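/- Let $s,N,\ell\in\mathbb N_0$, let $m$ be an integer with $|m|\ge 2$, and put $M=mI$, $E=\{0,\dots,|m|-1\}^s$. A mask is a family $\mathbf a=(a_\alpha)_{\alpha\in\mathbb Z^s}$ of real numbers with $a_\alpha=0$ for $\alpha\notin\{0,\dots,N\}^s$; its symbol is $a(z)=\sum_\alpha a_\alpha z^\alpha$ and its subdivision operator is $(S_{\mathbf a}c)(\alpha)=\sum_{\beta\in\mathbb Z^s}a_{\alpha-M\beta}\,c(\beta)$. The symbol satisfies sum rules of order $\ell+1$ if $a(1,\dots,1)=|m|^s$ and $D^\eta a(\xi)=0$ for all $\eta\in\mathbb N_0^s$ with $|\eta|\le\ell$ and all $\xi=(e^{-2\pi i\varepsilon_1/|m|},\dots,e^{-2\pi i\varepsilon_s/|m|})$, $\varepsilon\in E$, with $\xi\ne(1,\dots,1)$. Let $K$ be the (finite) set of all points of $\mathbb Z^s$ of the form $\sum_{r=1}^\infty M^{-r}g_r$ with $g_r\in\{-|m|,\dots,N+1\}^s$, and let $V_\ell\subset\mathbb R^K$ be the orthogonal complement of the span of the vectors $(p(\alpha))_{\alpha\in K}$, where $p$ runs through the polynomials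 of total degree at most $\ell$. A test function for $C^\ell$ is a compactly supported $f\in C^\ell(\mathbb R^s)$ satisfying the Strang–Fix conditions of order $\ell+1$: for each polynomial $p$ of degree at most $\ell$, $\sum_{\alpha\in\mathbb Z^s}p(\alpha)f(\cdot-\alpha)-p$ is a polynomial of degree smaller than that of $p$ (zero if $p$ is constant). A scheme $\{S_{\mathbf a^{(r)}}: r\ge 1\}$ is $C^\ell$-convergent if for every $c\in\ell_\infty(\mathbb Z^s)$ there is a limit $g_c\in C^\ell(\mathbb R^s)$ such that for every test function $f$ for $C^\ell$ $$\lim_{k\to\infty}\Big\|g_c-\sum_{\alpha\in\mathbb Z^s}\big(S_{\mathbf a^{(k)}}\cdots S_{\mathbf a^{(1)}}c\big)(\alpha)\,f(M^k\cdot-\alpha)\Big\|_{C^\ell}=0 .$$ The Hölder exponent of a $C^0$-convergent scheme is $n+\zeta$, where $n$ is the largest integer such that $g_c\in C^n(\mathbb R^s)$ for all $c\in\ell_\infty(\mathbb Z^s)$, and $\zeta$ is the supremum of all $\nu\in[0,1]$ such that for each $c$ there is a constant $C$ with $|D^\mu g_c(x)-D^\mu g_c(y)|\le C|x-y|^\nu$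 for all $x,y\in\mathbb R^s$ and $|\mu|=n$ (the exponent is $\infty$ if there is no largest $n$). **Theorem.** Let $-\infty<\omega_1<\omega_2<\infty$ and let $\mathbf a(\omega)$, $\omega\in[\omega_1,\omega_2]$, be masks (supported in $\{0,\dots,N\}^s$) that depend linearly on $\omega$, i.e. $a_\alpha(\omega)=b_\alpha+\omega d_\alpha$, and whose symbols $a(z,\omega)$ all satisfy sum rules of order $\ell+1$. Put $A_{\varepsilon,\omega}=(a_{M\alpha+\varepsilon-\beta}(\omega))_{\alpha,\beta\in K}$ for $\varepsilon\in E$; these matrices leave $V_\ell$ invariant. Suppose that the joint spectral radius $$\gamma=\lim_{n\to\infty}\max\big\{\|M_1\cdots M_n\|^{1/n}: M_1,\dots,M_n\in\{A_{\varepsilon,\omega_1}|_{V_\ell},A_{\varepsilon,\omega_2}|_{V_\ell}:\varepsilon\in E\}\big\}$$ satisfies $\gamma<|m|^{-\ell}$. Then, for every sequence $(\omega^{(r)})_{r\ge1}$ in $[\omega_1,\omega_2]$, the non-stationary scheme $\{S_{\mathbf a(\omega^{(r)})}: r\ge 1\}$ is $C^\ell$-convergent, and its Hölder exponent is at least $-\log_{|m|}\gamma$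 (read as $\infty$ if $\gamma=0$). -/

import Mathlib

open Filter Topology
open scoped ENNReal NNReal

noncomputable section

namespace Subdivision

/-- A mask, or more generally a real sequence indexed by `ℤ^s`. -/
abbrev Mask (s : ℕ) : Type := (Fin s → ℤ) → ℝ

/-- The space `ℝ^s` with its Euclidean norm. -/
abbrev Space (s : ℕ) : Type := EuclideanSpace ℝ (Fin s)

/-- The mask `a` vanishes outside `{0, …, N}^s`. -/
def SupportedIn {s : ℕ} (N : ℕ) (a : Mask s) : Prop :=
  ∀ α : Fin s → ℤ, a α ≠ 0 → ∀ i, 0 ≤ α i ∧ α i ≤ N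

/-- The coset representatives `E = {0, …, |m| - 1}^s` of `ℤ^s / m ℤ^s`. -/
def cosets (s : ℕ) (m : ℤ) : Finset (Fin s → ℤ) :=
  Fintype.piFinset fun _ => Finset.Ico 0 |m|

/-- `α` has an expansion `α = ∑_{r ≥ 1} m^{-r} g_r` with digits
`g_r ∈ G = {-|m|, …, N + 1}^s` (the digit `g_{r+1}` is called `g r`). -/
def HasExpansion {s : ℕ} (m : ℤ) (N : ℕ) (α : Fin s → ℤ) : Prop :=
  ∃ g : ℕ → Fin s → ℤ, (∀ r i, -|m| ≤ g r i ∧ g r i ≤ N + 1) ∧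
    ∀ i, HasSum (fun r => (g r i : ℝ) / (m : ℝ) ^ (r + 1)) (α i : ℝ)

open Classical in
/-- The index set `K`: all points of `ℤ^s` that lie in `∑_{r ≥ 1} m^{-r} G`. It is cut out of a large
box, so that it is visibly finite; `mem_indexSet` shows that the box loses nothing. -/
def indexSet (s : ℕ) (m : ℤ) (N : ℕ) : Finset (Fin s → ℤ) :=
  (Fintype.piFinset fun _ => Finset.Icc (-(|m| + N + 1)) (|m| + N + 1)).filter (HasExpansion m N)

theorem mem_indexSet {s : ℕ} {m : ℤ} (hm : 2 ≤ |m|) {N : ℕ} {α : Fin s → ℤ} :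
    α ∈ indexSet s m N ↔ HasExpansion m N α := by
  classical
  simp only [indexSet, Finset.mem_filter, Fintype.mem_piFinset, Finset.mem_Icc,
    and_iff_right_iff_imp]
  rintro ⟨g, hg, hs⟩ i
  have hm' : (2 : ℝ) ≤ |(m : ℝ)| := by exact_mod_cast hm
  have hb : HasSum (fun r : ℕ => ((|m| : ℤ) + N + 1 : ℝ) / 2 * (1 / 2) ^ r)
      (((|m| : ℤ) + N + 1 : ℝ) / 2 * 2) := hasSum_geometric_two.mul_left _
  have h := HasSum.norm_le_of_bounded (hs i) hb (fun r => by
    have h1 : |(g r i : ℝ)| ≤ ((|m| : ℤ) + N + 1 : ℝ) := by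
      have : |g r i| ≤ |m| + N + 1 := by
        have := hg r i
        rw [abs_le]; constructor <;> omega
      exact_mod_cast this
    rw [norm_div, norm_pow, Real.norm_eq_abs, Real.norm_eq_abs]
    have h2 : (2 : ℝ) ^ (r + 1) ≤ |(m : ℝ)| ^ (r + 1) := by gcongr
    calc |(g r i : ℝ)| / |(m : ℝ)| ^ (r + 1)
        ≤ ((|m| : ℤ) + N + 1 : ℝ) / 2 ^ (r + 1) := by
          gcongr
      _ = ((|m| : ℤ) + N + 1 : ℝ) / 2 * (1 / 2) ^ r := by
          rw [pow_succ]; field_simp; simp)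
  rw [Real.norm_eq_abs, div_mul_cancel₀ _ (two_ne_zero)] at h
  have h' : |α i| ≤ |m| + N + 1 := by exact_mod_cast h
  exact abs_le.mp h'

/-- The subdivision operator `(S_a c)(α) = ∑_β a(α - m β) c(β)`
(a finite sum for a mask with finite support and `m ≠ 0`). -/
def subdiv {s : ℕ} (m : ℤ) (a : Mask s) (c : Mask s) : Mask s :=
  fun α => ∑' β : Fin s → ℤ, a (fun i => α i - m * β i) * c β

/-- The data `S_{a^{(k)}} ⋯ S_{a^{(1)}} c` after `k` steps. -/
def iterate {s : ℕ} (m : ℤ) (a : ℕ → Mask s) (c : Mask s) : ℕ → Mask s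
  | 0 => c
  | k + 1 => subdiv m (a (k + 1)) (iterate m a c k)

/-- The matrix `A_ε = (a(m α + ε - β))_{α, β ∈ K}` of a mask. -/
def transitionMatrix {s : ℕ} (m : ℤ) (N : ℕ) (a : Mask s) (ε : Fin s → ℤ) :
    Matrix (indexSet s m N) (indexSet s m N) ℝ :=
  Matrix.of fun α β => a (fun i => m * α.1 i + ε i - β.1 i)

/-- The symbol `a(z) = ∑_α a_α z^α` of a mask supported in `{0, …, N}^s`. -/
def symbol {s : ℕ} (N : ℕ) (a : Mask s) : MvPolynomial (Fin s) ℂ :=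
  ∑ α ∈ Fintype.piFinset fun _ : Fin s => Finset.range (N + 1),
    MvPolynomial.monomial (Finsupp.equivFunOnFinite.symm α) ((a fun i => (α i : ℤ) : ℝ) : ℂ)

/-- The partial derivative `D^η = ∂^{η_1}/∂z_1^{η_1} ⋯ ∂^{η_s}/∂z_s^{η_s}`. -/
def partialDeriv {s : ℕ} (η : Fin s → ℕ) (p : MvPolynomial (Fin s) ℂ) : MvPolynomial (Fin s) ℂ :=
  (List.finRange s).foldr (fun i q => (MvPolynomial.pderiv i)^[η i] q) p

/-- The point `exp(-2πi ε / |m|)` of the torus. -/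
def rootPoint {s : ℕ} (m : ℤ) (ε : Fin s → ℤ) : Fin s → ℂ :=
  fun i => Complex.exp (-Complex.I * (2 * Real.pi / (|m| : ℤ)) * (ε i : ℂ))

/-- Sum rules of order `ℓ + 1` for the symbol of a mask supported in `{0, …, N}^s`. -/
def SumRules {s : ℕ} (m : ℤ) (N ℓ : ℕ) (a : Mask s) : Prop :=
  MvPolynomial.eval (fun _ => 1) (symbol N a) = ((|m| : ℤ) : ℂ) ^ s ∧
  ∀ η : Fin s → ℕ, ∑ i, η i ≤ ℓ → ∀ ε ∈ cosets s m, rootPoint m ε ≠ (fun _ => 1) →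
    MvPolynomial.eval (rootPoint m ε) (partialDeriv η (symbol N a)) = 0

/-- `V_ℓ ⊆ ℝ^K`: the orthogonal complement of the span of the vectors `(p(α))_{α ∈ K}`, where `p`
runs through the polynomials of total degree at most `ℓ`. -/
def diffSpace (s : ℕ) (m : ℤ) (N ℓ : ℕ) : Submodule ℝ (EuclideanSpace ℝ (indexSet s m N)) :=
  (Submodule.span ℝ {v | ∃ p : MvPolynomial (Fin s) ℝ, p.totalDegree ≤ ℓ ∧
    ∀ α : indexSet s m N, v α = MvPolynomial.eval (fun i => (α.1 i : ℝ)) p})ᗮ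

/-- `T : V → V` is the restriction of the matrix `A` to the subspace `V`. -/
def IsRestriction {ι : Type*} [Fintype ι] [DecidableEq ι] (A : Matrix ι ι ℝ)
    (V : Submodule ℝ (EuclideanSpace ℝ ι)) (T : V →L[ℝ] V) : Prop :=
  ∀ v : V, ((T v : V) : EuclideanSpace ℝ ι) = Matrix.toEuclideanLin A v

/-- The family of the restrictions `A_ε|_{V_ℓ}`, `ε ∈ E`, over all masks in the set `𝒜`. -/
def restrictedFamily {s : ℕ} (m : ℤ) (N ℓ : ℕ) (𝒜 : Set (Mask s)) :
    Set (diffSpace s m N ℓ →L[ℝ] diffSpace s m N ℓ) :=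
  {T | ∃ a ∈ 𝒜, ∃ ε ∈ cosets s m, IsRestriction (transitionMatrix m N a ε) (diffSpace s m N ℓ) T}

/-- The joint spectral radius
`ρ(𝓜) = lim_n sup {‖M_1 ⋯ M_n‖^{1/n} : M_1, …, M_n ∈ 𝓜}`. For a bounded family the limit exists
(submultiplicativity), and is then equal to the upper limit written here. -/
def jointSpectralRadius {R : Type*} [NormedRing R] (𝓜 : Set R) : ℝ≥0∞ :=
  limsup (fun n : ℕ => (⨆ (T : Fin n → R) (_ : ∀ i, T i ∈ 𝓜), ‖(List.ofFn T).prod‖ₑ) ^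
    (1 / (n : ℝ))) atTop

/-- The vector of `ℝ^s` with the integer coordinates `α`. -/
def intVec {s : ℕ} (α : Fin s → ℤ) : Space s := WithLp.toLp 2 fun i => (α i : ℝ)

/-- Test functions for convergence in `C^ℓ`: compactly supported, of class `C^ℓ`, and with the
Strang–Fix conditions of order `ℓ + 1`, i.e. for each polynomial `p` of total degree at most `ℓ`,
`∑_α p(α) f(· - α)` is `p` plus a polynomial of smaller degree (plus `0` if `p` is constant). -/
structure IsTestFunction {s : ℕ} (ℓ : ℕ) (f : Space s → ℝ) : Prop where
  contDiff : ContDiff ℝ ℓ f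
  hasCompactSupport : HasCompactSupport f
  strangFix : ∀ p : MvPolynomial (Fin s) ℝ, p.totalDegree ≤ ℓ →
    ∃ q : MvPolynomial (Fin s) ℝ, (q = 0 ∨ q.totalDegree < p.totalDegree) ∧
      ∀ x : Space s, ∑' α : Fin s → ℤ,
        MvPolynomial.eval (fun i => (α i : ℝ)) p * f (x - intVec α) =
          MvPolynomial.eval (fun i => x i) (p + q)

/-- The function `x ↦ ∑_α (S_{a^{(k)}} ⋯ S_{a^{(1)}} c)(α) f(m^k x - α)`
(for `f` with compact support, a finite sum at each `x`). -/
def approximant {s : ℕ} (m : ℤ) (a : ℕ → Mask s) (c : Mask s) (f : Space s → ℝ) (k : ℕ) :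
    Space s → ℝ :=
  fun x => ∑' α : Fin s → ℤ, iterate m a c k α * f ((m : ℝ) ^ k • x - intVec α)

/-- `c ∈ ℓ_∞(ℤ^s)`. -/
def IsBoundedSeq {s : ℕ} (c : Mask s) : Prop := ∃ C : ℝ, ∀ α, |c α| ≤ C

/-- `g ∈ C^ℓ(ℝ^s)` is the `C^ℓ`-limit of the scheme started from `c`: for every test function, the
approximants converge to `g` in the `C^ℓ`-norm, i.e. uniformly on `ℝ^s` with all derivatives of
orders `0, …, ℓ`. -/
def IsLimit {s : ℕ} (m : ℤ) (ℓ : ℕ) (a : ℕ → Mask s) (c : Mask s) (g : Space s → ℝ) : Prop :=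
  ContDiff ℝ ℓ g ∧ ∀ f : Space s → ℝ, IsTestFunction ℓ f → ∀ j ≤ ℓ,
    TendstoUniformly (fun k x => iteratedFDeriv ℝ j (approximant m a c f k) x)
      (iteratedFDeriv ℝ j g) atTop

/-- `C^ℓ`-convergence of the scheme `{S_{a^{(r)}} : r ≥ 1}`. -/
def IsConvergent {s : ℕ} (m : ℤ) (ℓ : ℕ) (a : ℕ → Mask s) : Prop :=
  ∀ c : Mask s, IsBoundedSeq c → ∃ g, IsLimit m ℓ a c g

/-- The limit functions (in the sense of `C^0`-convergence) of the scheme. -/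
def limitFunctions {s : ℕ} (m : ℤ) (a : ℕ → Mask s) : Set (Space s → ℝ) :=
  {g | ∃ c : Mask s, IsBoundedSeq c ∧ IsLimit m 0 a c g}

/-- The derivatives of order `n` of `g` are Hölder continuous with exponent `ν`. -/
def HolderDeriv {s : ℕ} (n : ℕ) (ν : ℝ) (g : Space s → ℝ) : Prop :=
  ∃ C : ℝ, ∀ x y, ‖iteratedFDeriv ℝ n g x - iteratedFDeriv ℝ n g y‖ ≤ C * ‖x - y‖ ^ ν

/-- The Hölder exponent of the scheme: `n + ζ`, where `n` is the largest integer such that all limit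
functions are in `C^n` and `ζ` is the supremum of all `ν ∈ [0, 1]` such that the derivatives of
order `n` of all limit functions are `ν`-Hölder. (A smaller `n` contributes at most the next integer
to the outer supremum; the value is `∞` if there is no largest `n`.) -/
def holderExponent {s : ℕ} (m : ℤ) (a : ℕ → Mask s) : ℝ≥0∞ :=
  ⨆ (n : ℕ) (_ : ∀ g ∈ limitFunctions m a, ContDiff ℝ n g),
    ((n : ℝ≥0∞) + ⨆ (ν : ℝ≥0) (_ : ν ≤ 1 ∧ ∀ g ∈ limitFunctions m a, HolderDeriv n ν g),
      (ν : ℝ≥0∞))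

end Subdivision

end

noncomputable section

namespace Subdivision

/-! Everything is done by duality. Paired with a finitely supported sequence `u`, one subdivision
step becomes a transfer operator `T_ε` applied to `u` (`pairing_subdiv`), so `k` steps are governed
by words of length `k` in the transfer operators (`pairing_iterate`). By finite Fourier analysis,
sum rules say that all cosets of `mℤ^s` carry the same share of each moment up to order `ℓ`
(`SumRules.reproducing`). Hence `T_ε` preserves the sequences annihilating polynomials of degree `<
d` for `d ≤ ℓ + 1`, and for `d ≤ ℓ` it acts on them as `m^{-d}` modulo the next smaller annihilator.

The matrices on `V_ℓ` are the `T_ε` on annihilating sequences supported in `K`. Three facts turn the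
spectral hypothesis into decay. Each mask of the family is a convex combination of the two end
masks, and a product bound depending only on the length passes to convex combinations, one factor at
a time (`norm_prod_le_of_segment`). Transfer operators contract supports into `K`, so any rate `ρ >
γ` holds for all supports in a bounded region (`decays_of_indexSet`). Descending in `d`, the larger
annihilators with `d ≤ ℓ` decay with rate `|m|^{-d}` (`Decays.of_le`).

The `j`-th derivative of an approximant is `m^{kj}` times the pairing of the data with a window of
values of `D^j f`. By Strang–Fix, the moments of order at most `j` of such a window depend neither
on `f` nor on the base point (`IsTestFunction.pairing_window`). So differences between consecutive
levels, or between two test functions, come from annihilating sequences and decay like `(|m|^j r)^k`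
with `|m|^j r < 1`. This gives a `C^ℓ` limit that is independent of the test function
(`exists_isLimit`).

For regularity, the smooth test function `testBump` is used: derivatives of order `ℓ + 1` are
`O((|m|^{ℓ+1} ρ)^k)`, and interpolation with the `O((|m|^ℓ ρ)^k)` increments of order `ℓ` yields
every Hölder exponent `ν ≤ 1` with `|m|^{ℓ+ν} ρ < 1` (`IsLimit.holderDeriv`). In positive dimension
`γ ≥ |m|^{-(ℓ+1)}` (`Decays.inv_pow_le`), so `-log_{|m|} γ` lies in `[ℓ, ℓ + 1]` and derivatives of
order `ℓ` suffice to reach it. -/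

variable {s : ℕ}

/-! ### Finitely supported sequences on `ℤ^s` -/

/-- Finitely supported real sequences on `ℤ^s`. -/
abbrev FinSeq (s : ℕ) : Type := (Fin s → ℤ) →₀ ℝ

/-- The pairing `∑_κ u(κ) F(κ)`. -/
def pairing (F : Mask s) : FinSeq s →ₗ[ℝ] ℝ := Finsupp.linearCombination ℝ F

@[simp] theorem pairing_single (F : Mask s) (κ : Fin s → ℤ) (x : ℝ) :
    pairing F (Finsupp.single κ x) = x * F κ := by
  simp [pairing]

theorem pairing_add_left (F G : Mask s) (u : FinSeq s) :
    pairing (fun κ => F κ + G κ) u = pairing F u + pairing G u := by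
  simp [pairing, Finsupp.linearCombination_apply, Finsupp.sum, mul_add, Finset.sum_add_distrib]

theorem pairing_mul_left (c : ℝ) (F : Mask s) (u : FinSeq s) :
    pairing (fun κ => c * F κ) u = c * pairing F u := by
  simp [pairing, Finsupp.linearCombination_apply, Finsupp.sum, Finset.mul_sum, mul_left_comm]

theorem pairing_sum_left {ι : Type*} (S : Finset ι) (F : ι → Mask s) (u : FinSeq s) :
    pairing (fun κ => ∑ i ∈ S, F i κ) u = ∑ i ∈ S, pairing (F i) u := by
  simp only [pairing, Finsupp.linearCombination_apply, Finsupp.sum, smul_eq_mul, Finset.mul_sum]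
  exact Finset.sum_comm

/-- The `ℓ_1`-norm. -/
def l1 (u : FinSeq s) : ℝ := u.sum fun _ x => |x|

theorem l1_nonneg (u : FinSeq s) : 0 ≤ l1 u := Finset.sum_nonneg fun _ _ => abs_nonneg _

@[simp] theorem l1_zero : l1 (0 : FinSeq s) = 0 := by simp [l1]

@[simp] theorem l1_single (κ : Fin s → ℤ) (x : ℝ) : l1 (Finsupp.single κ x) = |x| := by
  simp [l1]

theorem l1_eq_sum {u : FinSeq s} {S : Finset (Fin s → ℤ)} (h : u.support ⊆ S) :
    l1 u = ∑ κ ∈ S, |u κ| :=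
  Finsupp.sum_of_support_subset _ h _ (by simp)

theorem l1_add_le (u v : FinSeq s) : l1 (u + v) ≤ l1 u + l1 v := by
  classical
  have hu : u.support ⊆ u.support ∪ v.support := Finset.subset_union_left
  have hv : v.support ⊆ u.support ∪ v.support := Finset.subset_union_right
  rw [l1_eq_sum hu, l1_eq_sum hv, l1_eq_sum Finsupp.support_add, ← Finset.sum_add_distrib]
  exact Finset.sum_le_sum fun κ _ => abs_add_le _ _

theorem l1_smul (c : ℝ) (u : FinSeq s) : l1 (c • u) = |c| * l1 u := by
  rw [l1_eq_sum (Finsupp.support_smul : (c • u).support ⊆ u.support), l1_eq_sum subset_rfl,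
    Finset.mul_sum]
  simp [abs_mul]

theorem l1_sum_le {ι : Type*} (S : Finset ι) (u : ι → FinSeq s) :
    l1 (∑ i ∈ S, u i) ≤ ∑ i ∈ S, l1 (u i) := by
  classical
  induction S using Finset.induction_on with
  | empty => simp
  | insert i S hi ih =>
    rw [Finset.sum_insert hi, Finset.sum_insert hi]
    exact (l1_add_le _ _).trans (by gcongr)

theorem abs_pairing_le {F : Mask s} {u : FinSeq s} {C : ℝ} (hF : ∀ κ ∈ u.support, |F κ| ≤ C) :
    |pairing F u| ≤ C * l1 u := by
  simp only [pairing, Finsupp.linearCombination_apply, Finsupp.sum, l1, Finset.mul_sum]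
  refine (Finset.abs_sum_le_sum_abs _ _).trans (Finset.sum_le_sum fun κ hκ => ?_)
  rw [smul_eq_mul, abs_mul, mul_comm]
  exact mul_le_mul_of_nonneg_right (hF κ hκ) (abs_nonneg _)

theorem l1_linearCombination_le {g : (Fin s → ℤ) → FinSeq s} {B : ℝ} (hg : ∀ κ, l1 (g κ) ≤ B)
    (u : FinSeq s) : l1 (Finsupp.linearCombination ℝ g u) ≤ B * l1 u := by
  rw [Finsupp.linearCombination_apply, Finsupp.sum]
  refine (l1_sum_le _ _).trans ?_
  rw [l1, Finsupp.sum, Finset.mul_sum]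
  refine Finset.sum_le_sum fun κ _ => ?_
  rw [l1_smul, mul_comm]
  exact mul_le_mul_of_nonneg_right (hg κ) (abs_nonneg _)

/-! ### The transfer operator -/

/-- The index box `{0, …, N}^s`. -/
def maskBox (s N : ℕ) : Finset (Fin s → ℤ) := Fintype.piFinset fun _ => Finset.Icc 0 (N : ℤ)

theorem mem_maskBox {N : ℕ} {γ : Fin s → ℤ} : γ ∈ maskBox s N ↔ ∀ i, 0 ≤ γ i ∧ γ i ≤ N := by
  simp [maskBox]

/-- The operator `(T u)(β) = ∑_κ a(m β + ε - κ) u(κ)` on finitely supported sequences. -/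
def transfer (m : ℤ) (N : ℕ) (a : Mask s) (ε : Fin s → ℤ) : FinSeq s →ₗ[ℝ] FinSeq s :=
  Finsupp.linearCombination ℝ fun κ => ∑ γ ∈ maskBox s N,
    if ∀ i, m ∣ γ i - (ε i - κ i) then
      Finsupp.single (fun i => (γ i - (ε i - κ i)) / m) (a γ) else 0

/-- The adjoint of the transfer operator. Summing over the finite mask box, with a divisibility
condition, avoids any infinite sum over `β`. -/
theorem pairing_transfer (m : ℤ) (N : ℕ) (a : Mask s) (ε : Fin s → ℤ) (F : Mask s) (u : FinSeq s) :
    pairing F (transfer m N a ε u) = pairing (fun κ => ∑ γ ∈ maskBox s N,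
      if ∀ i, m ∣ γ i - (ε i - κ i) then a γ * F (fun i => (γ i - (ε i - κ i)) / m) else 0) u := by
  induction u using Finsupp.induction_linear with
  | zero => simp
  | add u v hu hv => simp only [map_add, hu, hv]
  | single κ x =>
    simp only [transfer, Finsupp.linearCombination_single, map_smul, map_sum, pairing_single,
      smul_eq_mul]
    congr 1
    refine Finset.sum_congr rfl fun γ _ => ?_
    split_ifs <;> simp

theorem l1_transfer_le (m : ℤ) (N : ℕ) (a : Mask s) (ε : Fin s → ℤ) (u : FinSeq s) :
    l1 (transfer m N a ε u) ≤ (∑ γ ∈ maskBox s N, |a γ|) * l1 u := by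
  refine l1_linearCombination_le (fun κ => (l1_sum_le _ _).trans
    (Finset.sum_le_sum fun γ _ => ?_)) u
  split_ifs <;> simp

theorem exists_of_mem_support_transfer {m : ℤ} {N : ℕ} {a : Mask s} {ε : Fin s → ℤ} {u : FinSeq s}
    {β : Fin s → ℤ} (hβ : β ∈ (transfer m N a ε u).support) :
    ∃ κ ∈ u.support, ∃ γ ∈ maskBox s N, ∀ i, m * β i = γ i - (ε i - κ i) := by
  classical
  rw [transfer, Finsupp.linearCombination_apply, Finsupp.sum] at hβ
  obtain ⟨κ, hκ, h⟩ := Finset.mem_biUnion.1 (Finsupp.support_finsetSum hβ)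
  obtain ⟨γ, hγ, h⟩ := Finset.mem_biUnion.1
    (Finsupp.support_finsetSum (Finsupp.support_smul h))
  refine ⟨κ, hκ, γ, hγ, fun i => ?_⟩
  split_ifs at h with hd
  · rw [Finset.mem_singleton.1 (Finsupp.support_single_subset h)]
    exact Int.mul_ediv_cancel' (hd i)
  · simp at h

/-- The substitution `γ = mβ + δ` is injective and hits exactly the `γ ≡ δ` modulo `m`; only those
in the mask box contribute. -/
theorem tsum_mask_mul {m : ℤ} (hm : m ≠ 0) {N : ℕ} {a : Mask s} (ha : SupportedIn N a)
    (δ : Fin s → ℤ) (F : Mask s) :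
    ∑' β : Fin s → ℤ, a (fun i => m * β i + δ i) * F β = ∑ γ ∈ maskBox s N,
      if ∀ i, m ∣ γ i - δ i then a γ * F (fun i => (γ i - δ i) / m) else 0 := by
  classical
  have hinj : ∀ β : Fin s → ℤ, (fun i => (m * β i + δ i - δ i) / m) = β := fun β => by
    funext i; rw [add_sub_cancel_right, Int.mul_ediv_cancel_left _ hm]
  rw [← Finset.sum_filter, tsum_eq_sum (s := ((maskBox s N).filter
    fun γ => ∀ i, m ∣ γ i - δ i).image fun γ i => (γ i - δ i) / m)]
  · have hcan : ∀ γ ∈ (maskBox s N).filter fun γ => ∀ i, m ∣ γ i - δ i,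
        (fun i => m * ((γ i - δ i) / m) + δ i) = γ := fun γ hγ => by
      funext i
      rw [Int.mul_ediv_cancel' ((Finset.mem_filter.1 hγ).2 i), sub_add_cancel]
    rw [Finset.sum_image]
    · exact Finset.sum_congr rfl fun γ hγ => by rw [hcan γ hγ]
    · intro γ hγ γ' hγ' h
      rw [← hcan γ hγ, ← hcan γ' hγ']
      funext i
      simp only [congrFun h i]
  · intro β hβ
    by_contra hne
    refine hβ (Finset.mem_image.2 ⟨fun i => m * β i + δ i, Finset.mem_filter.2 ⟨?_, ?_⟩, hinj β⟩)
    · exact mem_maskBox.2 (ha _ (left_ne_zero_of_mul hne))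
    · intro i; simp

theorem transfer_apply {m : ℤ} (hm : m ≠ 0) {N : ℕ} {a : Mask s} (ha : SupportedIn N a)
    (ε : Fin s → ℤ) (u : FinSeq s) (β : Fin s → ℤ) :
    transfer m N a ε u β = u.sum fun κ x => x * a (fun i => m * β i + ε i - κ i) := by
  classical
  have h1 : transfer m N a ε u β = pairing (Pi.single β 1) (transfer m N a ε u) := by
    simp only [pairing, Finsupp.linearCombination_apply, Finsupp.sum, smul_eq_mul, Pi.single_apply,
      mul_ite, mul_one, mul_zero, Finset.sum_ite_eq', Finsupp.mem_support_iff, ne_eq, ite_not]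
    split_ifs with h <;> simp [h]
  rw [h1, pairing_transfer, pairing, Finsupp.linearCombination_apply]
  refine Finset.sum_congr rfl fun κ _ => ?_
  have := tsum_mask_mul hm ha (fun i => ε i - κ i) (Pi.single β 1)
  dsimp only at this ⊢
  rw [← this, tsum_eq_single β]
  · simp [add_sub_assoc]
  · intro β' h; simp [h]

/-- One subdivision step, seen through the pairing with a finitely supported sequence. -/
theorem pairing_subdiv {m : ℤ} (hm : m ≠ 0) {N : ℕ} {a : Mask s} (ha : SupportedIn N a)
    (c : Mask s) (γ ε : Fin s → ℤ) (u : FinSeq s) :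
    pairing (fun κ => subdiv m a c (fun i => m * γ i + ε i - κ i)) u =
      pairing (fun κ => c (fun i => γ i - κ i)) (transfer m N a ε u) := by
  rw [pairing_transfer]
  congr 2
  funext κ
  -- The reflection `β ↦ γ - β` turns the mask argument `mγ + ε - κ - mβ` of subdivision into the
  -- argument `mβ + ε - κ` of the transfer operator.
  rw [← tsum_mask_mul hm ha (fun i => ε i - κ i) (fun β => c (fun i => γ i - β i)), subdiv,
    ← (Equiv.subLeft γ).tsum_eq]
  refine tsum_congr fun β => ?_
  simp only [Equiv.subLeft_apply, Pi.sub_apply]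
  congr 2
  · funext i; ring

/-! ### Polynomials of degree smaller than `d` and their annihilators -/

/-- Polynomials all of whose monomials have degree smaller than `d`. -/
def polyLT (s d : ℕ) : Submodule ℝ (MvPolynomial (Fin s) ℝ) :=
  MvPolynomial.restrictSupport ℝ {n | n.degree < d}

theorem mem_polyLT {d : ℕ} {p : MvPolynomial (Fin s) ℝ} :
    p ∈ polyLT s d ↔ ∀ n ∈ p.support, n.degree < d :=
  MvPolynomial.mem_restrictSupport_iff ℝ

theorem mem_polyLT_succ {d : ℕ} {p : MvPolynomial (Fin s) ℝ} :
    p ∈ polyLT s (d + 1) ↔ p.totalDegree ≤ d := by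
  rw [mem_polyLT, MvPolynomial.totalDegree, Finset.sup_le_iff]
  refine forall₂_congr fun n _ => ?_
  rw [Nat.lt_succ_iff]; rfl

theorem mem_polyLT_of_lt {d : ℕ} {p : MvPolynomial (Fin s) ℝ} (h : p.totalDegree < d) :
    p ∈ polyLT s d := by
  obtain ⟨d, rfl⟩ := Nat.exists_eq_succ_of_ne_zero (Nat.ne_zero_of_lt h)
  exact mem_polyLT_succ.2 (Nat.lt_succ_iff.1 h)

theorem polyLT_mono {d e : ℕ} (h : d ≤ e) : polyLT s d ≤ polyLT s e := fun _ hp =>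
  mem_polyLT.2 fun n hn => (mem_polyLT.1 hp n hn).trans_le h

theorem polyLT_induction {d : ℕ} {P : MvPolynomial (Fin s) ℝ → Prop} (h0 : P 0)
    (hadd : ∀ p q, P p → P q → P (p + q))
    (hmon : ∀ n c, n.degree < d → P (MvPolynomial.monomial n c))
    {p : MvPolynomial (Fin s) ℝ} (hp : p ∈ polyLT s d) : P p := by
  rw [p.as_sum]
  exact Finset.sum_induction _ P hadd h0 fun n hn => hmon n _ (mem_polyLT.1 hp n hn)

theorem X_mul_mem_polyLT {d : ℕ} {p : MvPolynomial (Fin s) ℝ} (hp : p ∈ polyLT s d) (i : Fin s) :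
    MvPolynomial.X i * p ∈ polyLT s (d + 1) := by
  classical
  rw [mem_polyLT] at hp ⊢
  intro n hn
  rw [mul_comm, MvPolynomial.support_mul_X] at hn
  obtain ⟨k, hk, rfl⟩ := Finset.mem_map.1 hn
  have := hp k hk
  simp only [addRightEmbedding_apply, map_add, Finsupp.degree_single]
  omega

theorem C_mul_mem_polyLT {d : ℕ} {p : MvPolynomial (Fin s) ℝ} (hp : p ∈ polyLT s d) (c : ℝ) :
    MvPolynomial.C c * p ∈ polyLT s d := by
  rw [MvPolynomial.C_mul']; exact Submodule.smul_mem _ _ hp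

/-- The polynomial `p(t (x + v))`. -/
def affineSubst (t : ℝ) (v : Fin s → ℝ) : MvPolynomial (Fin s) ℝ →ₐ[ℝ] MvPolynomial (Fin s) ℝ :=
  MvPolynomial.bind₁ fun i => MvPolynomial.C t * (MvPolynomial.X i + MvPolynomial.C (v i))

theorem eval_affineSubst (t : ℝ) (v x : Fin s → ℝ) (p : MvPolynomial (Fin s) ℝ) :
    MvPolynomial.eval x (affineSubst t v p) = MvPolynomial.eval (fun i => t * (x i + v i)) p := by
  simp only [affineSubst, MvPolynomial.eval, MvPolynomial.eval₂Hom_bind₁]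
  congr 2
  funext i
  simp

/-- A dilation by `t` multiplies the part of degree `d` by `t^d`, and a translation changes only
lower-degree terms. For monomials this is an induction splitting off one variable at a time;
monomials of degree below `d` are harmless because the substitution does not raise degrees. -/
theorem affineSubst_sub_mem {d : ℕ} (t : ℝ) (v : Fin s → ℝ) {p : MvPolynomial (Fin s) ℝ}
    (hp : p ∈ polyLT s (d + 1)) :
    affineSubst t v p - MvPolynomial.C (t ^ d) * p ∈ polyLT s d := by
  have key : ∀ e : ℕ, ∀ n : Fin s →₀ ℕ, n.degree = e → ∀ c : ℝ,
      affineSubst t v (MvPolynomial.monomial n c) -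
        MvPolynomial.C (t ^ e) * MvPolynomial.monomial n c ∈ polyLT s e := by
    intro e
    induction e with
    | zero =>
      intro n hn c
      have : n = 0 := (Finsupp.degree_eq_zero_iff n).1 hn
      subst this
      have h1 : affineSubst t v (MvPolynomial.monomial 0 c) = MvPolynomial.monomial 0 c := by
        simp
      rw [h1]; simp
    | succ e ih =>
      intro n hn c
      obtain ⟨i, hi⟩ : ∃ i, n i ≠ 0 := by
        by_contra! h
        have : n = 0 := Finsupp.ext h
        simp [this] at hn
      obtain ⟨k, rfl⟩ : ∃ k, n = k + Finsupp.single i 1 :=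
        ⟨n - Finsupp.single i 1, (tsub_add_cancel_of_le (Finsupp.single_le_iff.2
          (Nat.one_le_iff_ne_zero.2 hi))).symm⟩
      have hk : k.degree = e := by simpa using hn
      have hmul : MvPolynomial.monomial (k + Finsupp.single i 1) c =
          MvPolynomial.X i * (MvPolynomial.monomial k c : MvPolynomial (Fin s) ℝ) := by
        rw [mul_comm, MvPolynomial.X, MvPolynomial.monomial_mul, mul_one]
      have hr := ih k hk c
      set q := (MvPolynomial.monomial k c : MvPolynomial (Fin s) ℝ)
      have hq : q ∈ polyLT s (e + 1) := by
        rw [polyLT, MvPolynomial.monomial_mem_restrictSupport]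
        left; simp [hk]
      set r := affineSubst t v q - MvPolynomial.C (t ^ e) * q with hrdef
      have hX : affineSubst t v (MvPolynomial.X i) =
          MvPolynomial.C t * (MvPolynomial.X i + MvPolynomial.C (v i)) := by
        simp [affineSubst]
      have : affineSubst t v (MvPolynomial.X i * q) -
          MvPolynomial.C (t ^ (e + 1)) * (MvPolynomial.X i * q) =
          MvPolynomial.C t * (MvPolynomial.X i * r) +
            MvPolynomial.C (t * v i) * (r + MvPolynomial.C (t ^ e) * q) := by
        rw [map_mul, hX, hrdef, map_mul, pow_succ, map_mul]
        ring
      rw [hmul, this]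
      exact Submodule.add_mem _ (C_mul_mem_polyLT (X_mul_mem_polyLT hr i) _)
        (C_mul_mem_polyLT (Submodule.add_mem _ (polyLT_mono e.le_succ hr)
          (C_mul_mem_polyLT hq _)) _)
  refine polyLT_induction (P := fun p => affineSubst t v p - MvPolynomial.C (t ^ d) * p ∈ polyLT s d)
    (by simp) (fun _ _ h1 h2 => ?_) (fun n c hn => ?_) hp
  · have := Submodule.add_mem _ h1 h2
    rwa [sub_add_sub_comm, ← map_add, ← mul_add] at this
  · rcases (Nat.lt_succ_iff.1 hn).eq_or_lt with h | h
    · exact key d n h c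
    · have hm : MvPolynomial.monomial n c ∈ polyLT s d := by
        rw [polyLT, MvPolynomial.monomial_mem_restrictSupport]
        exact Or.inl h
      have hm' : MvPolynomial.monomial n c ∈ polyLT s (n.degree + 1) := by
        rw [polyLT, MvPolynomial.monomial_mem_restrictSupport]
        exact Or.inl (Nat.lt_succ_self _)
      have h2 : affineSubst t v (MvPolynomial.monomial n c) ∈ polyLT s d := by
        have := Submodule.add_mem _ (polyLT_mono h.le (key _ n rfl c))
          (C_mul_mem_polyLT hm (t ^ n.degree))
        rwa [sub_add_cancel] at this
      exact Submodule.sub_mem _ h2 (C_mul_mem_polyLT hm _)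

theorem affineSubst_mem {d : ℕ} (t : ℝ) (v : Fin s → ℝ) {p : MvPolynomial (Fin s) ℝ}
    (hp : p ∈ polyLT s d) : affineSubst t v p ∈ polyLT s d := by
  have := Submodule.add_mem _ (affineSubst_sub_mem t v (polyLT_mono d.le_succ hp))
    (C_mul_mem_polyLT hp (t ^ d))
  rwa [sub_add_cancel] at this

/-- The restriction of a polynomial to `ℤ^s`. -/
def evalInt (p : MvPolynomial (Fin s) ℝ) : Mask s := fun α => MvPolynomial.eval (fun i => (α i : ℝ)) p

theorem pairing_evalInt_add (p q : MvPolynomial (Fin s) ℝ) (u : FinSeq s) :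
    pairing (evalInt (p + q)) u = pairing (evalInt p) u + pairing (evalInt q) u := by
  rw [← pairing_add_left]; congr 2; funext κ; simp [evalInt]

theorem pairing_evalInt_C_mul (c : ℝ) (p : MvPolynomial (Fin s) ℝ) (u : FinSeq s) :
    pairing (evalInt (MvPolynomial.C c * p)) u = c * pairing (evalInt p) u := by
  rw [← pairing_mul_left]; congr 2; funext κ; simp [evalInt]

/-- The sequences that annihilate all polynomials of degree smaller than `d`. -/
def annihilator (s d : ℕ) : Submodule ℝ (FinSeq s) where
  carrier := {u | ∀ p ∈ polyLT s d, pairing (evalInt p) u = 0}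
  zero_mem' := by intro p _; simp
  add_mem' := by intro u v hu hv p hp; rw [map_add, hu p hp, hv p hp, add_zero]
  smul_mem' := by intro c u hu p hp; rw [map_smul, hu p hp, smul_zero]

theorem mem_annihilator {d : ℕ} {u : FinSeq s} :
    u ∈ annihilator s d ↔ ∀ p ∈ polyLT s d, pairing (evalInt p) u = 0 := Iff.rfl

/-- The consequences of sum rules of order `ℓ + 1` that are used below: on each coset of `m ℤ^s` the
mask has the same moments up to order `ℓ`. -/
structure Reproducing (m : ℤ) (N ℓ : ℕ) (a : Mask s) : Prop where
  supported : SupportedIn N a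
  sum_eq : ∑ γ ∈ maskBox s N, a γ = (|m| : ℝ) ^ s
  coset_sum : ∀ p ∈ polyLT s (ℓ + 1), ∀ δ : Fin s → ℤ,
    (∑ γ ∈ maskBox s N, if ∀ i, m ∣ γ i - δ i then a γ * evalInt p γ else 0) =
      ((|m| : ℝ) ^ s)⁻¹ * ∑ γ ∈ maskBox s N, a γ * evalInt p γ

/-- The transfer operator of a mask with sum rules multiplies leading parts by `m^{-d}`. -/
theorem Reproducing.pairing_transfer {m : ℤ} (hm : m ≠ 0) {N ℓ : ℕ} {a : Mask s}
    (ha : Reproducing m N ℓ a) (ε : Fin s → ℤ) {d : ℕ} (hd : d ≤ ℓ)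
    {p : MvPolynomial (Fin s) ℝ} (hp : p ∈ polyLT s (d + 1)) :
    ∃ r ∈ polyLT s d, ∀ u : FinSeq s, pairing (evalInt p) (transfer m N a ε u) =
      ((m : ℝ) ^ d)⁻¹ * pairing (evalInt p) u + pairing (evalInt r) u := by
  have hmR : (m : ℝ) ≠ 0 := by exact_mod_cast hm
  have hM : (|m| : ℝ) ^ s ≠ 0 := by positivity
  -- The pairing a priori involves only the `γ` in the coset of `ε - κ`. Equal coset moments replace
  -- this by an average over all `γ`, which is polynomial in `κ`. The weights sum to `1`, so its
  -- part of degree `d` is that of `m^{-d} p`.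
  set q : MvPolynomial (Fin s) ℝ := ∑ γ ∈ maskBox s N, MvPolynomial.C (((|m| : ℝ) ^ s)⁻¹ * a γ) *
    affineSubst (m : ℝ)⁻¹ (fun i => (γ i : ℝ) - ε i) p with hq
  refine ⟨q - MvPolynomial.C (((m : ℝ) ^ d)⁻¹) * p, ?_, fun u => ?_⟩
  · have h1 : MvPolynomial.C (((m : ℝ) ^ d)⁻¹) * p = ∑ γ ∈ maskBox s N,
        MvPolynomial.C (((|m| : ℝ) ^ s)⁻¹ * a γ) * (MvPolynomial.C ((m : ℝ)⁻¹ ^ d) * p) := by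
      rw [← Finset.sum_mul, ← map_sum, ← Finset.mul_sum, ha.sum_eq, inv_mul_cancel₀ hM, map_one,
        one_mul, inv_pow]
    rw [h1, hq, ← Finset.sum_sub_distrib]
    refine Submodule.sum_mem _ fun γ _ => ?_
    rw [← mul_sub]
    exact C_mul_mem_polyLT (affineSubst_sub_mem _ _ hp) _
  · rw [← pairing_evalInt_C_mul, ← pairing_evalInt_add, add_sub_cancel, Subdivision.pairing_transfer]
    congr 2
    funext κ
    have h2 := ha.coset_sum (affineSubst (m : ℝ)⁻¹ (fun i => (κ i : ℝ) - ε i) p)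
      (polyLT_mono (by omega) (affineSubst_mem _ _ hp)) (fun i => ε i - κ i)
    have h3 : ∀ γ ∈ maskBox s N, (if ∀ i, m ∣ γ i - (ε i - κ i) then
        a γ * evalInt p (fun i => (γ i - (ε i - κ i)) / m) else 0) =
        if ∀ i, m ∣ γ i - (ε i - κ i) then
        a γ * evalInt (affineSubst (m : ℝ)⁻¹ (fun i => (κ i : ℝ) - ε i) p) γ else 0 := by
      intro γ _
      split_ifs with h
      · rw [evalInt, evalInt, eval_affineSubst]
        congr 3
        funext i
        rw [Int.cast_div (h i) hmR]
        push_cast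
        field_simp
        ring
      · rfl
    rw [Finset.sum_congr rfl h3, h2, hq, evalInt, map_sum, Finset.mul_sum]
    refine Finset.sum_congr rfl fun γ _ => ?_
    rw [evalInt, map_mul, eval_affineSubst, eval_affineSubst, MvPolynomial.eval_C, ← mul_assoc]
    congr 3
    funext i
    ring

/-- For `d ≥ 1`, apply the leading-part formula in degree `d - 1 ≤ ℓ`: both the polynomial and its
remainder lie in the annihilated range. This is why the range includes `d = ℓ + 1`. -/
theorem Reproducing.transfer_mem {m : ℤ} (hm : m ≠ 0) {N ℓ : ℕ} {a : Mask s}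
    (ha : Reproducing m N ℓ a) (ε : Fin s → ℤ) {d : ℕ} (hd : d ≤ ℓ + 1) {u : FinSeq s}
    (hu : u ∈ annihilator s d) : transfer m N a ε u ∈ annihilator s d := by
  intro p hp
  rcases d with _ | d
  · have : p = 0 := by
      rw [← MvPolynomial.support_eq_empty, Finset.eq_empty_iff_forall_notMem]
      exact fun n hn => absurd (mem_polyLT.1 hp n hn) (Nat.not_lt_zero _)
    have h0 := pairing_evalInt_C_mul 0 p (transfer m N a ε u)
    rw [map_zero, zero_mul, zero_mul] at h0
    rw [this, h0]
  · obtain ⟨r, hr, h⟩ := ha.pairing_transfer hm ε (Nat.succ_le_succ_iff.1 hd) hp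
    rw [h, hu p hp, hu r (polyLT_mono d.le_succ hr), mul_zero, add_zero]

/-- On this annihilator the lower-order remainder of the moment formula drops out, leaving the
scalar `m^{-d}` on moments of order `d`. This drives the descent from `d + 1` to `d`. -/
theorem Reproducing.transfer_sub_mem {m : ℤ} (hm : m ≠ 0) {N ℓ : ℕ} {a : Mask s}
    (ha : Reproducing m N ℓ a) (ε : Fin s → ℤ) {d : ℕ} (hd : d ≤ ℓ) {u : FinSeq s}
    (hu : u ∈ annihilator s d) :
    transfer m N a ε u - ((m : ℝ) ^ d)⁻¹ • u ∈ annihilator s (d + 1) := by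
  intro p hp
  obtain ⟨r, hr, h⟩ := ha.pairing_transfer hm ε hd hp
  rw [map_sub, map_smul, h, hu r hr, smul_eq_mul, add_zero, sub_self]

/-! ### Sum rules -/

theorem iterate_pderiv_monomial (i : Fin s) (e : ℕ) (n : Fin s →₀ ℕ) (c : ℂ) :
    (MvPolynomial.pderiv i)^[e] (MvPolynomial.monomial n c) =
      MvPolynomial.monomial (n - Finsupp.single i e) (c * (n i).descFactorial e) := by
  induction e with
  | zero => simp
  | succ e ih =>
    rw [Function.iterate_succ_apply', ih, MvPolynomial.pderiv_monomial, tsub_tsub,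
      ← Finsupp.single_add, Nat.descFactorial_succ]
    congr 1
    simp only [Finsupp.tsub_apply, Finsupp.single_eq_same]
    push_cast
    ring

theorem foldr_pderiv_monomial (η : Fin s → ℕ) (n : Fin s →₀ ℕ) (c : ℂ) (l : List (Fin s))
    (hl : l.Nodup) :
    l.foldr (fun i q => (MvPolynomial.pderiv i)^[η i] q) (MvPolynomial.monomial n c) =
      MvPolynomial.monomial (n - (l.map fun i => Finsupp.single i (η i)).sum)
        (c * (l.map fun i => ((n i).descFactorial (η i) : ℂ)).prod) := by
  induction l with
  | nil => simp
  | cons i l ih =>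
    rw [List.nodup_cons] at hl
    have h0 : ((l.map fun i => Finsupp.single i (η i)).sum : Fin s →₀ ℕ) i = 0 := by
      have : ∀ l' : List (Fin s), i ∉ l' →
          ((l'.map fun i => Finsupp.single i (η i)).sum : Fin s →₀ ℕ) i = 0 := by
        intro l'
        induction l' with
        | nil => simp
        | cons j l' ih' =>
          intro h
          rw [List.mem_cons, not_or] at h
          simp [ih' h.2, Ne.symm h.1]
      exact this l hl.1
    rw [List.foldr_cons, ih hl.2, iterate_pderiv_monomial, tsub_tsub, List.map_cons, List.sum_cons,
      List.map_cons, List.prod_cons, add_comm (Finsupp.single i (η i)), Finsupp.tsub_apply, h0]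
    congr 1
    simp only [tsub_zero]
    ring

/-- Differentiating a monomial produces a falling factorial, so derivatives of the symbol are
factorial moments of the mask twisted by powers of `ξ`. -/
theorem eval_partialDeriv_symbol (N : ℕ) (a : Mask s) (η : Fin s → ℕ) (ξ : Fin s → ℂ) :
    MvPolynomial.eval ξ (partialDeriv η (symbol N a)) =
      ∑ α ∈ Fintype.piFinset fun _ : Fin s => Finset.range (N + 1),
        (a fun i => (α i : ℤ) : ℂ) * ∏ i, ((α i).descFactorial (η i) : ℂ) * ξ i ^ (α i - η i) := by
  have hlin : ∀ (l : List (Fin s)) (S : Finset (Fin s → ℕ))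
      (q : (Fin s → ℕ) → MvPolynomial (Fin s) ℂ),
      l.foldr (fun i q => (MvPolynomial.pderiv i)^[η i] q) (∑ α ∈ S, q α) =
        ∑ α ∈ S, l.foldr (fun i q => (MvPolynomial.pderiv i)^[η i] q) (q α) := by
    intro l S q
    induction l with
    | nil => simp
    | cons i l ih =>
      simp only [List.foldr_cons, ih]
      generalize η i = e
      induction e with
      | zero => simp
      | succ e ihe => simp only [Function.iterate_succ_apply', ihe, map_sum]
  rw [partialDeriv, symbol, hlin, map_sum]
  refine Finset.sum_congr rfl fun α _ => ?_
  rw [foldr_pderiv_monomial _ _ _ _ (List.nodup_finRange s), MvPolynomial.eval_monomial,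
    Finset.prod_mul_distrib, mul_assoc]
  congr 2
  · rw [Finsupp.prod_fintype _ _ (by simp)]
    refine Finset.prod_congr rfl fun i _ => ?_
    congr 1
    have : (List.map (fun i => Finsupp.single i (η i)) (List.finRange s)).sum =
        Finsupp.equivFunOnFinite.symm η := by
      rw [← List.ofFn_eq_map, List.sum_ofFn]
      ext j
      simp [Finsupp.finsetSum_apply, Finsupp.single_apply]
    rw [this]
    simp

/-- Falling factorials span the powers; the coefficients obey the Stirling recursion from `x · (x)_k
= (x)_{k+1} + k (x)_k`. It converts factorial moments into ordinary ones. -/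
theorem exists_pow_eq_sum_descFactorial (n : ℕ) : ∃ c : ℕ → ℂ, ∀ x : ℕ,
    (x : ℂ) ^ n = ∑ k ∈ Finset.range (n + 1), c k * (x.descFactorial k : ℂ) := by
  induction n with
  | zero => exact ⟨fun _ => 1, fun x => by simp⟩
  | succ n ih =>
    obtain ⟨c, hc⟩ := ih
    have hd : ∀ x k : ℕ, (x : ℂ) * (x.descFactorial k : ℂ) =
        (x.descFactorial (k + 1) : ℂ) + k * (x.descFactorial k : ℂ) := by
      intro x k
      rw [Nat.descFactorial_succ]
      rcases le_or_gt k x with h | h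
      · push_cast [h]; ring
      · simp [Nat.descFactorial_of_lt h]
    refine ⟨fun k => (if k = 0 then 0 else c (k - 1)) + (if k = n + 1 then 0 else k * c k),
      fun x => ?_⟩
    simp only [add_mul, Finset.sum_add_distrib]
    rw [pow_succ', hc, Finset.mul_sum, Finset.sum_range_succ' _ (n + 1),
      Finset.sum_range_succ (fun k => (if k = n + 1 then (0 : ℂ) else k * c k) * _) (n + 1)]
    simp only [if_true, zero_mul, add_zero, Nat.add_eq_zero_iff, one_ne_zero, and_false, if_false,
      add_tsub_cancel_right]
    rw [← Finset.sum_add_distrib]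
    refine Finset.sum_congr rfl fun k hk => ?_
    rw [if_neg (Finset.mem_range.1 hk).ne, mul_left_comm, hd]
    ring

theorem exp_eq_one_iff_dvd {m : ℤ} (hm : m ≠ 0) (k : ℤ) :
    Complex.exp (-Complex.I * (2 * Real.pi / (|m| : ℤ)) * (k : ℂ)) = 1 ↔ m ∣ k := by
  have hM : (((|m| : ℤ)) : ℂ) ≠ 0 := by exact_mod_cast abs_ne_zero.2 hm
  have hpi : (Real.pi : ℂ) ≠ 0 := by exact_mod_cast Real.pi_ne_zero
  rw [Complex.exp_eq_one_iff, ← abs_dvd]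
  constructor
  · rintro ⟨n, hn⟩
    refine ⟨-n, ?_⟩
    field_simp at hn
    have h2 : ((k : ℂ)) = ((|m| * -n : ℤ) : ℂ) := by
      have h3 : Complex.I * (2 * Real.pi) * (k + (|m| : ℤ) * n : ℂ) = 0 := by
        linear_combination (-2 * Real.pi * Complex.I) * hn
      have h4 := (mul_eq_zero.1 h3).resolve_left
        (mul_ne_zero Complex.I_ne_zero (mul_ne_zero two_ne_zero hpi))
      push_cast at h4 ⊢
      linear_combination h4
    exact_mod_cast h2
  · rintro ⟨n, hn⟩
    refine ⟨-n, ?_⟩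
    rw [hn]
    push_cast at hM ⊢
    field_simp

/-- Orthogonality of characters of `ℤ/mℤ`: the sum is geometric with ratio a `|m|`-th root of unity,
equal to `1` exactly when `m ∣ k`. -/
theorem sum_exp_coset {m : ℤ} (hm : m ≠ 0) (k : ℤ) :
    ∑ e ∈ Finset.Ico 0 |m|, Complex.exp (-Complex.I * (2 * Real.pi / (|m| : ℤ)) * ((e * k : ℤ) : ℂ)) =
      if m ∣ k then ((|m| : ℤ) : ℂ) else 0 := by
  set z := Complex.exp (-Complex.I * (2 * Real.pi / (|m| : ℤ)) * (k : ℂ)) with hz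
  have hM : ((m.natAbs : ℤ)) = |m| := Int.natCast_natAbs m
  have h1 : ∑ e ∈ Finset.Ico 0 |m|,
      Complex.exp (-Complex.I * (2 * Real.pi / (|m| : ℤ)) * ((e * k : ℤ) : ℂ)) =
      ∑ e ∈ Finset.range m.natAbs, z ^ e := by
    refine Finset.sum_nbij' Int.toNat (fun n => (n : ℤ)) ?_ ?_ ?_ ?_ ?_
    · intro e he; rw [Finset.mem_Ico] at he; rw [Finset.mem_range]; omega
    · intro e he; rw [Finset.mem_range] at he; rw [Finset.mem_Ico]; omega
    · intro e he; rw [Finset.mem_Ico] at he; exact Int.toNat_of_nonneg he.1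
    · intro e _; exact Int.toNat_natCast e
    · intro e he
      rw [Finset.mem_Ico] at he
      obtain ⟨n, rfl⟩ := Int.eq_ofNat_of_zero_le he.1
      rw [hz, ← Complex.exp_nat_mul, Int.toNat_natCast]
      congr 1
      push_cast
      ring
  rw [h1]
  split_ifs with h
  · rw [(exp_eq_one_iff_dvd hm k).2 h] at hz
    rw [hz, ← hM]
    simp
  · have hz1 : z ≠ 1 := fun h' => h ((exp_eq_one_iff_dvd hm k).1 h')
    have hzM : z ^ m.natAbs = 1 := by
      rw [hz, ← Complex.exp_nat_mul]
      have := (exp_eq_one_iff_dvd hm (m.natAbs * k)).2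
        ((Int.dvd_natAbs.2 dvd_rfl).mul_right k)
      rw [← this, Int.cast_mul, Int.cast_natCast]
      congr 1
      ring
    have := geom_sum_eq hz1 m.natAbs
    rw [this, hzM, sub_self, zero_div]

theorem sum_maskBox {β : Type*} [AddCommMonoid β] (N : ℕ) (F : (Fin s → ℤ) → β) :
    ∑ γ ∈ maskBox s N, F γ =
      ∑ α ∈ Fintype.piFinset fun _ : Fin s => Finset.range (N + 1), F fun i => (α i : ℤ) := by
  refine Finset.sum_nbij' (fun γ i => (γ i).toNat) (fun α i => (α i : ℤ)) ?_ ?_ ?_ ?_ ?_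
  · intro γ hγ
    rw [mem_maskBox] at hγ
    rw [Fintype.mem_piFinset]
    intro i
    have := hγ i
    rw [Finset.mem_range]; omega
  · intro α hα
    rw [Fintype.mem_piFinset] at hα
    rw [mem_maskBox]
    intro i
    have := Finset.mem_range.1 (hα i)
    omega
  · intro γ hγ
    funext i
    exact Int.toNat_of_nonneg (mem_maskBox.1 hγ i).1
  · intro α _
    funext i
    simp
  · intro γ hγ
    congr 1
    funext i
    exact (Int.toNat_of_nonneg (mem_maskBox.1 hγ i).1).symm

/-- At the nontrivial roots of unity the twisted moments of order at most `ℓ` vanish. -/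
theorem SumRules.twisted_moment {m : ℤ} {N ℓ : ℕ} {a : Mask s} (h : SumRules m N ℓ a)
    {ε : Fin s → ℤ} (hε : ε ∈ cosets s m) (hξ : rootPoint m ε ≠ fun _ => 1)
    {p : MvPolynomial (Fin s) ℝ} (hp : p ∈ polyLT s (ℓ + 1)) :
    ∑ γ ∈ maskBox s N, ((a γ * evalInt p γ : ℝ) : ℂ) * ∏ i, rootPoint m ε i ^ (γ i) = 0 := by
  set ξ := rootPoint m ε with hξdef
  have hξ0 : ∀ i, ξ i ≠ 0 := fun i => Complex.exp_ne_zero _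
  have hff : ∀ η : Fin s → ℕ, ∑ i, η i ≤ ℓ →
      ∑ α ∈ Fintype.piFinset fun _ : Fin s => Finset.range (N + 1), (a fun i => (α i : ℤ) : ℂ) *
        ((∏ i, ((α i).descFactorial (η i) : ℂ)) * ∏ i, ξ i ^ (α i)) = 0 := by
    intro η hη
    have h1 := h.2 η hη ε hε hξ
    rw [eval_partialDeriv_symbol] at h1
    -- Multiplying by `ξ^η` restores the exponent `α`. Where `α_i < η_i` the truncated subtraction
    -- is harmless, since the falling factorial vanishes.
    have h2 := congrArg (fun z => z * ∏ i, ξ i ^ (η i)) h1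
    rw [zero_mul, Finset.sum_mul] at h2
    rw [← h2]
    refine Finset.sum_congr rfl fun α _ => ?_
    rw [mul_assoc, ← Finset.prod_mul_distrib, ← Finset.prod_mul_distrib]
    congr 1
    refine Finset.prod_congr rfl fun i _ => ?_
    rcases le_or_gt (η i) (α i) with hle | hlt
    · rw [mul_assoc, ← pow_add, Nat.sub_add_cancel hle]
    · rw [Nat.descFactorial_of_lt hlt]; simp
  refine polyLT_induction (P := fun p => ∑ γ ∈ maskBox s N,
    ((a γ * evalInt p γ : ℝ) : ℂ) * ∏ i, ξ i ^ (γ i) = 0) ?_ ?_ ?_ hp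
  · simp [evalInt]
  · intro p q h1 h2
    rw [← add_zero (0 : ℂ)]
    nth_rewrite 1 [← h1]
    rw [← h2, ← Finset.sum_add_distrib]
    refine Finset.sum_congr rfl fun γ _ => ?_
    simp only [evalInt, map_add]
    push_cast
    ring
  · intro n c hn
    choose b hb using exists_pow_eq_sum_descFactorial
    rw [sum_maskBox]
    have key : ∀ α : Fin s → ℕ, ((evalInt (MvPolynomial.monomial n c) fun i => (α i : ℤ) : ℝ) : ℂ) =
        ∑ η ∈ Fintype.piFinset fun i => Finset.range (n i + 1),
          (c * ∏ i, b (n i) (η i)) * ∏ i, ((α i).descFactorial (η i) : ℂ) := by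
      intro α
      rw [evalInt, MvPolynomial.eval_monomial, Finsupp.prod_fintype _ _ (by simp)]
      push_cast
      simp only [hb]
      rw [Finset.prod_univ_sum, Finset.mul_sum]
      refine Finset.sum_congr rfl fun η _ => ?_
      rw [Finset.prod_mul_distrib]; ring
    simp only [Complex.ofReal_mul, key, Finset.mul_sum, Finset.sum_mul, zpow_natCast]
    rw [Finset.sum_comm]
    refine Finset.sum_eq_zero fun η hη => ?_
    have hle : ∑ i, η i ≤ ℓ := by
      have h1 : ∑ i, η i ≤ ∑ i, n i := Finset.sum_le_sum fun i _ =>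
        Nat.lt_succ_iff.1 (Finset.mem_range.1 (Fintype.mem_piFinset.1 hη i))
      rw [Finsupp.degree_eq_sum] at hn
      omega
    have h3 := congrArg (fun z => (c * ∏ i, b (n i) (η i)) * z) (hff η hle)
    rw [mul_zero, Finset.mul_sum] at h3
    rw [← h3]
    refine Finset.sum_congr rfl fun α _ => ?_
    ring

/-- Fourier inversion on `(ℤ/mℤ)^s`: the indicator of a coset is an average of characters, and the
twisted moments at all nontrivial characters vanish, so each coset receives the share `|m|^{-s}` of
the full moment. -/
theorem SumRules.reproducing {m : ℤ} (hm : m ≠ 0) {N ℓ : ℕ} {a : Mask s} (ha : SupportedIn N a)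
    (h : SumRules m N ℓ a) : Reproducing m N ℓ a where
  supported := ha
  sum_eq := by
    have h1 := h.1
    rw [symbol, map_sum] at h1
    rw [sum_maskBox]
    have h2 : ((∑ α ∈ Fintype.piFinset fun _ : Fin s => Finset.range (N + 1),
        a fun i => (α i : ℤ) : ℝ) : ℂ) = (((|m| : ℝ) ^ s : ℝ) : ℂ) := by
      push_cast
      rw [← Int.cast_abs, Complex.ofReal_intCast, ← h1]
      refine Finset.sum_congr rfl fun α _ => ?_
      rw [MvPolynomial.eval_monomial]
      simp
    exact_mod_cast h2
  coset_sum := by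
    intro p hp δ
    have hM : (|m| : ℝ) ^ s ≠ 0 := by positivity
    rw [eq_inv_mul_iff_mul_eq₀ hM]
    set χ : ℤ → ℂ := fun k => Complex.exp (-Complex.I * (2 * Real.pi / (|m| : ℤ)) * (k : ℂ)) with hχ
    have hχadd : ∀ j k, χ (j + k) = χ j * χ k := by
      intro j k
      simp only [hχ]
      rw [← Complex.exp_add]
      congr 1; push_cast; ring
    have hroot : ∀ (ε γ : Fin s → ℤ), ∏ i, rootPoint m ε i ^ (γ i) = ∏ i, χ (ε i * γ i) := by
      intro ε γ
      refine Finset.prod_congr rfl fun i _ => ?_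
      rw [rootPoint, ← Complex.exp_int_mul]
      simp only [hχ]
      congr 1; push_cast; ring
    have horth : ∀ γ : Fin s → ℤ, ∑ ε ∈ cosets s m, ∏ i, χ (ε i * (γ i - δ i)) =
        if ∀ i, m ∣ γ i - δ i then ((|m| : ℝ) ^ s : ℂ) else 0 := by
      intro γ
      rw [cosets, ← Finset.prod_univ_sum (fun _ => Finset.Ico 0 |m|)
        (fun i e => χ (e * (γ i - δ i)))]
      simp only [hχ, sum_exp_coset hm]
      split_ifs with hd
      · rw [Finset.prod_congr rfl fun i _ => if_pos (hd i), Finset.prod_const, Finset.card_univ,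
          Fintype.card_fin, ← Int.cast_abs, Complex.ofReal_intCast]
      · push Not at hd
        obtain ⟨i, hi⟩ := hd
        exact Finset.prod_eq_zero (Finset.mem_univ i) (if_neg hi)
    have hmain : ∑ ε ∈ cosets s m, (∑ γ ∈ maskBox s N, ((a γ * evalInt p γ : ℝ) : ℂ) *
        ∏ i, rootPoint m ε i ^ (γ i)) * ∏ i, χ (ε i * (-δ i)) =
        ∑ γ ∈ maskBox s N, ((a γ * evalInt p γ : ℝ) : ℂ) := by
      have h0 : (0 : Fin s → ℤ) ∈ cosets s m := by
        simp [cosets, abs_pos.2 hm]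
      rw [Finset.sum_eq_single_of_mem 0 h0]
      · simp [hχ, rootPoint]
      · intro ε hε hne
        rw [h.twisted_moment hε _ hp, zero_mul]
        intro h1
        refine hne (funext fun i => ?_)
        have h2 : m ∣ ε i := (exp_eq_one_iff_dvd hm (ε i)).1 (congrFun h1 i)
        have h3 := Fintype.mem_piFinset.1 hε i
        rw [Finset.mem_Ico] at h3
        exact Int.eq_zero_of_dvd_of_nonneg_of_lt h3.1 h3.2 ((abs_dvd _ _).2 h2)
    have hC : (((|m| : ℝ) ^ s * ∑ γ ∈ maskBox s N,
        if ∀ i, m ∣ γ i - δ i then a γ * evalInt p γ else 0 : ℝ) : ℂ) =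
        ((∑ γ ∈ maskBox s N, a γ * evalInt p γ : ℝ) : ℂ) := by
      rw [Complex.ofReal_sum, ← hmain]
      simp only [Finset.sum_mul]
      rw [Finset.sum_comm, Complex.ofReal_mul, Complex.ofReal_sum, Finset.mul_sum]
      refine Finset.sum_congr rfl fun γ _ => ?_
      have h1 : ∀ ε ∈ cosets s m, ((a γ * evalInt p γ : ℝ) : ℂ) * (∏ i, rootPoint m ε i ^ (γ i)) *
          ∏ i, χ (ε i * (-δ i)) = ((a γ * evalInt p γ : ℝ) : ℂ) * ∏ i, χ (ε i * (γ i - δ i)) := by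
        intro ε _
        rw [hroot, mul_assoc, ← Finset.prod_mul_distrib]
        congr 1
        refine Finset.prod_congr rfl fun i _ => ?_
        rw [← hχadd]; congr 1; ring
      rw [Finset.sum_congr rfl h1, ← Finset.mul_sum, horth]
      split_ifs <;> push_cast <;> ring
    exact_mod_cast hC

/-! ### Supports under the transfer operator -/

/-- The center of the attractor of the maps `x ↦ (x + g) / m` with digits `g`. -/
def center (m : ℤ) (N : ℕ) : ℝ := ((N + 1 - |(m : ℝ)|) / 2) / (m - 1)

/-- The points at distance at most `R` from the cube spanned by the attractor of the transfer
operators. -/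
def region (s : ℕ) (m : ℤ) (N : ℕ) (R : ℝ) : Set (Fin s → ℤ) :=
  {κ | ∀ i, |(κ i : ℝ) - center m N| ≤ R + ((N + |(m : ℝ)| - 1) / 2) / (|(m : ℝ)| - 1)}

theorem region_mono {m : ℤ} {N : ℕ} {R R' : ℝ} (h : R ≤ R') : region s m N R ⊆ region s m N R' :=
  fun _ hκ i => (hκ i).trans (by gcongr)

theorem two_le_abs_cast {m : ℤ} (hm : 2 ≤ |m|) : (2 : ℝ) ≤ |(m : ℝ)| := by exact_mod_cast hm

/-- The center is the fixed point of `x ↦ (x + g)/m` for the midpoint `g = (N + 1 - |m|)/2` of the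
digit interval. The differences `γ - ε ∈ [1 - |m|, N]` and the digits `[-|m|, N + 1]` that define
`K` have this same midpoint. -/
theorem center_mul {m : ℤ} (hm : 2 ≤ |m|) (N : ℕ) :
    m * center m N = center m N + (N + 1 - |(m : ℝ)|) / 2 := by
  have h1 : (m : ℝ) - 1 ≠ 0 := by
    intro h
    have : (m : ℝ) = 1 := by linarith
    have h2 := two_le_abs_cast hm
    rw [this] at h2
    norm_num at h2
  rw [center]
  field_simp
  ring

/-- With `h` half the length of the interval of `γ - ε`, the radius `h/(|m| - 1)` is fixed by `x ↦
(x + h)/|m|`. Only the excess `R` is contracted, and it is divided by `|m|`. -/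
theorem support_transfer_subset_region {m : ℤ} (hm : 2 ≤ |m|) {N : ℕ} {a : Mask s}
    {ε : Fin s → ℤ} (hε : ε ∈ cosets s m) {u : FinSeq s} {R : ℝ}
    (hu : ↑u.support ⊆ region s m N R) :
    ↑(transfer m N a ε u).support ⊆ region s m N (R / |(m : ℝ)|) := by
  intro β hβ i
  obtain ⟨κ, hκ, γ, hγ, h⟩ := exists_of_mem_support_transfer hβ
  have hM := two_le_abs_cast hm
  have h1 := hu hκ i
  have h2 : (m : ℝ) * β i = γ i - (ε i - κ i) := by exact_mod_cast h i
  have h3 := mem_maskBox.1 hγ i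
  have h4 := Finset.mem_Ico.1 (Fintype.mem_piFinset.1 hε i)
  have h5 : (0 : ℝ) ≤ γ i ∧ (γ i : ℝ) ≤ N := ⟨by exact_mod_cast h3.1, by exact_mod_cast h3.2⟩
  have h6 : (0 : ℝ) ≤ ε i ∧ (ε i : ℝ) + 1 ≤ |(m : ℝ)| :=
    ⟨by exact_mod_cast h4.1, by exact_mod_cast Int.add_one_le_iff.2 h4.2⟩
  have h7 : m * ((β i : ℝ) - center m N) =
      (κ i - center m N) + (γ i - ε i - (N + 1 - |(m : ℝ)|) / 2) := by
    rw [mul_sub, h2, center_mul hm]; ring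
  have h8 : |(γ i - ε i - (N + 1 - |(m : ℝ)|) / 2 : ℝ)| ≤ (N + |(m : ℝ)| - 1) / 2 := by
    rw [abs_le]; constructor <;> linarith [h5.1, h5.2, h6.1, h6.2]
  have h9 : |(m : ℝ)| * |(β i : ℝ) - center m N| ≤
      (R + ((N + |(m : ℝ)| - 1) / 2) / (|(m : ℝ)| - 1)) + (N + |(m : ℝ)| - 1) / 2 := by
    rw [← abs_mul, h7]
    exact (abs_add_le _ _).trans (add_le_add h1 h8)
  have hM0 : (0 : ℝ) < |(m : ℝ)| := by linarith
  have hM1 : |(m : ℝ)| - 1 ≠ 0 := by linarith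
  rw [← mul_le_mul_iff_right₀ hM0]
  refine h9.trans (le_of_eq ?_)
  field_simp
  ring

/-- One step of a digit expansion: with the digit `mx - y` the remainder `y` stays in the interval
around the center that is self-consistent for the digits of `K`. -/
theorem exists_digit {m : ℤ} (hm : 2 ≤ |m|) (N : ℕ) {x : ℤ}
    (hx : |(x : ℝ) - center m N| ≤ ((N + 1 + |(m : ℝ)|) / 2) / (|(m : ℝ)| - 1)) :
    ∃ y : ℤ, |(y : ℝ) - center m N| ≤ ((N + 1 + |(m : ℝ)|) / 2) / (|(m : ℝ)| - 1) ∧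
      -|m| ≤ m * x - y ∧ m * x - y ≤ N + 1 := by
  have hM := two_le_abs_cast hm
  set ρ : ℝ := ((N + 1 + |(m : ℝ)|) / 2) / (|(m : ℝ)| - 1) with hρ
  have hρm : ρ * (|(m : ℝ)| - 1) = (N + 1 + |(m : ℝ)|) / 2 :=
    div_mul_cancel₀ _ (by linarith)
  have hρ2 : 1 / 2 ≤ ρ := by
    rw [hρ, le_div_iff₀ (by linarith)]
    have : (0 : ℝ) ≤ N := N.cast_nonneg
    linarith
  have hmx : |m * (x : ℝ) - (N + 1 - |(m : ℝ)|) / 2 - center m N| ≤ |(m : ℝ)| * ρ := by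
    have : m * (x : ℝ) - (N + 1 - |(m : ℝ)|) / 2 - center m N = m * (x - center m N) := by
      rw [mul_sub, center_mul hm]; ring
    rw [this, abs_mul]
    gcongr
  rw [abs_le] at hmx
  have hceil := Int.le_ceil (center m N - ρ)
  have hceil' := Int.ceil_lt_add_one (center m N - ρ)
  -- The least integer meeting both lower bounds. It also meets both upper bounds: the intervals for
  -- `y` overlap by `hmx`, their endpoints `mx - (N + 1)` and `mx + |m|` are integers, and the
  -- radius is at least `1/2`.
  refine ⟨max ⌈center m N - ρ⌉ (m * x - (N + 1)), ?_, ?_, ?_⟩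
  · rw [abs_le]
    push_cast
    constructor
    · have := le_max_left (⌈center m N - ρ⌉ : ℝ) (m * x - (N + 1))
      linarith
    · rw [sub_le_iff_le_add]
      refine max_le (by linarith) (by nlinarith [hmx.2])
  · have h1 : ⌈center m N - ρ⌉ ≤ m * x + |m| := by
      rw [Int.ceil_le]
      push_cast
      nlinarith [hmx.1]
    have h2 : m * x - (N + 1) ≤ m * x + |m| := by have := abs_nonneg m; omega
    have := max_le h1 h2
    omega
  · have := le_max_right ⌈center m N - ρ⌉ (m * x - (N + 1))
    omega

/-- Iterating the digit step gives the expansion: partial sums telescope to `x - x_n m^{-n}` with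
bounded remainders `x_n`. The excess `1/(|m| - 1)` is the gain in radius from digits reaching one
unit further at each end than `γ - ε` does; it leaves `K` room to absorb every support after
finitely many transfers. -/
theorem region_subset_indexSet {m : ℤ} (hm : 2 ≤ |m|) (N : ℕ) :
    region s m N (1 / (|(m : ℝ)| - 1)) ⊆ indexSet s m N := by
  intro κ hκ
  have hM := two_le_abs_cast hm
  set ρ : ℝ := ((N + 1 + |(m : ℝ)|) / 2) / (|(m : ℝ)| - 1) with hρ
  set J : Set ℤ := {x | |(x : ℝ) - center m N| ≤ ρ} with hJ
  have hstep : ∀ x : J, ∃ y : J, -|m| ≤ m * x.1 - y.1 ∧ m * x.1 - y.1 ≤ N + 1 := fun x => by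
    obtain ⟨y, hy, h⟩ := exists_digit hm N x.2
    exact ⟨⟨y, hy⟩, h⟩
  choose next hnext using hstep
  have hκJ : ∀ i, κ i ∈ J := by
    intro i
    have h := hκ i
    rw [← add_div] at h
    refine h.trans (le_of_eq ?_)
    rw [hρ]; ring
  have hm0 : (m : ℝ) ≠ 0 := by rw [← abs_pos]; linarith
  have main : ∀ x : J, HasSum (fun r => ((m * (next^[r] x).1 - (next^[r + 1] x).1 : ℤ) : ℝ) /
      (m : ℝ) ^ (r + 1)) (x.1 : ℝ) := by
    intro x
    have hsum : Summable (fun r => ((m * (next^[r] x).1 - (next^[r + 1] x).1 : ℤ) : ℝ) /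
        (m : ℝ) ^ (r + 1)) := by
      refine Summable.of_norm_bounded
        ((summable_geometric_two).mul_left (|(m : ℝ)| + N + 1)) fun r => ?_
      have h1 : |((m * (next^[r] x).1 - (next^[r + 1] x).1 : ℤ) : ℝ)| ≤ |(m : ℝ)| + N + 1 := by
        have := hnext (next^[r] x)
        rw [← show next^[r + 1] x = _ from Function.iterate_succ_apply' next r x] at this
        have h0 := abs_nonneg m
        have h2 : |m * (next^[r] x).1 - (next^[r + 1] x).1| ≤ |m| + N + 1 := by
          rw [abs_le]; constructor <;> omega
        exact_mod_cast h2
      rw [norm_div, norm_pow, Real.norm_eq_abs, Real.norm_eq_abs, div_eq_mul_inv, ← inv_pow]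
      refine mul_le_mul h1 ?_ (by positivity) (by positivity)
      calc (|(m : ℝ)|⁻¹) ^ (r + 1) ≤ (1 / 2) ^ (r + 1) := by
            refine pow_le_pow_left₀ (by positivity) ?_ _
            rw [one_div]; exact inv_anti₀ two_pos hM
        _ ≤ (1 / 2) ^ r := pow_le_pow_of_le_one (by norm_num) (by norm_num) (Nat.le_succ r)
    rw [hsum.hasSum_iff_tendsto_nat]
    have hpart : ∀ n, ∑ r ∈ Finset.range n,
        ((m * (next^[r] x).1 - (next^[r + 1] x).1 : ℤ) : ℝ) / (m : ℝ) ^ (r + 1) =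
        x.1 - (next^[n] x).1 * (m⁻¹ : ℝ) ^ n := by
      intro n
      induction n with
      | zero => simp
      | succ n ih =>
        rw [Finset.sum_range_succ, ih, inv_pow, inv_pow]
        push_cast
        field_simp
        ring
    simp only [hpart]
    have h0 : Tendsto (fun n => ((next^[n] x).1 : ℝ) * (m⁻¹ : ℝ) ^ n) atTop (𝓝 0) := by
      refine Tendsto.zero_mul_isBoundedUnder_le ?_ ?_ |>.congr fun n => mul_comm _ _
      · refine tendsto_pow_atTop_nhds_zero_of_abs_lt_one ?_
        rw [abs_inv]
        exact inv_lt_one_of_one_lt₀ (by linarith)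
      · refine isBoundedUnder_of ⟨ρ + |center m N|, fun n => ?_⟩
        have h1 : |((next^[n] x).1 : ℝ) - center m N| ≤ ρ := (next^[n] x).2
        have h2 := abs_add_le (((next^[n] x).1 : ℝ) - center m N) (center m N)
        rw [sub_add_cancel] at h2
        simp only [Function.comp, Real.norm_eq_abs]
        linarith
    simpa using h0.const_sub (x.1 : ℝ)
  rw [Finset.mem_coe, mem_indexSet hm]
  refine ⟨fun r i => m * (next^[r] ⟨κ i, hκJ i⟩).1 - (next^[r + 1] ⟨κ i, hκJ i⟩).1, ?_,
    fun i => main ⟨κ i, hκJ i⟩⟩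
  intro r i
  have := hnext (next^[r] ⟨κ i, hκJ i⟩)
  rwa [← show next^[r + 1] _ = _ from Function.iterate_succ_apply' next r _] at this

/-- Prepend the admissible digit `γ - ε` to an expansion of `κ`. Hence transfer operators do not
leave `K`. -/
theorem mem_indexSet_of_mul_eq {m : ℤ} (hm : 2 ≤ |m|) {N : ℕ} {κ β γ ε : Fin s → ℤ}
    (hκ : κ ∈ indexSet s m N) (hγ : γ ∈ maskBox s N) (hε : ε ∈ cosets s m)
    (h : ∀ i, m * β i = γ i - (ε i - κ i)) : β ∈ indexSet s m N := by
  rw [mem_indexSet hm] at hκ ⊢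
  obtain ⟨g, hg, hs⟩ := hκ
  refine ⟨fun r => if r = 0 then fun i => γ i - ε i else g (r - 1), fun r i => ?_, fun i => ?_⟩
  · rcases r with _ | r
    · have h3 := mem_maskBox.1 hγ i
      have h4 := Finset.mem_Ico.1 (Fintype.mem_piFinset.1 hε i)
      simp only [if_true]
      omega
    · exact hg r i
  · have hm0 : (m : ℝ) ≠ 0 := by
      have := two_le_abs_cast hm
      rw [← abs_pos]; linarith
    have h2 : (m : ℝ) * β i = γ i - (ε i - κ i) := by exact_mod_cast h i
    have h3 := (hs i).mul_left (m : ℝ)⁻¹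
    have h4 : (β i : ℝ) - (γ i - ε i : ℤ) / (m : ℝ) ^ 1 = (m : ℝ)⁻¹ * κ i := by
      push_cast
      field_simp
      linarith
    rw [← hasSum_nat_add_iff' 1, Finset.sum_range_one]
    simp only [if_true, Nat.succ_ne_zero, if_false, Nat.add_sub_cancel, zero_add, h4]
    refine h3.congr_fun fun r => ?_
    rw [pow_succ _ (r + 1)]
    field_simp

/-! ### Joint spectral radius -/

/-- From some length on, every product is bounded by `ρ` to its length; the finitely many shorter
lengths are absorbed into the constant by the uniform bound on the factors. -/
theorem exists_bound_of_jointSpectralRadius_lt {R : Type*} [NormedRing R] {𝓜 : Set R}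
    (hb : ∃ B, ∀ T ∈ 𝓜, ‖T‖ ≤ B) (h1 : ‖(1 : R)‖ ≤ 1) {ρ : ℝ} (hρ : 0 < ρ)
    (h : jointSpectralRadius 𝓜 < ENNReal.ofReal ρ) :
    ∃ C, 0 ≤ C ∧ ∀ l : List R, (∀ T ∈ l, T ∈ 𝓜) → ‖l.prod‖ ≤ C * ρ ^ l.length := by
  obtain ⟨B, hB⟩ := hb
  obtain ⟨n₀, hn₀⟩ := eventually_atTop.1 (eventually_lt_of_limsup_lt h)
  set B' : ℝ := max B 1
  have hB'1 : 1 ≤ B' := le_max_right _ _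
  have hsmall : ∀ l : List R, (∀ T ∈ l, T ∈ 𝓜) → ‖l.prod‖ ≤ B' ^ l.length := by
    intro l
    induction l with
    | nil => intro _; simpa using h1
    | cons T l ih =>
      intro hl
      rw [List.prod_cons, List.length_cons, pow_succ']
      refine (norm_mul_le _ _).trans (mul_le_mul ?_ (ih fun X hX => hl X (List.mem_cons_of_mem _ hX))
        (norm_nonneg _) (by positivity))
      exact (hB T (hl T List.mem_cons_self)).trans (le_max_left _ _)
  -- Length `0` counts as short, so the exponent `1/n` is a genuine root for the long products.
  set n₁ := max n₀ 1
  have hterm : ∀ n, 0 ≤ (B' / ρ) ^ n := fun n => by positivity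
  refine ⟨1 + ∑ n ∈ Finset.range n₁, (B' / ρ) ^ n, by
    have := Finset.sum_nonneg fun n (_ : n ∈ Finset.range n₁) => hterm n
    linarith, fun l hl => ?_⟩
  rcases lt_or_ge l.length n₁ with hlt | hge
  · refine (hsmall l hl).trans ?_
    have h2 : (B' / ρ) ^ l.length ≤ ∑ n ∈ Finset.range n₁, (B' / ρ) ^ n :=
      Finset.single_le_sum (fun n _ => hterm n) (Finset.mem_range.2 hlt)
    calc B' ^ l.length = (B' / ρ) ^ l.length * ρ ^ l.length := by
          rw [div_pow, div_mul_cancel₀ _ (by positivity)]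
      _ ≤ _ := by gcongr; linarith
  · have h2 := hn₀ l.length ((le_max_left _ _).trans hge)
    have hn : 0 < l.length := lt_of_lt_of_le one_pos ((le_max_right _ _).trans hge)
    have hn' : (0 : ℝ) < l.length := by exact_mod_cast hn
    have h3 : ‖l.prod‖ₑ ≤ ⨆ (T : Fin l.length → R) (_ : ∀ i, T i ∈ 𝓜), ‖(List.ofFn T).prod‖ₑ := by
      refine le_iSup₂_of_le l.get (fun i => hl _ (List.get_mem l i)) ?_
      rw [List.ofFn_get]
    have h4 : ‖l.prod‖ₑ ^ (1 / (l.length : ℝ)) < ENNReal.ofReal ρ :=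
      (ENNReal.rpow_le_rpow h3 (by positivity)).trans_lt h2
    have h5 : ‖l.prod‖ₑ ≤ ENNReal.ofReal (ρ ^ l.length) := by
      have := ENNReal.rpow_le_rpow h4.le hn'.le
      rwa [← ENNReal.rpow_mul, one_div, inv_mul_cancel₀ hn'.ne', ENNReal.rpow_one,
        ENNReal.rpow_natCast, ← ENNReal.ofReal_pow hρ.le] at this
    have h6 : ‖l.prod‖ ≤ ρ ^ l.length := by
      rw [← ofReal_norm] at h5
      exact (ENNReal.ofReal_le_ofReal_iff (by positivity)).1 h5
    refine h6.trans (le_mul_of_one_le_left (by positivity) ?_)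
    have := Finset.sum_nonneg fun n (_ : n ∈ Finset.range n₁) => hterm n
    linarith

/-- A bound for products from `𝓜` passes to products of elements of segments with ends in `𝓜`. -/
theorem norm_prod_le_of_segment {R : Type*} [NormedRing R] [NormedAlgebra ℝ R] {𝓜 𝓢 : Set R}
    (hS : ∀ T ∈ 𝓢, ∃ X ∈ 𝓜, ∃ Y ∈ 𝓜, T ∈ segment ℝ X Y) {b : ℕ → ℝ}
    (hb : ∀ l : List R, (∀ T ∈ l, T ∈ 𝓜) → ‖l.prod‖ ≤ b l.length) (l : List R)
    (hl : ∀ T ∈ l, T ∈ 𝓢) : ‖l.prod‖ ≤ b l.length := by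
  -- The factors in `l₁` have already been replaced by end points; each step replaces the next one.
  -- The product is affine in that factor, and the bound depends on the total length only.
  suffices H : ∀ l : List R, (∀ T ∈ l, T ∈ 𝓢) → ∀ l₁ : List R, (∀ T ∈ l₁, T ∈ 𝓜) →
      ‖l₁.prod * l.prod‖ ≤ b (l₁.length + l.length) by
    simpa using H l hl [] (by simp)
  intro l
  induction l with
  | nil => intro _ l₁ h₁; simpa using hb l₁ h₁
  | cons T l ih =>
    intro hl l₁ h₁
    obtain ⟨X, hX, Y, hY, x, y, hx, hy, hxy, rfl⟩ := hS T (hl T List.mem_cons_self)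
    have hl' : ∀ T ∈ l, T ∈ 𝓢 := fun Z hZ => hl Z (List.mem_cons_of_mem _ hZ)
    have key : ∀ Z ∈ 𝓜, ‖l₁.prod * (Z * l.prod)‖ ≤ b (l₁.length + (l.length + 1)) := by
      intro Z hZ
      have := ih hl' (l₁ ++ [Z]) (by
        intro W hW
        rcases List.mem_append.1 hW with h | h
        · exact h₁ W h
        · rw [List.mem_singleton.1 h]; exact hZ)
      rwa [List.prod_append, List.prod_singleton, mul_assoc, List.length_append,
        List.length_singleton, add_assoc, add_comm 1] at this
    rw [List.prod_cons, List.length_cons, add_mul, mul_add, smul_mul_assoc, smul_mul_assoc,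
      mul_smul_comm, mul_smul_comm]
    refine (norm_add_le _ _).trans ?_
    rw [norm_smul, norm_smul, Real.norm_of_nonneg hx, Real.norm_of_nonneg hy]
    calc _ ≤ x * b (l₁.length + (l.length + 1)) + y * b (l₁.length + (l.length + 1)) := by
          gcongr
          · exact key X hX
          · exact key Y hY
      _ = _ := by rw [← add_mul, hxy, one_mul]

/-! ### Words in the transfer operators -/

/-- Apply the transfer operators of the letters of `w` one after the other. -/
def run (m : ℤ) (N : ℕ) (w : List (Mask s × (Fin s → ℤ))) (u : FinSeq s) : FinSeq s :=
  w.foldl (fun u p => transfer m N p.1 p.2 u) u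

@[simp] theorem run_nil (m : ℤ) (N : ℕ) (u : FinSeq s) : run m N [] u = u := rfl

@[simp] theorem run_cons (m : ℤ) (N : ℕ) (p : Mask s × (Fin s → ℤ)) (w) (u : FinSeq s) :
    run m N (p :: w) u = run m N w (transfer m N p.1 p.2 u) := rfl

theorem run_add (m : ℤ) (N : ℕ) (w : List (Mask s × (Fin s → ℤ))) (u v : FinSeq s) :
    run m N w (u + v) = run m N w u + run m N w v := by
  induction w generalizing u v with
  | nil => rfl
  | cons p w ih => simp [ih]

theorem run_smul (m : ℤ) (N : ℕ) (w : List (Mask s × (Fin s → ℤ))) (c : ℝ) (u : FinSeq s) :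
    run m N w (c • u) = c • run m N w u := by
  induction w generalizing u with
  | nil => rfl
  | cons p w ih => simp [ih]

/-- The letters `(a, ε)` with `a ∈ 𝒜` and `ε ∈ E`. -/
def letters (m : ℤ) (𝒜 : Set (Mask s)) : Set (Mask s × (Fin s → ℤ)) :=
  {p | p.1 ∈ 𝒜 ∧ p.2 ∈ cosets s m}

/-- Along words in `L`, the transfer operators decay with rate `r` on the annihilator of the
polynomials of degree smaller than `d`, uniformly for supports in a bounded region. -/
def Decays (m : ℤ) (N : ℕ) (L : Set (Mask s × (Fin s → ℤ))) (d : ℕ) (r : ℝ) : Prop :=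
  ∀ R : ℝ, ∃ C, 0 ≤ C ∧ ∀ u ∈ annihilator s d, ↑u.support ⊆ region s m N R →
    ∀ w : List (Mask s × (Fin s → ℤ)), (∀ p ∈ w, p ∈ L) →
      l1 (run m N w u) ≤ C * r ^ w.length * l1 u

/-- Decay for supports in the index set implies decay for all supports. -/
theorem decays_of_indexSet {m : ℤ} (hm : 2 ≤ |m|) {N ℓ : ℕ} {𝒜 : Set (Mask s)} {B ρ : ℝ}
    (h𝒜 : ∀ a ∈ 𝒜, Reproducing m N ℓ a) (hB : ∀ a ∈ 𝒜, ∑ γ ∈ maskBox s N, |a γ| ≤ B)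
    (hB0 : 0 ≤ B) (hρ : 0 < ρ)
    (hK : ∃ C, 0 ≤ C ∧ ∀ u ∈ annihilator s (ℓ + 1), u.support ⊆ indexSet s m N →
      ∀ w : List (Mask s × (Fin s → ℤ)), (∀ p ∈ w, p ∈ letters m 𝒜) →
        l1 (run m N w u) ≤ C * ρ ^ w.length * l1 u) :
    Decays m N (letters m 𝒜) (ℓ + 1) ρ := by
  have hM := two_le_abs_cast hm
  have hm0 : m ≠ 0 := by rintro rfl; norm_num at hm
  have key : ∀ n : ℕ, ∃ C, 0 ≤ C ∧ ∀ u ∈ annihilator s (ℓ + 1),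
      ↑u.support ⊆ region s m N (|(m : ℝ)| ^ n * (1 / (|(m : ℝ)| - 1))) →
      ∀ w : List (Mask s × (Fin s → ℤ)), (∀ p ∈ w, p ∈ letters m 𝒜) →
        l1 (run m N w u) ≤ C * ρ ^ w.length * l1 u := by
    intro n
    induction n with
    | zero =>
      obtain ⟨C, hC, h⟩ := hK
      refine ⟨C, hC, fun u hu hs => h u hu ?_⟩
      rw [pow_zero, one_mul] at hs
      exact Finset.coe_subset.1 (hs.trans (region_subset_indexSet hm N))
    | succ n ih =>
      obtain ⟨C, hC, h⟩ := ih
      -- The `1` serves the empty word. Otherwise one letter shrinks the region by `|m|`, at the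
      -- price of the factor `B` and one lost power of `ρ`.
      refine ⟨1 + C * B / ρ, by positivity, fun u hu hs w hw => ?_⟩
      cases w with
      | nil =>
        simp only [run_nil, List.length_nil, pow_zero, mul_one]
        exact le_mul_of_one_le_left (l1_nonneg _) (le_add_of_nonneg_right (by positivity))
      | cons p w =>
        have hp := hw p List.mem_cons_self
        have h1 := h _ ((h𝒜 _ hp.1).transfer_mem hm0 p.2 le_rfl hu) (by
          have := support_transfer_subset_region (a := p.1) hm hp.2 hs
          rwa [pow_succ', mul_assoc, mul_div_cancel_left₀ _ (by positivity)] at this) w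
          fun q hq => hw q (List.mem_cons_of_mem _ hq)
        rw [run_cons, List.length_cons]
        have h2 := (l1_transfer_le m N p.1 p.2 u).trans
          (mul_le_mul_of_nonneg_right (hB _ hp.1) (l1_nonneg u))
        calc _ ≤ C * ρ ^ w.length * (B * l1 u) := h1.trans (by gcongr)
          _ = C * B / ρ * ρ ^ (w.length + 1) * l1 u := by rw [pow_succ]; field_simp
          _ ≤ _ := by
            have := l1_nonneg u
            gcongr
            linarith
  intro R
  obtain ⟨n, hn⟩ := pow_unbounded_of_one_lt (R * (|(m : ℝ)| - 1)) (by linarith : 1 < |(m : ℝ)|)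
  obtain ⟨C, hC, h⟩ := key n
  refine ⟨C, hC, fun u hu hs => h u hu (hs.trans (region_mono ?_))⟩
  rw [mul_one_div, le_div_iff₀ (by linarith)]
  exact hn.le

/-- On the annihilator of polynomials of degree smaller than `d ≤ ℓ`, the transfer operators act
like `m^{-d}` up to faster decaying terms. -/
theorem Decays.of_succ {m : ℤ} (hm : 2 ≤ |m|) {N ℓ : ℕ} {𝒜 : Set (Mask s)} {B : ℝ}
    (h𝒜 : ∀ a ∈ 𝒜, Reproducing m N ℓ a) (hB : ∀ a ∈ 𝒜, ∑ γ ∈ maskBox s N, |a γ| ≤ B)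
    (hB0 : 0 ≤ B) {d : ℕ} (hd : d ≤ ℓ) {r : ℝ} (hr0 : 0 ≤ r) (hr : r < (|(m : ℝ)| ^ d)⁻¹)
    (h : Decays m N (letters m 𝒜) (d + 1) r) :
    Decays m N (letters m 𝒜) d (|(m : ℝ)| ^ d)⁻¹ := by
  have hM := two_le_abs_cast hm
  have hm0 : m ≠ 0 := by rintro rfl; norm_num at hm
  intro R₀
  -- A nonnegative excess makes the region invariant under transfer, so the same constant serves at
  -- each letter.
  set R := max R₀ 0
  set q := (|(m : ℝ)| ^ d)⁻¹ with hq
  have hq0 : 0 < q := by positivity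
  obtain ⟨C, hC, hd1⟩ := h R
  -- With this constant, `x_n = (1 + D) q^n - D r^n` solves `x_{n+1} = q x_n + C (B + q) r^n` with
  -- `x_0 = 1`. That is the recursion from writing a transfer as `m^{-d} u + v`, where `v` lies in
  -- the next annihilator.
  set D := C * (B + q) / (q - r) with hD
  have hD0 : 0 ≤ D := by have := sub_pos.2 hr; positivity
  have key : ∀ u ∈ annihilator s d, ↑u.support ⊆ region s m N R →
      ∀ w : List (Mask s × (Fin s → ℤ)), (∀ p ∈ w, p ∈ letters m 𝒜) →
      l1 (run m N w u) ≤ ((1 + D) * q ^ w.length - D * r ^ w.length) * l1 u := by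
    intro u hu hs w
    induction w with
    | nil => intro _; simp
    | cons p w ih =>
      intro hw
      have hp := hw p List.mem_cons_self
      have hw' : ∀ p ∈ w, p ∈ letters m 𝒜 := fun q hq => hw q (List.mem_cons_of_mem _ hq)
      set v := transfer m N p.1 p.2 u - ((m : ℝ) ^ d)⁻¹ • u with hv
      have hvm : v ∈ annihilator s (d + 1) := (h𝒜 _ hp.1).transfer_sub_mem hm0 p.2 hd hu
      have hvs : ↑v.support ⊆ region s m N R := by
        classical
        intro κ hκ
        rcases Finset.mem_union.1 (Finsupp.support_sub hκ) with h1 | h1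
        · refine region_mono ?_ (support_transfer_subset_region hm hp.2 hs h1)
          exact div_le_self (le_max_right _ _) (by linarith)
        · exact hs (Finsupp.support_smul h1)
      have habs : |((m : ℝ) ^ d)⁻¹| = q := by rw [abs_inv, abs_pow]
      have hv1 : l1 v ≤ (B + q) * l1 u := by
        rw [hv, sub_eq_add_neg, ← neg_smul]
        refine (l1_add_le _ _).trans ?_
        rw [l1_smul, abs_neg, habs, add_mul]
        gcongr
        exact (l1_transfer_le _ _ _ _ _).trans
          (mul_le_mul_of_nonneg_right (hB _ hp.1) (l1_nonneg u))
      have h1 : transfer m N p.1 p.2 u = ((m : ℝ) ^ d)⁻¹ • u + v := by rw [hv]; abel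
      rw [run_cons, h1, run_add, run_smul, List.length_cons]
      refine (l1_add_le _ _).trans ?_
      rw [l1_smul, habs]
      have h2 := ih hw'
      have h3 : l1 (run m N w v) ≤ C * r ^ w.length * ((B + q) * l1 u) :=
        (hd1 v hvm hvs w hw').trans (by gcongr)
      have h4 : D * (q - r) = C * (B + q) := div_mul_cancel₀ _ (sub_pos.2 hr).ne'
      calc _ ≤ q * (((1 + D) * q ^ w.length - D * r ^ w.length) * l1 u) +
            C * r ^ w.length * ((B + q) * l1 u) := by gcongr
        _ = _ := by
          rw [pow_succ, pow_succ]
          linear_combination (-(r ^ w.length * l1 u)) * h4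
  refine ⟨1 + D, by positivity, fun u hu hs w hw => ?_⟩
  refine (key u hu (hs.trans (region_mono (le_max_left _ _))) w hw).trans ?_
  have := l1_nonneg u
  gcongr
  have : 0 ≤ D * r ^ w.length := by positivity
  linarith

/-- Descending induction from `ℓ + 1`: at each stage the rate `|m|^{-(d+1)}` just obtained (at the
top, `ρ < |m|^{-ℓ}`) is strictly below the scalar `|m|^{-d}` that governs the next stage. -/
theorem Decays.of_le {m : ℤ} (hm : 2 ≤ |m|) {N ℓ : ℕ} {𝒜 : Set (Mask s)} {B : ℝ}
    (h𝒜 : ∀ a ∈ 𝒜, Reproducing m N ℓ a) (hB : ∀ a ∈ 𝒜, ∑ γ ∈ maskBox s N, |a γ| ≤ B)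
    (hB0 : 0 ≤ B) {ρ : ℝ} (hρ0 : 0 ≤ ρ) (hρ : ρ < (|(m : ℝ)| ^ ℓ)⁻¹)
    (h : Decays m N (letters m 𝒜) (ℓ + 1) ρ) {d : ℕ} (hd : d ≤ ℓ) :
    Decays m N (letters m 𝒜) d (|(m : ℝ)| ^ d)⁻¹ := by
  have hM := two_le_abs_cast hm
  induction hd using Nat.decreasingInduction with
  | self => exact h.of_succ hm h𝒜 hB hB0 le_rfl hρ0 hρ
  | of_succ k hk ih =>
    refine ih.of_succ hm h𝒜 hB hB0 hk.le (by positivity) ?_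
    rw [pow_succ]
    refine inv_strictAnti₀ (by positivity) ?_
    exact lt_mul_of_one_lt_right (by positivity) (by linarith)

/-- Every pairing with the data after `k` steps is a pairing with the initial data. -/
theorem pairing_iterate {m : ℤ} (hm : 2 ≤ |m|) {N : ℕ} {𝒜 : Set (Mask s)}
    (h𝒜 : ∀ a ∈ 𝒜, SupportedIn N a) {a : ℕ → Mask s} (ha : ∀ r, 1 ≤ r → a r ∈ 𝒜) (c : Mask s)
    (k : ℕ) (γ : Fin s → ℤ) (u : FinSeq s) :
    ∃ w : List (Mask s × (Fin s → ℤ)), w.length = k ∧ (∀ p ∈ w, p ∈ letters m 𝒜) ∧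
      ∃ γ' : Fin s → ℤ, pairing (fun κ => iterate m a c k (fun i => γ i - κ i)) u =
        pairing (fun κ => c (fun i => γ' i - κ i)) (run m N w u) := by
  have hm0 : m ≠ 0 := by rintro rfl; norm_num at hm
  induction k generalizing γ u with
  | zero => exact ⟨[], rfl, by simp, γ, rfl⟩
  | succ k ih =>
    -- The Euclidean remainder lies in `[0, |m|)` also for negative `m`, so division of `γ` by `m`
    -- selects the letter. The last mask applied to the data is the first letter of the word.
    have hε : (fun i => γ i % m) ∈ cosets s m := by
      rw [cosets, Fintype.mem_piFinset]
      intro i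
      rw [Finset.mem_Ico]
      exact ⟨Int.emod_nonneg _ hm0, Int.emod_lt_abs _ hm0⟩
    have hdec : ∀ i, γ i = m * (γ i / m) + γ i % m := fun i => (Int.mul_ediv_add_emod _ _).symm
    obtain ⟨w, hw, hwL, γ', h⟩ := ih (fun i => γ i / m)
      (transfer m N (a (k + 1)) (fun i => γ i % m) u)
    refine ⟨(a (k + 1), fun i => γ i % m) :: w, by simp [hw], ?_, γ', ?_⟩
    · intro p hp
      rcases List.mem_cons.1 hp with rfl | hp
      · exact ⟨ha _ (Nat.le_add_left 1 k), hε⟩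
      · exact hwL p hp
    · rw [run_cons, ← h, ← pairing_subdiv hm0 (h𝒜 _ (ha _ (Nat.le_add_left 1 k)))]
      congr 2
      funext κ
      rw [iterate]
      congr 1
      funext i
      rw [← hdec i]

theorem Decays.abs_pairing_iterate_le {m : ℤ} (hm : 2 ≤ |m|) {N : ℕ} {𝒜 : Set (Mask s)}
    (h𝒜 : ∀ a ∈ 𝒜, SupportedIn N a) {d : ℕ} {r : ℝ} (h : Decays m N (letters m 𝒜) d r) (R : ℝ) :
    ∃ C, 0 ≤ C ∧ ∀ (a : ℕ → Mask s), (∀ r, 1 ≤ r → a r ∈ 𝒜) → ∀ (c : Mask s) (A : ℝ),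
      (∀ α, |c α| ≤ A) → ∀ u ∈ annihilator s d, ↑u.support ⊆ region s m N R → ∀ (k : ℕ)
      (γ : Fin s → ℤ),
      |pairing (fun κ => iterate m a c k (fun i => γ i - κ i)) u| ≤ A * (C * r ^ k * l1 u) := by
  obtain ⟨C, hC, h⟩ := h R
  refine ⟨C, hC, fun a ha c A hA u hu hs k γ => ?_⟩
  obtain ⟨w, hw, hwL, γ', h1⟩ := pairing_iterate hm h𝒜 ha c k γ u
  rw [h1, ← hw]
  have hA0 : 0 ≤ A := (abs_nonneg _).trans (hA 0)
  exact (abs_pairing_le fun κ _ => hA _).trans (mul_le_mul_of_nonneg_left (h u hu hs w hwL) hA0)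

/-! ### Vectors on the index set as finitely supported sequences -/

/-- Extension by zero of a vector on the index set. -/
def extend (s : ℕ) (m : ℤ) (N : ℕ) : EuclideanSpace ℝ (indexSet s m N) →ₗ[ℝ] FinSeq s where
  toFun v := ∑ κ : indexSet s m N, Finsupp.single κ.1 (v κ)
  map_add' v w := by simp [Finset.sum_add_distrib]
  map_smul' c v := by simp [Finset.smul_sum]

theorem extend_def {m : ℤ} {N : ℕ} (v : EuclideanSpace ℝ (indexSet s m N)) :
    extend s m N v = ∑ κ : indexSet s m N, Finsupp.single κ.1 (v κ) := rfl

theorem extend_apply {m : ℤ} {N : ℕ} (v : EuclideanSpace ℝ (indexSet s m N))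
    (κ : indexSet s m N) : extend s m N v κ.1 = v κ := by
  classical
  rw [extend_def, Finsupp.finsetSum_apply, Finset.sum_eq_single κ]
  · simp
  · intro κ' _ h
    rw [Finsupp.single_apply, if_neg (fun h' => h (Subtype.ext h'))]
  · simp

theorem extend_apply_of_notMem {m : ℤ} {N : ℕ} (v : EuclideanSpace ℝ (indexSet s m N))
    {κ : Fin s → ℤ} (hκ : κ ∉ indexSet s m N) : extend s m N v κ = 0 := by
  classical
  rw [extend_def, Finsupp.finsetSum_apply]
  refine Finset.sum_eq_zero fun κ' _ => ?_
  rw [Finsupp.single_apply, if_neg]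
  rintro rfl
  exact hκ κ'.2

theorem support_extend_subset {m : ℤ} {N : ℕ} (v : EuclideanSpace ℝ (indexSet s m N)) :
    (extend s m N v).support ⊆ indexSet s m N := by
  intro κ hκ
  by_contra h
  exact Finsupp.mem_support_iff.1 hκ (extend_apply_of_notMem v h)

theorem exists_extend_eq {m : ℤ} {N : ℕ} {u : FinSeq s} (hu : u.support ⊆ indexSet s m N) :
    ∃ v, extend s m N v = u := by
  refine ⟨WithLp.toLp 2 fun κ => u κ.1, ?_⟩
  ext κ
  by_cases h : κ ∈ indexSet s m N
  · exact extend_apply _ ⟨κ, h⟩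
  · rw [extend_apply_of_notMem _ h]
    exact (Finsupp.notMem_support_iff.1 fun h' => h (hu h')).symm

theorem pairing_extend {m : ℤ} {N : ℕ} (F : Mask s) (v : EuclideanSpace ℝ (indexSet s m N)) :
    pairing F (extend s m N v) = ∑ κ : indexSet s m N, v κ * F κ.1 := by
  rw [extend_def, map_sum]; simp

theorem l1_extend_le {m : ℤ} {N : ℕ} (v : EuclideanSpace ℝ (indexSet s m N)) :
    l1 (extend s m N v) ≤ Fintype.card (indexSet s m N) * ‖v‖ := by
  rw [extend_def]
  refine (l1_sum_le _ _).trans ?_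
  rw [← nsmul_eq_mul, ← Finset.card_univ]
  refine Finset.sum_le_card_nsmul _ _ _ fun κ _ => ?_
  rw [l1_single]
  exact PiLp.norm_apply_le v κ

theorem norm_le_l1_extend {m : ℤ} {N : ℕ} (v : EuclideanSpace ℝ (indexSet s m N)) :
    ‖v‖ ≤ l1 (extend s m N v) := by
  classical
  rw [l1_eq_sum (support_extend_subset v), ← Finset.sum_attach]
  have h1 : ∀ κ ∈ (indexSet s m N).attach, |extend s m N v κ.1| = |v κ| := fun κ _ => by
    rw [extend_apply]
  rw [Finset.sum_congr rfl h1, EuclideanSpace.norm_eq]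
  refine Real.sqrt_le_iff.2 ⟨Finset.sum_nonneg fun _ _ => abs_nonneg _, ?_⟩
  exact Finset.sum_sq_le_sq_sum_of_nonneg fun _ _ => abs_nonneg _

/-- The inner product with a sampled polynomial is its pairing with the extension by zero, so
orthogonality in `ℝ^K` is annihilation of polynomials of degree at most `ℓ`. -/
theorem mem_diffSpace_iff {m : ℤ} {N ℓ : ℕ} (v : EuclideanSpace ℝ (indexSet s m N)) :
    v ∈ diffSpace s m N ℓ ↔ extend s m N v ∈ annihilator s (ℓ + 1) := by
  rw [diffSpace, Submodule.mem_orthogonal, mem_annihilator]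
  have hinner : ∀ (w : EuclideanSpace ℝ (indexSet s m N)) (p : MvPolynomial (Fin s) ℝ),
      (∀ α : indexSet s m N, w α = MvPolynomial.eval (fun i => (α.1 i : ℝ)) p) →
      inner ℝ w v = pairing (evalInt p) (extend s m N v) := by
    intro w p hw
    rw [pairing_extend, PiLp.inner_apply]
    refine Finset.sum_congr rfl fun κ _ => ?_
    simp [hw κ, evalInt]
  constructor
  · intro h p hp
    rw [← hinner (WithLp.toLp 2 fun α => MvPolynomial.eval (fun i => (α.1 i : ℝ)) p) p fun _ => rfl]
    exact h _ (Submodule.subset_span ⟨p, mem_polyLT_succ.1 hp, fun _ => rfl⟩)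
  · intro h w hw
    induction hw using Submodule.span_induction with
    | mem w hw =>
      obtain ⟨p, hp, hw⟩ := hw
      rw [hinner w p hw]
      exact h p (mem_polyLT_succ.2 hp)
    | zero => simp
    | add x y _ _ hx hy => rw [inner_add_left, hx, hy, add_zero]
    | smul c x _ hx => rw [inner_smul_left, hx, mul_zero]

/-- Truncating to `K` loses nothing, because a transfer of a sequence supported in `K` is again
supported in `K`. -/
theorem extend_toEuclideanLin {m : ℤ} (hm : 2 ≤ |m|) {N : ℕ} {a : Mask s} (ha : SupportedIn N a)
    {ε : Fin s → ℤ} (hε : ε ∈ cosets s m) (v : EuclideanSpace ℝ (indexSet s m N)) :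
    extend s m N (Matrix.toEuclideanLin (transitionMatrix m N a ε) v) =
      transfer m N a ε (extend s m N v) := by
  have hm0 : m ≠ 0 := by rintro rfl; norm_num at hm
  ext β
  by_cases hβ : β ∈ indexSet s m N
  · rw [transfer_apply hm0 ha]
    have h1 := pairing_extend (fun κ => a (fun i => m * β i + ε i - κ i)) v
    rw [pairing, Finsupp.linearCombination_apply] at h1
    rw [show β = (⟨β, hβ⟩ : indexSet s m N).1 from rfl, extend_apply]
    refine Eq.trans ?_ h1.symm
    rw [Matrix.toLpLin_apply]
    simp only [Matrix.mulVec, dotProduct, transitionMatrix, Matrix.of_apply, mul_comm]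
  · rw [extend_apply_of_notMem _ hβ]
    by_contra hne
    obtain ⟨κ, hκ, γ, hγ, h⟩ := exists_of_mem_support_transfer
      (Finsupp.mem_support_iff.2 (Ne.symm hne))
    exact hβ (mem_indexSet_of_mul_eq hm (support_extend_subset v hκ) hγ hε h)

/-! ### Restrictions of the transition matrices -/

theorem IsRestriction.ext {ι : Type*} [Fintype ι] [DecidableEq ι] {A : Matrix ι ι ℝ}
    {V : Submodule ℝ (EuclideanSpace ℝ ι)} {T T' : V →L[ℝ] V} (h : IsRestriction A V T)
    (h' : IsRestriction A V T') : T = T' := by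
  ext1 v
  exact Subtype.ext ((h v).trans (h' v).symm)

theorem exists_isRestriction {m : ℤ} (hm : 2 ≤ |m|) {N ℓ : ℕ} {a : Mask s}
    (ha : Reproducing m N ℓ a) {ε : Fin s → ℤ} (hε : ε ∈ cosets s m) :
    ∃ T, IsRestriction (transitionMatrix m N a ε) (diffSpace s m N ℓ) T := by
  have hm0 : m ≠ 0 := by rintro rfl; norm_num at hm
  have hinv : ∀ v ∈ diffSpace s m N ℓ,
      Matrix.toEuclideanLin (transitionMatrix m N a ε) v ∈ diffSpace s m N ℓ := by
    intro v hv
    rw [mem_diffSpace_iff] at hv ⊢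
    rw [extend_toEuclideanLin hm ha.supported hε]
    exact ha.transfer_mem hm0 ε le_rfl hv
  exact ⟨LinearMap.toContinuousLinearMap
    ((Matrix.toEuclideanLin (transitionMatrix m N a ε)).restrict hinv), fun v => rfl⟩

theorem finite_restrictedFamily {m : ℤ} {N ℓ : ℕ} {𝒜 : Set (Mask s)} (h : 𝒜.Finite) :
    (restrictedFamily m N ℓ 𝒜).Finite := by
  have : restrictedFamily m N ℓ 𝒜 = ⋃ a ∈ 𝒜, ⋃ ε ∈ (cosets s m : Set (Fin s → ℤ)),
      {T | IsRestriction (transitionMatrix m N a ε) (diffSpace s m N ℓ) T} := by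
    ext T; simp [restrictedFamily]
  rw [this]
  exact h.biUnion fun a _ => (cosets s m).finite_toSet.biUnion fun ε _ =>
    Set.Subsingleton.finite fun T hT T' hT' => IsRestriction.ext hT hT'

/-- A bound for products of restricted transition matrices gives decay of transfer operators. -/
theorem l1_run_le_of_norm_prod_le {m : ℤ} (hm : 2 ≤ |m|) {N ℓ : ℕ} {𝒜 : Set (Mask s)}
    (h𝒜 : ∀ a ∈ 𝒜, Reproducing m N ℓ a) {C ρ : ℝ} (hC : 0 ≤ C) (hρ : 0 ≤ ρ)
    (h : ∀ l : List (diffSpace s m N ℓ →L[ℝ] diffSpace s m N ℓ),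
      (∀ T ∈ l, T ∈ restrictedFamily m N ℓ 𝒜) → ‖l.prod‖ ≤ C * ρ ^ l.length) :
    ∃ C', 0 ≤ C' ∧ ∀ u ∈ annihilator s (ℓ + 1), u.support ⊆ indexSet s m N →
      ∀ w : List (Mask s × (Fin s → ℤ)), (∀ p ∈ w, p ∈ letters m 𝒜) →
        l1 (run m N w u) ≤ C' * ρ ^ w.length * l1 u := by
  have hrun : ∀ (w : List (Mask s × (Fin s → ℤ))), (∀ p ∈ w, p ∈ letters m 𝒜) →
      ∃ l : List (diffSpace s m N ℓ →L[ℝ] diffSpace s m N ℓ), l.length = w.length ∧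
        (∀ T ∈ l, T ∈ restrictedFamily m N ℓ 𝒜) ∧
        ∀ v : diffSpace s m N ℓ, run m N w (extend s m N v) = extend s m N (l.prod v) := by
    intro w
    induction w with
    | nil => exact fun _ => ⟨[], rfl, by simp, fun v => rfl⟩
    | cons p w ih =>
      intro hw
      have hp := hw p List.mem_cons_self
      obtain ⟨l, hl, hlL, hlw⟩ := ih fun q hq => hw q (List.mem_cons_of_mem _ hq)
      obtain ⟨T, hT⟩ := exists_isRestriction hm (h𝒜 _ hp.1) hp.2
      -- The first letter acts first, hence is the last factor of the product.
      refine ⟨l ++ [T], by simp [hl], ?_, fun v => ?_⟩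
      · intro X hX
        rcases List.mem_append.1 hX with h | h
        · exact hlL X h
        · rw [List.mem_singleton.1 h]
          exact ⟨p.1, hp.1, p.2, hp.2, hT⟩
      · rw [run_cons, ← extend_toEuclideanLin hm (h𝒜 _ hp.1).supported hp.2, ← hT, hlw,
          List.prod_append, List.prod_singleton]
        rfl
  refine ⟨Fintype.card (indexSet s m N) * C, by positivity, fun u hu hs w hw => ?_⟩
  obtain ⟨v, rfl⟩ := exists_extend_eq hs
  have hv : v ∈ diffSpace s m N ℓ := (mem_diffSpace_iff v).2 hu
  obtain ⟨l, hl, hlL, hlw⟩ := hrun w hw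
  have h1 := hlw ⟨v, hv⟩
  dsimp only at h1
  rw [h1]
  calc l1 (extend s m N (l.prod ⟨v, hv⟩))
      ≤ Fintype.card (indexSet s m N) * ‖l.prod ⟨v, hv⟩‖ := l1_extend_le _
    _ ≤ Fintype.card (indexSet s m N) * ((C * ρ ^ w.length) * ‖v‖) := by
        gcongr
        refine (l.prod.le_opNorm ⟨v, hv⟩).trans ?_
        rw [← hl]
        exact mul_le_mul_of_nonneg_right (h l hlL) (norm_nonneg _)
    _ ≤ Fintype.card (indexSet s m N) * ((C * ρ ^ w.length) * l1 (extend s m N v)) := by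
        gcongr
        exact norm_le_l1_extend v
    _ = _ := by ring

/-- The transition matrix depends linearly on the mask, and the same `ε` is used at both end points.
-/
theorem restrictedFamily_subset_segment {m : ℤ} (hm : 2 ≤ |m|) {N ℓ : ℕ} {a₁ a₂ : Mask s}
    (h₁ : Reproducing m N ℓ a₁) (h₂ : Reproducing m N ℓ a₂) {𝒜 : Set (Mask s)}
    (h𝒜 : 𝒜 ⊆ segment ℝ a₁ a₂) :
    ∀ T ∈ restrictedFamily m N ℓ 𝒜, ∃ X ∈ restrictedFamily m N ℓ {a₁, a₂},
      ∃ Y ∈ restrictedFamily m N ℓ {a₁, a₂}, T ∈ segment ℝ X Y := by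
  rintro T ⟨a, ha, ε, hε, hT⟩
  obtain ⟨x, y, hx, hy, hxy, rfl⟩ := h𝒜 ha
  obtain ⟨X, hX⟩ := exists_isRestriction hm h₁ hε
  obtain ⟨Y, hY⟩ := exists_isRestriction hm h₂ hε
  refine ⟨X, ⟨a₁, by simp, ε, hε, hX⟩, Y, ⟨a₂, by simp, ε, hε, hY⟩, x, y, hx, hy, hxy, ?_⟩
  refine IsRestriction.ext (A := transitionMatrix m N (x • a₁ + y • a₂) ε) (fun v => ?_) hT
  have hA : transitionMatrix m N (x • a₁ + y • a₂) ε =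
      x • transitionMatrix m N a₁ ε + y • transitionMatrix m N a₂ ε := by
    ext α β
    simp [transitionMatrix]
  rw [hA, map_add, map_smul, map_smul]
  simp only [_root_.add_apply, _root_.smul_apply, Submodule.coe_add,
    Submodule.coe_smul, LinearMap.add_apply, LinearMap.smul_apply, hX v, hY v]

theorem sum_abs_le_of_mem_segment {N : ℕ} {a₁ a₂ a : Mask s} (h : a ∈ segment ℝ a₁ a₂) :
    ∑ γ ∈ maskBox s N, |a γ| ≤ ∑ γ ∈ maskBox s N, |a₁ γ| + ∑ γ ∈ maskBox s N, |a₂ γ| := by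
  obtain ⟨x, y, hx, hy, hxy, rfl⟩ := h
  rw [← Finset.sum_add_distrib]
  refine Finset.sum_le_sum fun γ _ => ?_
  simp only [Pi.add_apply, Pi.smul_apply, smul_eq_mul]
  refine (abs_add_le _ _).trans ?_
  rw [abs_mul, abs_mul, abs_of_nonneg hx, abs_of_nonneg hy]
  exact add_le_add (mul_le_of_le_one_left (abs_nonneg _) (by linarith))
    (mul_le_of_le_one_left (abs_nonneg _) (by linarith))

theorem decays_of_jointSpectralRadius_lt {m : ℤ} (hm : 2 ≤ |m|) {N ℓ : ℕ} {a₁ a₂ : Mask s}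
    (h₁ : Reproducing m N ℓ a₁) (h₂ : Reproducing m N ℓ a₂) {𝒜 : Set (Mask s)}
    (h𝒜 : 𝒜 ⊆ segment ℝ a₁ a₂) (hrep : ∀ a ∈ 𝒜, Reproducing m N ℓ a) {ρ : ℝ} (hρ : 0 < ρ)
    (h : jointSpectralRadius (restrictedFamily m N ℓ {a₁, a₂}) < ENNReal.ofReal ρ) :
    Decays m N (letters m 𝒜) (ℓ + 1) ρ := by
  obtain ⟨B, hB⟩ := ((finite_restrictedFamily (m := m) (N := N) (ℓ := ℓ)
    (Set.toFinite {a₁, a₂})).image norm).bddAbove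
  obtain ⟨C, hC, hl⟩ := exists_bound_of_jointSpectralRadius_lt
    ⟨B, fun T hT => hB (Set.mem_image_of_mem norm hT)⟩
    ContinuousLinearMap.norm_id_le hρ h
  refine decays_of_indexSet hm hrep (fun a ha => sum_abs_le_of_mem_segment (h𝒜 ha))
    (by positivity) hρ (l1_run_le_of_norm_prod_le hm hrep hC hρ.le fun l hl' => ?_)
  exact norm_prod_le_of_segment (restrictedFamily_subset_segment hm h₁ h₂ h𝒜)
    (b := fun n => C * ρ ^ n) hl l hl'

/-! ### The decay rate is at least `|m|^{-(ℓ + 1)}` in positive dimension -/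

theorem card_cosets (s : ℕ) (m : ℤ) : ((cosets s m).card : ℝ) = |(m : ℝ)| ^ s := by
  rw [cosets, Fintype.card_piFinset_const, Int.card_Ico, sub_zero]
  push_cast
  rw [← Int.cast_natCast, Int.toNat_of_nonneg (abs_nonneg m)]
  simp

/-- As `ε` runs through the cosets, `mβ + ε` runs once through `ℤ^s`, so the sum is the pairing of
`F` with the full convolution of `u` and the mask. -/
theorem sum_pairing_transfer_cosets {m : ℤ} (hm0 : m ≠ 0) (N : ℕ) (a : Mask s) (F : Mask s)
    (u : FinSeq s) :
    ∑ ε ∈ cosets s m, pairing (fun β => F fun i => m * β i + ε i) (transfer m N a ε u) =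
      ∑ γ ∈ maskBox s N, a γ * pairing (fun κ => F fun i => κ i + γ i) u := by
  classical
  simp only [pairing_transfer, ← pairing_mul_left]
  rw [← pairing_sum_left, ← pairing_sum_left]
  congr 2
  funext κ
  rw [Finset.sum_comm]
  refine Finset.sum_congr rfl fun γ _ => ?_
  have h1 : ∀ ε ∈ cosets s m, (if ∀ i, m ∣ γ i - (ε i - κ i) then
      a γ * F (fun i => m * ((γ i - (ε i - κ i)) / m) + ε i) else 0) =
      if ε = fun i => (κ i + γ i) % m then a γ * F (fun i => κ i + γ i) else 0 := by
    intro ε hε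
    have hiff : (∀ i, m ∣ γ i - (ε i - κ i)) ↔ ε = fun i => (κ i + γ i) % m := by
      constructor
      · intro h
        funext i
        have h4 := Finset.mem_Ico.1 (Fintype.mem_piFinset.1 hε i)
        have h5 : m ∣ (κ i + γ i) - ε i := by
          have := h i; rwa [show γ i - (ε i - κ i) = κ i + γ i - ε i by ring] at this
        rw [← Int.emod_abs, ← Int.emod_eq_of_lt h4.1 h4.2]
        exact ((Int.emod_emod_of_dvd _ dvd_rfl).symm.trans
          (by rw [Int.emod_emod]; exact Int.ModEq.eq (Int.modEq_iff_dvd.2 ((abs_dvd _ _).2 h5))))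
      · rintro rfl i
        rw [show γ i - ((κ i + γ i) % m - κ i) = κ i + γ i - (κ i + γ i) % m by ring]
        exact Int.dvd_self_sub_emod
    by_cases h : ∀ i, m ∣ γ i - (ε i - κ i)
    · rw [if_pos h, if_pos (hiff.1 h)]
      congr 2
      funext i
      rw [Int.mul_ediv_cancel' (h i)]
      ring
    · rw [if_neg h, if_neg (fun h' => h (hiff.2 h'))]
  rw [Finset.sum_congr rfl h1, Finset.sum_ite_eq' (cosets s m), if_pos]
  rw [cosets, Fintype.mem_piFinset]
  intro i
  rw [Finset.mem_Ico]
  exact ⟨Int.emod_nonneg _ hm0, Int.emod_lt_abs _ hm0⟩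

/-- Averaged over the cosets, the transfer operators of a mask with sum rules of order `d` multiply
moments of order `d` by `m^{-d}` on the annihilator of the polynomials of degree smaller than `d`. -/
theorem Reproducing.sum_pairing_transfer {m : ℤ} (hm0 : m ≠ 0) {N ℓ : ℕ} {a : Mask s}
    (ha : Reproducing m N ℓ a) {p : MvPolynomial (Fin s) ℝ} (hp : p ∈ polyLT s (ℓ + 2))
    {u : FinSeq s} (hu : u ∈ annihilator s (ℓ + 1)) :
    (m : ℝ) ^ (ℓ + 1) * ∑ ε ∈ cosets s m, pairing (evalInt p) (transfer m N a ε u) =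
      |(m : ℝ)| ^ s * pairing (evalInt p) u := by
  have hmR : (m : ℝ) ≠ 0 := by exact_mod_cast hm0
  -- On the annihilator of lower degrees, moments of order `ℓ + 1` ignore translations and scale by
  -- `t^{ℓ+1}`. After summation over `ε` no coset condition remains, so sum rules of one order more
  -- are not needed.
  have hshift : ∀ (t : ℝ) (v : Fin s → ℝ), ∀ w ∈ annihilator s (ℓ + 1),
      pairing (evalInt (affineSubst t v p)) w = t ^ (ℓ + 1) * pairing (evalInt p) w := by
    intro t v w hw
    have h := hw _ (affineSubst_sub_mem t v hp)
    rw [sub_eq_add_neg, ← neg_mul, ← map_neg, pairing_evalInt_add, pairing_evalInt_C_mul] at h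
    linarith
  have h1 := sum_pairing_transfer_cosets hm0 N a (evalInt p) u
  have h2 : ∀ ε ∈ cosets s m, pairing (fun β => evalInt p fun i => m * β i + ε i)
      (transfer m N a ε u) = (m : ℝ) ^ (ℓ + 1) * pairing (evalInt p) (transfer m N a ε u) := by
    intro ε _
    rw [← hshift m (fun i => ε i / m) _ (ha.transfer_mem hm0 ε le_rfl hu)]
    congr 2
    funext β
    rw [evalInt, evalInt, eval_affineSubst]
    congr 2
    funext i
    push_cast
    field_simp
  have h3 : ∀ γ ∈ maskBox s N, a γ * pairing (fun κ => evalInt p fun i => κ i + γ i) u =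
      a γ * pairing (evalInt p) u := by
    intro γ _
    have := hshift 1 (fun i => γ i) u hu
    rw [one_pow, one_mul] at this
    rw [← this]
    congr 3
    funext κ
    rw [evalInt, evalInt, eval_affineSubst]
    congr 2
    funext i
    push_cast
    ring
  rw [Finset.sum_congr rfl h2, Finset.sum_congr rfl h3, ← Finset.mul_sum, ← Finset.sum_mul,
    ha.sum_eq] at h1
  exact h1

/-- Pigeonhole: averaged over `ε` the moment is multiplied by `m^{-(ℓ+1)}`, so at each step some `ε`
shrinks its modulus by no more than that factor. -/
theorem Reproducing.exists_word {m : ℤ} (hm0 : m ≠ 0) {N ℓ : ℕ} {a : Mask s}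
    (ha : Reproducing m N ℓ a) {p : MvPolynomial (Fin s) ℝ} (hp : p ∈ polyLT s (ℓ + 2))
    (n : ℕ) {u : FinSeq s} (hu : u ∈ annihilator s (ℓ + 1)) :
    ∃ w : List (Mask s × (Fin s → ℤ)), w.length = n ∧ (∀ q ∈ w, q ∈ letters m {a}) ∧
      |pairing (evalInt p) u| ≤ (|(m : ℝ)| ^ (ℓ + 1)) ^ n * |pairing (evalInt p) (run m N w u)| := by
  induction n generalizing u with
  | zero => exact ⟨[], rfl, by simp, by simp⟩
  | succ n ih =>
    have hM : 0 < |(m : ℝ)| := by simpa using hm0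
    obtain ⟨ε, hε, h1⟩ : ∃ ε ∈ cosets s m, |pairing (evalInt p) u| ≤
        |(m : ℝ)| ^ (ℓ + 1) * |pairing (evalInt p) (transfer m N a ε u)| := by
      by_contra! hcon
      have hne : (cosets s m).Nonempty := by
        rw [← Finset.card_pos, ← Nat.cast_pos (α := ℝ), card_cosets]; positivity
      have h2 := Finset.sum_lt_sum_of_nonempty hne hcon
      rw [Finset.sum_const, nsmul_eq_mul, card_cosets, ← Finset.mul_sum] at h2
      have h3 := congrArg abs (ha.sum_pairing_transfer hm0 hp hu)
      rw [abs_mul, abs_mul, abs_pow, abs_pow, abs_abs] at h3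
      rw [← h3] at h2
      exact absurd h2 (not_lt.2 (mul_le_mul_of_nonneg_left (Finset.abs_sum_le_sum_abs _ _)
        (by positivity)))
    obtain ⟨w, hw, hwL, h2⟩ := ih (ha.transfer_mem hm0 ε le_rfl hu)
    refine ⟨(a, ε) :: w, by simp [hw], ?_, ?_⟩
    · intro q hq
      rcases List.mem_cons.1 hq with rfl | hq
      · exact ⟨rfl, hε⟩
      · exact hwL q hq
    · rw [run_cons, pow_succ', mul_assoc]
      exact h1.trans (mul_le_mul_of_nonneg_left h2 (by positivity))

/-- The finite difference of order `d` in the direction `i`. -/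
def finDiff (i : Fin s) (d : ℕ) : FinSeq s :=
  ∑ k ∈ Finset.range (d + 1),
    Finsupp.single (Pi.single i (k : ℤ)) (((-1 : ℤ) ^ (d - k) * d.choose k : ℤ) : ℝ)

theorem pairing_finDiff (i : Fin s) (d : ℕ) (F : Mask s) (f : ℝ → ℝ)
    (h : ∀ k : ℕ, F (Pi.single i (k : ℤ)) = f k) :
    pairing F (finDiff i d) = (fwdDiff (1 : ℝ))^[d] f 0 := by
  rw [finDiff, map_sum, fwdDiff_iter_eq_sum_shift]
  refine Finset.sum_congr rfl fun k _ => ?_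
  rw [pairing_single, h]
  simp

theorem finDiff_mem_annihilator (i : Fin s) (d : ℕ) : finDiff i d ∈ annihilator s d := by
  intro p hp
  refine polyLT_induction (P := fun p => pairing (evalInt p) (finDiff i d) = 0) ?_ ?_ ?_ hp
  · have := pairing_evalInt_C_mul 0 0 (finDiff i d)
    simpa using this
  · intro p q h1 h2
    rw [pairing_evalInt_add, h1, h2, add_zero]
  · intro n c hn
    have hle : n i < d := (Finsupp.le_degree i n).trans_lt hn
    -- On the `i`-th axis the monomial is a constant times `x^{n i}`, with `0^0 = 1` for absent
    -- variables; a difference of order `d > n i` kills it.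
    rw [pairing_finDiff i d _ ((c * ∏ j ∈ Finset.univ.erase i, (0 : ℝ) ^ n j) • fun x => x ^ n i)]
    · rw [fwdDiff_iter_const_smul, fwdDiff_iter_pow_eq_zero_of_lt hle]
      simp
    · intro k
      rw [evalInt, MvPolynomial.eval_monomial, Finsupp.prod_fintype _ _ (by simp),
        ← Finset.mul_prod_erase _ _ (Finset.mem_univ i)]
      have : ∀ j ∈ Finset.univ.erase i, ((Pi.single i (k : ℤ) : Fin s → ℤ) j : ℝ) ^ n j =
          0 ^ n j := by
        intro j hj
        rw [Pi.single_eq_of_ne (Finset.ne_of_mem_erase hj)]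
        simp
      rw [Finset.prod_congr rfl this, Pi.single_eq_same]
      simp only [Pi.smul_apply, smul_eq_mul, Int.cast_natCast]
      ring

theorem pairing_X_pow_finDiff (i : Fin s) (d : ℕ) :
    pairing (evalInt (MvPolynomial.X i ^ d)) (finDiff i d) = d.factorial := by
  rw [pairing_finDiff i d _ (fun x => x ^ d), fwdDiff_iter_eq_factorial]
  · simp
  · intro k; simp [evalInt]

/-- The finite difference of order `ℓ + 1` has nonzero moment `(ℓ+1)!` against `x_i^{ℓ+1}`. Some
words shrink this moment at most like `|m|^{-(ℓ+1)n}`, while supports stay bounded, so the moment is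
`O(ρ^n)`. A coordinate `i` must exist, which excludes dimension zero. -/
theorem Decays.inv_pow_le {m : ℤ} (hm : 2 ≤ |m|) {N ℓ : ℕ} {𝒜 : Set (Mask s)} {a : Mask s}
    (ha : a ∈ 𝒜) (hrep : Reproducing m N ℓ a) (i : Fin s) {ρ : ℝ} (hρ : 0 ≤ ρ)
    (h : Decays m N (letters m 𝒜) (ℓ + 1) ρ) : (|(m : ℝ)| ^ (ℓ + 1))⁻¹ ≤ ρ := by
  have hM := two_le_abs_cast hm
  have hm0 : m ≠ 0 := by rintro rfl; norm_num at hm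
  by_contra! hlt
  set u := finDiff i (ℓ + 1)
  have hu : u ∈ annihilator s (ℓ + 1) := finDiff_mem_annihilator i (ℓ + 1)
  set p : MvPolynomial (Fin s) ℝ := MvPolynomial.X i ^ (ℓ + 1)
  have hp : p ∈ polyLT s (ℓ + 2) := mem_polyLT_succ.2 (by
    rw [MvPolynomial.totalDegree_X_pow])
  set e : ℝ := ((N + |(m : ℝ)| - 1) / 2) / (|(m : ℝ)| - 1) with he
  obtain ⟨R, hR0, hR⟩ : ∃ R : ℝ, 0 ≤ R ∧ ↑u.support ⊆ region s m N R := by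
    obtain ⟨R, hR⟩ := (u.support.image fun κ => ∑ j, |(κ j : ℝ) - center m N|).exists_le
    refine ⟨max (R - e) 0, le_max_right _ _, fun κ hκ j => ?_⟩
    have h1 := hR _ (Finset.mem_image_of_mem _ hκ)
    have h2 := Finset.single_le_sum (f := fun j => |(κ j : ℝ) - center m N|)
      (fun j _ => abs_nonneg _) (Finset.mem_univ j)
    have h3 := le_max_left (R - e) 0
    linarith
  obtain ⟨C, hC, hd⟩ := h R
  set Q : ℝ := R + e + |center m N|
  have hQ0 : 0 ≤ Q := by
    have : 0 ≤ e := div_nonneg (by have := N.cast_nonneg (α := ℝ); linarith) (by linarith)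
    positivity
  have hbound : ∀ v : FinSeq s, ↑v.support ⊆ region s m N R →
      |pairing (evalInt p) v| ≤ Q ^ (ℓ + 1) * l1 v := by
    intro v hv
    refine abs_pairing_le fun κ hκ => ?_
    have h1 : |(κ i : ℝ)| ≤ Q := by
      have h2 := hv hκ i
      have h3 := abs_add_le ((κ i : ℝ) - center m N) (center m N)
      rw [sub_add_cancel] at h3
      linarith
    simp only [evalInt, p, map_pow, MvPolynomial.eval_X, abs_pow]
    gcongr
  have hrun : ∀ w : List (Mask s × (Fin s → ℤ)), (∀ q ∈ w, q ∈ letters m {a}) →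
      ∀ v : FinSeq s, ↑v.support ⊆ region s m N R → ↑(run m N w v).support ⊆ region s m N R := by
    intro w
    induction w with
    | nil => exact fun _ v hv => hv
    | cons q w ih =>
      intro hw v hv
      refine ih (fun q hq => hw q (List.mem_cons_of_mem _ hq)) _ ?_
      refine (support_transfer_subset_region hm (hw q List.mem_cons_self).2 hv).trans
        (region_mono (div_le_self hR0 (by linarith)))
  set θ := |(m : ℝ)| ^ (ℓ + 1) * ρ with hθ
  have hθ1 : θ < 1 := by
    rw [hθ, ← lt_inv_mul_iff₀ (by positivity), mul_one]; exact hlt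
  have hall : ∀ n : ℕ, ((ℓ + 1).factorial : ℝ) ≤ (Q ^ (ℓ + 1) * C * l1 u) * θ ^ n := by
    intro n
    obtain ⟨w, hw, hwL, h1⟩ := hrep.exists_word hm0 hp n hu
    rw [pairing_X_pow_finDiff, Nat.abs_cast] at h1
    have h2 := hd u hu hR w fun q hq => ⟨by rw [(hwL q hq).1]; exact ha, (hwL q hq).2⟩
    rw [hw] at h2
    calc _ ≤ _ := h1
      _ ≤ (|(m : ℝ)| ^ (ℓ + 1)) ^ n * (Q ^ (ℓ + 1) * (C * ρ ^ n * l1 u)) := by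
        gcongr
        exact (hbound _ (hrun w hwL u hR)).trans (by gcongr)
      _ = _ := by rw [hθ, mul_pow]; ring
  have hlim : Tendsto (fun n => (Q ^ (ℓ + 1) * C * l1 u) * θ ^ n) atTop (𝓝 0) := by
    simpa using (tendsto_pow_atTop_nhds_zero_of_lt_one (by positivity) hθ1).const_mul
      (Q ^ (ℓ + 1) * C * l1 u)
  have := ge_of_tendsto' hlim hall
  have hpos : (0 : ℝ) < ((ℓ + 1).factorial : ℝ) := by positivity
  linarith

/-! ### Derivatives of polynomial functions -/

/-- The function on `ℝ^s` defined by a polynomial. -/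
def polyFun (p : MvPolynomial (Fin s) ℝ) : Space s → ℝ := fun x => MvPolynomial.eval (fun i => x i) p

theorem hasFDerivAt_polyFun (p : MvPolynomial (Fin s) ℝ) (x : Space s) :
    HasFDerivAt (polyFun p)
      (∑ i, polyFun (MvPolynomial.pderiv i p) x • (EuclideanSpace.proj i : Space s →L[ℝ] ℝ)) x := by
  classical
  induction p using MvPolynomial.induction_on with
  | C a =>
    have : polyFun (s := s) (MvPolynomial.C a) = fun _ => a := by funext y; simp [polyFun]
    rw [this]
    simpa [polyFun] using hasFDerivAt_const a x
  | add p q hp hq =>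
    have : polyFun (p + q) = polyFun p + polyFun q := by funext y; simp [polyFun]
    rw [this]
    refine (hp.add hq).congr_fderiv ?_
    simp [polyFun, add_smul, Finset.sum_add_distrib]
  | mul_X p j hp =>
    have : polyFun (p * MvPolynomial.X j) =
        fun y => polyFun p y * (EuclideanSpace.proj j : Space s →L[ℝ] ℝ) y := by
      funext y; simp [polyFun]
    rw [this]
    refine (hp.mul (EuclideanSpace.proj j : Space s →L[ℝ] ℝ).hasFDerivAt).congr_fderiv ?_
    have h1 : ∀ i, polyFun (MvPolynomial.pderiv i (p * MvPolynomial.X j)) x =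
        polyFun (MvPolynomial.pderiv i p) x * x j + if i = j then polyFun p x else 0 := by
      intro i
      rw [MvPolynomial.pderiv_mul, MvPolynomial.pderiv_X]
      by_cases h : i = j
      · subst h; simp [polyFun]
      · simp [polyFun, h, Ne.symm h]
    simp only [h1, add_smul, Finset.sum_add_distrib, ite_smul, zero_smul, Finset.sum_ite_eq',
      Finset.mem_univ, if_true, Finset.smul_sum, smul_smul]
    rw [add_comm]
    congr 1
    refine Finset.sum_congr rfl fun i _ => ?_
    rw [mul_comm]; rfl

theorem contDiff_polyFun (p : MvPolynomial (Fin s) ℝ) {n : WithTop ℕ∞} :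
    ContDiff ℝ n (polyFun p) := by
  induction p using MvPolynomial.induction_on with
  | C a =>
    have : polyFun (s := s) (MvPolynomial.C a) = fun _ => a := by funext y; simp [polyFun]
    rw [this]; exact contDiff_const
  | add p q hp hq =>
    have : polyFun (p + q) = polyFun p + polyFun q := by funext y; simp [polyFun]
    rw [this]; exact hp.add hq
  | mul_X p j hp =>
    have : polyFun (p * MvPolynomial.X j) =
        fun y => polyFun p y * (EuclideanSpace.proj j : Space s →L[ℝ] ℝ) y := by
      funext y; simp [polyFun]
    rw [this]; exact hp.mul (EuclideanSpace.proj j : Space s →L[ℝ] ℝ).contDiff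

theorem eq_zero_of_mem_polyLT_zero {p : MvPolynomial (Fin s) ℝ} (hp : p ∈ polyLT s 0) : p = 0 := by
  rw [← MvPolynomial.support_eq_empty, Finset.eq_empty_iff_forall_notMem]
  exact fun n hn => absurd (mem_polyLT.1 hp n hn) (Nat.not_lt_zero _)

theorem pderiv_mem_polyLT {d : ℕ} {p : MvPolynomial (Fin s) ℝ} (hp : p ∈ polyLT s (d + 1))
    (i : Fin s) : MvPolynomial.pderiv i p ∈ polyLT s d := by
  refine polyLT_induction (P := fun p => MvPolynomial.pderiv i p ∈ polyLT s d) (by simp)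
    (fun p q h1 h2 => by rw [map_add]; exact Submodule.add_mem _ h1 h2) (fun n c hn => ?_) hp
  rw [MvPolynomial.pderiv_monomial, polyLT, MvPolynomial.monomial_mem_restrictSupport]
  rcases Nat.eq_zero_or_pos (n i) with h | h
  · right; simp [h]
  · left
    have h1 : (n - Finsupp.single i 1) + Finsupp.single i 1 = n :=
      tsub_add_cancel_of_le (Finsupp.single_le_iff.2 h)
    have h2 := congrArg Finsupp.degree h1
    rw [map_add, Finsupp.degree_single] at h2
    simp only [Set.mem_ofPred_eq]
    omega

theorem iteratedFDeriv_polyFun_eq_zero {d : ℕ} {p : MvPolynomial (Fin s) ℝ}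
    (hp : p ∈ polyLT s d) (x : Space s) : iteratedFDeriv ℝ d (polyFun p) x = 0 := by
  induction d generalizing p with
  | zero =>
    rw [eq_zero_of_mem_polyLT_zero hp]
    ext v; simp [polyFun]
  | succ d ih =>
    rw [← norm_eq_zero, ← norm_iteratedFDeriv_fderiv, norm_eq_zero]
    have h1 : fderiv ℝ (polyFun p) = ∑ i, fun x =>
        polyFun (MvPolynomial.pderiv i p) x • (EuclideanSpace.proj i : Space s →L[ℝ] ℝ) := by
      funext x
      rw [(hasFDerivAt_polyFun p x).fderiv, Finset.sum_apply]
    rw [h1, iteratedFDeriv_sum_apply]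
    · refine Finset.sum_eq_zero fun i _ => ?_
      have h2 : (fun x => polyFun (MvPolynomial.pderiv i p) x •
          (EuclideanSpace.proj i : Space s →L[ℝ] ℝ)) =
          ((ContinuousLinearMap.id ℝ ℝ).smulRight (EuclideanSpace.proj i : Space s →L[ℝ] ℝ)) ∘
            polyFun (MvPolynomial.pderiv i p) := by
        funext x; rfl
      rw [h2, ContinuousLinearMap.iteratedFDeriv_comp_left _ (contDiff_polyFun _).contDiffAt
        (n := d) le_rfl, ih (pderiv_mem_polyLT hp i)]
      ext v; simp
    · intro i _
      exact ((contDiff_polyFun _).smul contDiff_const).contDiffAt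

/-- A translation changes such a polynomial only in degrees below `d`, and these have vanishing
`d`-th derivative. -/
theorem iteratedFDeriv_polyFun_eq {d : ℕ} {p : MvPolynomial (Fin s) ℝ}
    (hp : p ∈ polyLT s (d + 1)) (x : Space s) :
    iteratedFDeriv ℝ d (polyFun p) x = iteratedFDeriv ℝ d (polyFun p) 0 := by
  have h1 := iteratedFDeriv_comp_add_right (𝕜 := ℝ) (f := polyFun p) d x 0
  rw [zero_add] at h1
  have h2 : (fun z => polyFun p (z + x)) =
      polyFun p + polyFun (affineSubst 1 (fun i => x i) p - MvPolynomial.C (1 ^ d) * p) := by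
    funext z
    simp [polyFun, eval_affineSubst]
  rw [← h1, h2, iteratedFDeriv_add_apply (contDiff_polyFun _).contDiffAt
    (contDiff_polyFun _).contDiffAt, iteratedFDeriv_polyFun_eq_zero (affineSubst_sub_mem _ _ hp),
    add_zero]

/-! ### Sums of integer translates -/

/-- The function `∑_α c(α) f(· - α)`. -/
def shiftSum (c : Mask s) (f : Space s → ℝ) : Space s → ℝ :=
  fun z => ∑' α : Fin s → ℤ, c α * f (z - intVec α)

/-- The index box `{-R, …, R}^s`. -/
def box (s : ℕ) (R : ℤ) : Finset (Fin s → ℤ) := Fintype.piFinset fun _ => Finset.Icc (-R) R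

theorem mem_box {R : ℤ} {κ : Fin s → ℤ} : κ ∈ box s R ↔ ∀ i, |κ i| ≤ R := by
  simp [box, abs_le]

/-- The values of `D^j f` in direction `v` at the points `y + κ`, `κ ∈ {-R, …, R}^s`. -/
def window (f : Space s → ℝ) (j : ℕ) (v : Fin j → Space s) (R : ℤ) (y : Space s) : FinSeq s :=
  ∑ κ ∈ box s R, Finsupp.single κ (iteratedFDeriv ℝ j f (y + intVec κ) v)

theorem support_window_subset (f : Space s → ℝ) (j : ℕ) (v : Fin j → Space s) (R : ℤ)
    (y : Space s) : (window f j v R y).support ⊆ box s R := by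
  classical
  intro κ hκ
  obtain ⟨κ', hκ', h⟩ := Finset.mem_biUnion.1 (Finsupp.support_finsetSum hκ)
  rwa [Finset.mem_singleton.1 (Finsupp.support_single_subset h)]

theorem l1_window_le {f : Space s → ℝ} {j : ℕ} {B : ℝ} (hB : ∀ x, ‖iteratedFDeriv ℝ j f x‖ ≤ B)
    (v : Fin j → Space s) (R : ℤ) (y : Space s) :
    l1 (window f j v R y) ≤ (box s R).card * B * ∏ i, ‖v i‖ := by
  refine (l1_sum_le _ _).trans ?_
  rw [mul_assoc, ← nsmul_eq_mul]
  refine Finset.sum_le_card_nsmul _ _ _ fun κ _ => ?_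
  rw [l1_single]
  exact ((iteratedFDeriv ℝ j f (y + intVec κ)).le_opNorm v).trans
    (mul_le_mul_of_nonneg_right (hB _) (Finset.prod_nonneg fun _ _ => norm_nonneg _))

/-- The box `{-R, …, R}^s` contains all translates of the support of `f` that meet the points near
the ball of radius `L`. -/
def Covers (f : Space s → ℝ) (L : ℝ) (R : ℤ) : Prop :=
  ∀ (y : Space s) (κ : Fin s → ℤ), (∀ i, |y i| ≤ L + 1) → f (y + intVec κ) ≠ 0 → κ ∈ box s R

/-- All larger boxes are allowed, so that two test functions can share one box. -/
theorem exists_covers {f : Space s → ℝ} (hf : HasCompactSupport f) (L : ℝ) :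
    ∃ R₀ : ℤ, ∀ R, R₀ ≤ R → Covers f L R := by
  obtain ⟨r, hr⟩ := hf.isCompact.isBounded.exists_norm_le
  refine ⟨⌈r + L + 1⌉, fun R hR y κ hy h => mem_box.2 fun i => ?_⟩
  have h1 := hr _ (subset_tsupport f h)
  have h2 := (PiLp.norm_apply_le (y + intVec κ) i).trans h1
  rw [Real.norm_eq_abs] at h2
  have h3 : (y + intVec κ) i = y i + κ i := rfl
  rw [h3] at h2
  have h4 : |(κ i : ℝ)| ≤ r + L + 1 := by
    have h5 := abs_sub_abs_le_abs_sub (κ i : ℝ) (-y i)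
    rw [abs_neg, sub_neg_eq_add, add_comm (κ i : ℝ)] at h5
    linarith [hy i]
  have h6 := h4.trans (Int.le_ceil _)
  have h7 : |κ i| ≤ ⌈r + L + 1⌉ := by exact_mod_cast h6
  exact h7.trans hR

theorem shiftSum_eq_sum {f : Space s → ℝ} {L : ℝ} {R : ℤ} (hR : Covers f L R) (c : Mask s)
    (γ : Fin s → ℤ) {z : Space s} (hz : ∀ i, |z i - γ i| ≤ L + 1) :
    shiftSum c f z = ∑ κ ∈ box s R, c (fun i => γ i - κ i) * f (z + (intVec κ - intVec γ)) := by
  have harg : ∀ κ, z - intVec (γ - κ) = z + (intVec κ - intVec γ) := by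
    intro κ
    ext i
    simp [intVec]
    ring
  rw [shiftSum, ← (Equiv.subLeft γ).tsum_eq, tsum_eq_sum (s := box s R)]
  · refine Finset.sum_congr rfl fun κ _ => ?_
    rw [Equiv.subLeft_apply, harg]; rfl
  · intro κ hκ
    by_contra hne
    have h1 := right_ne_zero_of_mul hne
    rw [Equiv.subLeft_apply, harg, add_sub_left_comm, add_comm] at h1
    exact hκ (hR (z - intVec γ) κ hz h1)

/-- The unit margin built into `Covers` makes one finite sum valid on a whole ball around `z`, so
the series may be differentiated term by term. -/
theorem shiftSum_eventuallyEq {f : Space s → ℝ} {L : ℝ} {R : ℤ} (hR : Covers f L R) (c : Mask s)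
    (γ : Fin s → ℤ) {z : Space s} (hz : ∀ i, |z i - γ i| ≤ L) :
    shiftSum c f =ᶠ[𝓝 z] ∑ κ ∈ box s R, fun z' =>
      c (fun i => γ i - κ i) • f (z' + (intVec κ - intVec γ)) := by
  filter_upwards [Metric.ball_mem_nhds z one_pos] with z' hz'
  rw [Finset.sum_apply]
  refine shiftSum_eq_sum hR c γ fun i => ?_
  have h1 := (PiLp.norm_apply_le (z' - z) i).trans (mem_ball_iff_norm.1 hz').le
  rw [Real.norm_eq_abs] at h1
  have h2 : (z' - z) i = z' i - z i := rfl
  rw [h2] at h1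
  have h3 := abs_add_le (z' i - z i) (z i - γ i)
  rw [sub_add_sub_cancel] at h3
  linarith [hz i]

theorem abs_sub_floor_le (x : ℝ) : |x - ⌊x⌋| ≤ 1 := by
  rw [abs_le]
  have := Int.floor_le x
  have := Int.lt_floor_add_one x
  constructor <;> linarith

theorem contDiff_shiftSum {f : Space s → ℝ} {n : WithTop ℕ∞} (hf : ContDiff ℝ n f)
    (hfs : HasCompactSupport f) (c : Mask s) : ContDiff ℝ n (shiftSum c f) := by
  obtain ⟨R, hR⟩ := exists_covers hfs 1
  rw [contDiff_iff_contDiffAt]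
  intro z
  refine ContDiffAt.congr_of_eventuallyEq ?_ (shiftSum_eventuallyEq (hR R le_rfl) c
    (fun i => ⌊z i⌋) (fun i => abs_sub_floor_le _))
  refine ContDiff.contDiffAt ?_
  rw [show (∑ κ ∈ box s R, fun z' : Space s => c (fun i => ⌊z i⌋ - κ i) •
    f (z' + (intVec κ - intVec fun i => ⌊z i⌋))) = fun z' => ∑ κ ∈ box s R,
    c (fun i => ⌊z i⌋ - κ i) • f (z' + (intVec κ - intVec fun i => ⌊z i⌋)) by
      funext z'; rw [Finset.sum_apply]]
  exact ContDiff.sum fun κ _ => (show ContDiff ℝ n fun x : Space s =>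
    f (x + (intVec κ - intVec fun i => ⌊z i⌋)) from
      hf.comp (contDiff_id.add contDiff_const)).const_smul (c fun i => ⌊z i⌋ - κ i)

theorem iteratedFDeriv_shiftSum {f : Space s → ℝ} {j : ℕ} (hf : ContDiff ℝ j f) {L : ℝ} {R : ℤ}
    (hR : Covers f L R) (c : Mask s) (γ : Fin s → ℤ) {z : Space s} (hz : ∀ i, |z i - γ i| ≤ L)
    (v : Fin j → Space s) :
    iteratedFDeriv ℝ j (shiftSum c f) z v =
      pairing (fun κ => c fun i => γ i - κ i) (window f j v R (z - intVec γ)) := by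
  have hcd : ∀ κ : Fin s → ℤ,
      ContDiff ℝ j (fun z' : Space s => f (z' + (intVec κ - intVec γ))) := fun κ =>
    hf.comp (contDiff_id.add contDiff_const)
  rw [((shiftSum_eventuallyEq hR c γ hz).iteratedFDeriv ℝ j).eq_of_nhds,
    iteratedFDeriv_sum_apply fun κ _ => ((hcd κ).const_smul (c fun i => γ i - κ i)).contDiffAt]
  rw [window, map_sum]
  simp only [pairing_single]
  rw [_root_.sum_apply]
  refine Finset.sum_congr rfl fun κ _ => ?_
  have h1 := iteratedFDeriv_const_smul_apply (𝕜 := ℝ) (a := c fun i => γ i - κ i)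
    (hcd κ).contDiffAt (x := z)
  have h2 : (fun z' => (c fun i => γ i - κ i) • f (z' + (intVec κ - intVec γ))) =
    (c fun i => γ i - κ i) • fun z' => f (z' + (intVec κ - intVec γ)) := rfl
  rw [h2, h1, iteratedFDeriv_comp_add_right, _root_.smul_apply, smul_eq_mul,
    mul_comm, sub_add_eq_add_sub, add_sub_assoc]

/-- Moments of the windows of a function whose translates reproduce a polynomial. -/
theorem pairing_evalInt_window {f : Space s → ℝ} {j : ℕ} (hf : ContDiff ℝ j f) {L : ℝ} {R : ℤ}
    (hR : Covers f L R) {p q : MvPolynomial (Fin s) ℝ}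
    (hq : shiftSum (evalInt (affineSubst (-1) 0 p)) f = polyFun q) {y : Space s}
    (hy : ∀ i, |y i| ≤ L) (v : Fin j → Space s) :
    pairing (evalInt p) (window f j v R y) = iteratedFDeriv ℝ j (polyFun q) y v := by
  -- The window entry at `κ` belongs to the translate by `α = -κ`; hence the reflected polynomial.
  have h := iteratedFDeriv_shiftSum hf hR (evalInt (affineSubst (-1) 0 p)) 0 (z := y)
    (by simpa using hy) v
  have h0 : (intVec 0 : Space s) = 0 := by ext i; simp [intVec]
  rw [← hq, h, h0, sub_zero]
  congr 2
  funext κ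
  rw [evalInt, evalInt, eval_affineSubst]
  congr 2
  funext i
  simp

theorem IsTestFunction.exists_shiftSum_eq {ℓ : ℕ} {f : Space s → ℝ} (hf : IsTestFunction ℓ f)
    {j : ℕ} (hj : j ≤ ℓ) {p : MvPolynomial (Fin s) ℝ} (hp : p ∈ polyLT s (j + 1)) :
    ∃ q ∈ polyLT s j, shiftSum (evalInt p) f = polyFun (p + q) := by
  have hp' := mem_polyLT_succ.1 hp
  obtain ⟨q, hq, h⟩ := hf.strangFix p (hp'.trans hj)
  refine ⟨q, ?_, funext h⟩
  rcases hq with rfl | hq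
  · exact Submodule.zero_mem _
  · exact mem_polyLT_of_lt (hq.trans_le hp')

/-- The moments of order `j` of the windows of `D^j f` are the same for all test functions. -/
theorem IsTestFunction.pairing_window {ℓ : ℕ} {f : Space s → ℝ} (hf : IsTestFunction ℓ f)
    {j : ℕ} (hj : j ≤ ℓ) {L : ℝ} {R : ℤ} (hR : Covers f L R) {p : MvPolynomial (Fin s) ℝ}
    (hp : p ∈ polyLT s (j + 1)) {y : Space s} (hy : ∀ i, |y i| ≤ L) (v : Fin j → Space s) :
    pairing (evalInt p) (window f j v R y) =
      iteratedFDeriv ℝ j (polyFun (affineSubst (-1) 0 p)) 0 v := by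
  have hp' : affineSubst (-1) 0 p ∈ polyLT s (j + 1) := affineSubst_mem _ _ hp
  obtain ⟨q, hq, h⟩ := hf.exists_shiftSum_eq hj hp'
  rw [pairing_evalInt_window (hf.contDiff.of_le (by exact_mod_cast hj)) hR h hy]
  have h2 : polyFun (affineSubst (-1) 0 p + q) = polyFun (affineSubst (-1) 0 p) + polyFun q := by
    funext x; simp [polyFun]
  rw [h2, iteratedFDeriv_add_apply (contDiff_polyFun _).contDiffAt (contDiff_polyFun _).contDiffAt,
    iteratedFDeriv_polyFun_eq_zero hq, add_zero, iteratedFDeriv_polyFun_eq hp']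

theorem IsTestFunction.pairing_window_eq_zero {ℓ : ℕ} {f : Space s → ℝ} (hf : IsTestFunction ℓ f)
    {j : ℕ} (hj : j ≤ ℓ) {L : ℝ} {R : ℤ} (hR : Covers f L R) {p : MvPolynomial (Fin s) ℝ}
    (hp : p ∈ polyLT s j) {y : Space s} (hy : ∀ i, |y i| ≤ L) (v : Fin j → Space s) :
    pairing (evalInt p) (window f j v R y) = 0 := by
  rw [hf.pairing_window hj hR (polyLT_mono j.le_succ hp) hy,
    iteratedFDeriv_polyFun_eq_zero (affineSubst_mem _ _ hp)]
  rfl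

/-- Translates reproduce polynomials of degree at most `ℓ` up to lower-degree terms, and one
derivative more kills the result. -/
theorem IsTestFunction.window_mem_annihilator {ℓ : ℕ} {f : Space s → ℝ} (hf : IsTestFunction ℓ f)
    (hf' : ContDiff ℝ (ℓ + 1 : ℕ) f) {L : ℝ} {R : ℤ} (hR : Covers f L R) {y : Space s}
    (hy : ∀ i, |y i| ≤ L) (v : Fin (ℓ + 1) → Space s) :
    window f (ℓ + 1) v R y ∈ annihilator s (ℓ + 1) := by
  intro p hp
  have hp' : affineSubst (-1) 0 p ∈ polyLT s (ℓ + 1) := affineSubst_mem _ _ hp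
  obtain ⟨q, hq, h⟩ := hf.exists_shiftSum_eq le_rfl hp'
  rw [pairing_evalInt_window hf' hR h hy, iteratedFDeriv_polyFun_eq_zero
    (Submodule.add_mem _ hp' (polyLT_mono ℓ.le_succ hq))]
  rfl

/-! ### Derivatives of the approximants -/

theorem approximant_eq_shiftSum (m : ℤ) (a : ℕ → Mask s) (c : Mask s) (f : Space s → ℝ) (k : ℕ) :
    approximant m a c f k = fun x => shiftSum (iterate m a c k) f ((m : ℝ) ^ k • x) := rfl

theorem contDiff_approximant {m : ℤ} {a : ℕ → Mask s} {c : Mask s} {f : Space s → ℝ}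
    {n : WithTop ℕ∞} (hf : ContDiff ℝ n f) (hfs : HasCompactSupport f) (k : ℕ) :
    ContDiff ℝ n (approximant m a c f k) := by
  rw [approximant_eq_shiftSum]
  exact (contDiff_shiftSum hf hfs _).comp (contDiff_const_smul _)

theorem iteratedFDeriv_approximant {m : ℤ} {a : ℕ → Mask s} {c : Mask s} {f : Space s → ℝ} {j : ℕ}
    (hf : ContDiff ℝ j f) (hfs : HasCompactSupport f) {L : ℝ} {R : ℤ} (hR : Covers f L R) {k : ℕ}
    {x : Space s} {γ : Fin s → ℤ} (hγ : ∀ i, |((m : ℝ) ^ k • x - intVec γ) i| ≤ L)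
    (v : Fin j → Space s) :
    iteratedFDeriv ℝ j (approximant m a c f k) x v =
      ((m : ℝ) ^ k) ^ j * pairing (fun κ => iterate m a c k fun i => γ i - κ i)
        (window f j v R ((m : ℝ) ^ k • x - intVec γ)) := by
  rw [approximant_eq_shiftSum, iteratedFDeriv_comp_const_smul _ (contDiff_shiftSum hf hfs _),
    _root_.smul_apply, iteratedFDeriv_shiftSum hf hR _ γ (z := (m : ℝ) ^ k • x) hγ, smul_eq_mul]

theorem exists_box_subset_region (s : ℕ) (m : ℤ) (N : ℕ) (R : ℤ) :
    ∃ R' : ℝ, 0 ≤ R' ∧ ↑(box s R) ⊆ region s m N R' := by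
  set e : ℝ := ((N + |(m : ℝ)| - 1) / 2) / (|(m : ℝ)| - 1)
  refine ⟨max (R + |center m N| - e) 0, le_max_right _ _, fun κ hκ i => ?_⟩
  have h1 : |(κ i : ℝ)| ≤ R := by exact_mod_cast mem_box.1 hκ i
  have h2 := abs_sub (κ i : ℝ) (center m N)
  have h3 := le_max_left (R + |center m N| - e) 0
  linarith

/-- The point `m^k x` rounded down. -/
def roundDown (m : ℤ) (k : ℕ) (x : Space s) : Fin s → ℤ := fun i => ⌊((m : ℝ) ^ k • x) i⌋

theorem abs_sub_roundDown_le (m : ℤ) (k : ℕ) (x : Space s) (i : Fin s) :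
    |((m : ℝ) ^ k • x - intVec (roundDown m k x)) i| ≤ 1 :=
  abs_sub_floor_le (((m : ℝ) ^ k • x) i)

section Estimates

variable {m : ℤ} {N ℓ : ℕ} {𝒜 : Set (Mask s)} {a : ℕ → Mask s} {c : Mask s} {A : ℝ}

/-- Pulled back to level `k`, the difference is a pairing with `m^j T(window at my) - (window at
y)`. The factor `m^j` cancels the scalar `m^{-j}` of `T` on moments of order `j`, so this sequence
annihilates degree at most `j`; decay with rate `r` then meets the chain-rule factor `|m|^{jk}`. -/
theorem norm_iteratedFDeriv_approximant_succ_sub_le (hm : 2 ≤ |m|) {B : ℝ}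
    (h𝒜 : ∀ a ∈ 𝒜, Reproducing m N ℓ a) (hB : ∀ a ∈ 𝒜, ∑ γ ∈ maskBox s N, |a γ| ≤ B)
    (hB0 : 0 ≤ B) {j : ℕ} (hj : j ≤ ℓ) {r : ℝ} (hr : 0 ≤ r)
    (hD : Decays m N (letters m 𝒜) (j + 1) r) {f : Space s → ℝ} (hf : IsTestFunction ℓ f)
    (ha : ∀ r, 1 ≤ r → a r ∈ 𝒜) (hA : ∀ α, |c α| ≤ A) :
    ∃ C, ∀ k x, ‖iteratedFDeriv ℝ j (approximant m a c f (k + 1)) x -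
      iteratedFDeriv ℝ j (approximant m a c f k) x‖ ≤ C * (|(m : ℝ)| ^ j * r) ^ k := by
  have hM := two_le_abs_cast hm
  have hm0 : m ≠ 0 := by rintro rfl; norm_num at hm
  have hmR : (m : ℝ) ≠ 0 := by exact_mod_cast hm0
  have hfj : ContDiff ℝ j f := hf.contDiff.of_le (by exact_mod_cast hj)
  -- The base point at level `k + 1` is `mγ`, so the remainder there is `my`, bounded by `|m|`
  -- rather than `1`, and the letter has `ε = 0`.
  obtain ⟨R, hR⟩ := exists_covers hf.hasCompactSupport |(m : ℝ)|
  replace hR := hR R le_rfl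
  obtain ⟨R', hR'0, hR'⟩ := exists_box_subset_region s m N R
  obtain ⟨C, hC, hE⟩ := hD.abs_pairing_iterate_le hm (fun a ha => (h𝒜 a ha).supported) R'
  obtain ⟨D, hDf⟩ := (hf.hasCompactSupport.iteratedFDeriv (𝕜 := ℝ) j).exists_bound_of_continuous
    (hfj.continuous_iteratedFDeriv le_rfl)
  have hD0 : 0 ≤ D := (norm_nonneg _).trans (hDf 0)
  have hA0 : 0 ≤ A := (abs_nonneg _).trans (hA 0)
  set W : ℝ := (|(m : ℝ)| ^ j * B + 1) * ((box s R).card * D)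
  refine ⟨A * C * W, fun k x => ?_⟩
  refine ContinuousMultilinearMap.opNorm_le_bound (by positivity) fun v => ?_
  set γ := roundDown m k x
  set y := (m : ℝ) ^ k • x - intVec γ with hy
  have hy1 : ∀ i, |y i| ≤ |(m : ℝ)| := fun i =>
    (abs_sub_roundDown_le m k x i).trans (by linarith)
  have hmy : (m : ℝ) ^ (k + 1) • x - intVec (fun i => m * γ i) = (m : ℝ) • y := by
    ext i
    simp only [hy, intVec, PiLp.sub_apply, PiLp.smul_apply, smul_eq_mul]
    push_cast
    ring
  have hmy1 : ∀ i, |((m : ℝ) • y) i| ≤ |(m : ℝ)| := by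
    intro i
    rw [PiLp.smul_apply, smul_eq_mul, abs_mul]
    exact mul_le_of_le_one_right (abs_nonneg _) (abs_sub_roundDown_le m k x i)
  have hε : (0 : Fin s → ℤ) ∈ cosets s m := by simp [cosets, abs_pos.2 hm0]
  set T := transfer m N (a (k + 1)) 0
  set w : FinSeq s := (m : ℝ) ^ j • T (window f j v R ((m : ℝ) • y)) - window f j v R y with hw
  have ha' := h𝒜 _ (ha (k + 1) (Nat.le_add_left 1 k))
  have hwm : w ∈ annihilator s (j + 1) := by
    intro p hp
    obtain ⟨q, hq, hqT⟩ := ha'.pairing_transfer hm0 0 hj hp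
    rw [hw, map_sub, map_smul, hqT, hf.pairing_window_eq_zero hj hR hq hmy1,
      hf.pairing_window hj hR hp hmy1, hf.pairing_window hj hR hp hy1, smul_eq_mul, add_zero,
      mul_inv_cancel_left₀ (pow_ne_zero _ hmR), sub_self]
  have hws : ↑w.support ⊆ region s m N R' := by
    classical
    intro κ hκ
    have hwin : ∀ y, ↑(window f j v R y).support ⊆ region s m N R' := fun y =>
      (Finset.coe_subset.2 (support_window_subset f j v R y)).trans hR'
    rcases Finset.mem_union.1 (Finsupp.support_sub hκ) with h1 | h1
    · exact region_mono (div_le_self hR'0 (by linarith))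
        (support_transfer_subset_region hm hε (hwin _) (Finsupp.support_smul h1))
    · exact hwin _ h1
  have hwl : l1 w ≤ W * ∏ i, ‖v i‖ := by
    rw [hw, sub_eq_add_neg, ← neg_one_smul ℝ (window f j v R y)]
    refine (l1_add_le _ _).trans ?_
    rw [l1_smul, l1_smul, abs_neg, abs_one, one_mul, abs_pow]
    have h1 := l1_window_le hDf v R y
    have h2 := l1_window_le hDf v R ((m : ℝ) • y)
    have h3 := (l1_transfer_le m N (a (k + 1)) 0 (window f j v R ((m : ℝ) • y))).trans
      (mul_le_mul_of_nonneg_right (hB _ (ha (k + 1) (Nat.le_add_left 1 k))) (l1_nonneg _))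
    calc _ ≤ |(m : ℝ)| ^ j * (B * ((box s R).card * D * ∏ i, ‖v i‖)) +
          (box s R).card * D * ∏ i, ‖v i‖ := by
          gcongr
          exact h3.trans (by gcongr)
      _ = _ := by ring
  have hstep : pairing (fun κ => iterate m a c (k + 1) fun i => m * γ i - κ i)
      (window f j v R ((m : ℝ) • y)) = pairing (fun κ => iterate m a c k fun i => γ i - κ i)
        (T (window f j v R ((m : ℝ) • y))) := by
    rw [← pairing_subdiv hm0 ha'.supported]
    simp only [Pi.zero_apply, add_zero]
    rfl
  have hdiff : (iteratedFDeriv ℝ j (approximant m a c f (k + 1)) x -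
      iteratedFDeriv ℝ j (approximant m a c f k) x) v =
      ((m : ℝ) ^ k) ^ j * pairing (fun κ => iterate m a c k fun i => γ i - κ i) w := by
    rw [_root_.sub_apply, iteratedFDeriv_approximant hfj hf.hasCompactSupport hR (γ := γ) hy1,
      iteratedFDeriv_approximant hfj hf.hasCompactSupport hR (γ := fun i => m * γ i)
        (by rw [hmy]; exact hmy1), hmy, hstep, hw, map_sub, map_smul, smul_eq_mul]
    ring
  rw [hdiff, Real.norm_eq_abs, abs_mul, abs_pow, abs_pow]
  calc _ ≤ (|(m : ℝ)| ^ k) ^ j * (A * (C * r ^ k * (W * ∏ i, ‖v i‖))) := by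
        gcongr
        exact (hE a ha c A hA w hwm hws k γ).trans (by gcongr)
    _ = _ := by rw [mul_pow, ← pow_mul, ← pow_mul, mul_comm k j]; ring

/-- The windows of two test functions have equal moments up to order `j`, so their difference lies
in the decaying annihilator. This makes the limit independent of the test function. -/
theorem norm_iteratedFDeriv_approximant_sub_le (hm : 2 ≤ |m|)
    (h𝒜 : ∀ a ∈ 𝒜, Reproducing m N ℓ a) {j : ℕ} (hj : j ≤ ℓ) {r : ℝ} (hr : 0 ≤ r)
    (hD : Decays m N (letters m 𝒜) (j + 1) r) {f f' : Space s → ℝ} (hf : IsTestFunction ℓ f)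
    (hf' : IsTestFunction ℓ f') (ha : ∀ r, 1 ≤ r → a r ∈ 𝒜) (hA : ∀ α, |c α| ≤ A) :
    ∃ C, ∀ k x, ‖iteratedFDeriv ℝ j (approximant m a c f k) x -
      iteratedFDeriv ℝ j (approximant m a c f' k) x‖ ≤ C * (|(m : ℝ)| ^ j * r) ^ k := by
  have hjℓ : ((j : ℕ∞) : WithTop ℕ∞) ≤ ((ℓ : ℕ∞) : WithTop ℕ∞) := by exact_mod_cast hj
  have hfj : ContDiff ℝ j f := hf.contDiff.of_le hjℓ
  have hfj' : ContDiff ℝ j f' := hf'.contDiff.of_le hjℓ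
  obtain ⟨R₁, hR₁⟩ := exists_covers hf.hasCompactSupport 1
  obtain ⟨R₂, hR₂⟩ := exists_covers hf'.hasCompactSupport 1
  set R := max R₁ R₂
  have hR := hR₁ R (le_max_left _ _)
  have hR' := hR₂ R (le_max_right _ _)
  obtain ⟨Q, hQ0, hQ⟩ := exists_box_subset_region s m N R
  obtain ⟨C, hC, hE⟩ := hD.abs_pairing_iterate_le hm (fun a ha => (h𝒜 a ha).supported) Q
  obtain ⟨D, hDf⟩ := (hf.hasCompactSupport.iteratedFDeriv (𝕜 := ℝ) j).exists_bound_of_continuous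
    (hfj.continuous_iteratedFDeriv le_rfl)
  obtain ⟨D', hDf'⟩ := (hf'.hasCompactSupport.iteratedFDeriv (𝕜 := ℝ)
    j).exists_bound_of_continuous (hfj'.continuous_iteratedFDeriv le_rfl)
  have hD0 : 0 ≤ D := (norm_nonneg _).trans (hDf 0)
  have hD0' : 0 ≤ D' := (norm_nonneg _).trans (hDf' 0)
  have hA0 : 0 ≤ A := (abs_nonneg _).trans (hA 0)
  refine ⟨A * C * ((box s R).card * D + (box s R).card * D'), fun k x => ?_⟩
  refine ContinuousMultilinearMap.opNorm_le_bound (by positivity) fun v => ?_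
  set γ := roundDown m k x
  set y := (m : ℝ) ^ k • x - intVec γ with hy
  have hy1 : ∀ i, |y i| ≤ 1 := abs_sub_roundDown_le m k x
  set w : FinSeq s := window f j v R y - window f' j v R y with hw
  have hwm : w ∈ annihilator s (j + 1) := by
    intro p hp
    rw [hw, map_sub, hf.pairing_window hj hR hp hy1, hf'.pairing_window hj hR' hp hy1, sub_self]
  have hws : ↑w.support ⊆ region s m N Q := by
    classical
    intro κ hκ
    rcases Finset.mem_union.1 (Finsupp.support_sub hκ) with h1 | h1
    · exact hQ (support_window_subset f j v R y h1)
    · exact hQ (support_window_subset f' j v R y h1)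
  have hwl : l1 w ≤ ((box s R).card * D + (box s R).card * D') * ∏ i, ‖v i‖ := by
    rw [hw, sub_eq_add_neg, ← neg_one_smul ℝ (window f' j v R y)]
    refine (l1_add_le _ _).trans ?_
    rw [l1_smul, abs_neg, abs_one, one_mul, add_mul]
    exact add_le_add (l1_window_le hDf v R y) (l1_window_le hDf' v R y)
  have hdiff : (iteratedFDeriv ℝ j (approximant m a c f k) x -
      iteratedFDeriv ℝ j (approximant m a c f' k) x) v =
      ((m : ℝ) ^ k) ^ j * pairing (fun κ => iterate m a c k fun i => γ i - κ i) w := by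
    rw [_root_.sub_apply, iteratedFDeriv_approximant hfj hf.hasCompactSupport hR (γ := γ) hy1,
      iteratedFDeriv_approximant hfj' hf'.hasCompactSupport hR' (γ := γ) hy1, hw, map_sub]
    ring
  rw [hdiff, Real.norm_eq_abs, abs_mul, abs_pow, abs_pow]
  calc _ ≤ (|(m : ℝ)| ^ k) ^ j * (A * (C * r ^ k *
        (((box s R).card * D + (box s R).card * D') * ∏ i, ‖v i‖))) := by
        gcongr
        exact (hE a ha c A hA w hwm hws k γ).trans (by gcongr)
    _ = _ := by rw [mul_pow, ← pow_mul, ← pow_mul, mul_comm k j]; ring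

/-- The window of `D^{ℓ+1} f` itself lies in the decaying annihilator. The resulting bound may grow
with `k`, but supplies Lipschitz constants for the derivatives of order `ℓ`. -/
theorem norm_iteratedFDeriv_succ_approximant_le (hm : 2 ≤ |m|)
    (h𝒜 : ∀ a ∈ 𝒜, Reproducing m N ℓ a) {r : ℝ} (hr : 0 ≤ r)
    (hD : Decays m N (letters m 𝒜) (ℓ + 1) r) {f : Space s → ℝ} (hf : IsTestFunction ℓ f)
    (hf' : ContDiff ℝ (ℓ + 1 : ℕ) f) (ha : ∀ r, 1 ≤ r → a r ∈ 𝒜) (hA : ∀ α, |c α| ≤ A) :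
    ∃ C, ∀ k x, ‖iteratedFDeriv ℝ (ℓ + 1) (approximant m a c f k) x‖ ≤
      C * (|(m : ℝ)| ^ (ℓ + 1) * r) ^ k := by
  obtain ⟨R, hR⟩ := exists_covers hf.hasCompactSupport 1
  replace hR := hR R le_rfl
  obtain ⟨Q, hQ0, hQ⟩ := exists_box_subset_region s m N R
  obtain ⟨C, hC, hE⟩ := hD.abs_pairing_iterate_le hm (fun a ha => (h𝒜 a ha).supported) Q
  obtain ⟨D, hDf⟩ := (hf.hasCompactSupport.iteratedFDeriv (𝕜 := ℝ)
    (ℓ + 1)).exists_bound_of_continuous (hf'.continuous_iteratedFDeriv le_rfl)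
  have hD0 : 0 ≤ D := (norm_nonneg _).trans (hDf 0)
  have hA0 : 0 ≤ A := (abs_nonneg _).trans (hA 0)
  refine ⟨A * C * ((box s R).card * D), fun k x => ?_⟩
  refine ContinuousMultilinearMap.opNorm_le_bound (by positivity) fun v => ?_
  have hy1 := abs_sub_roundDown_le m k x
  rw [iteratedFDeriv_approximant hf' hf.hasCompactSupport hR hy1, Real.norm_eq_abs, abs_mul,
    abs_pow, abs_pow]
  calc _ ≤ (|(m : ℝ)| ^ k) ^ (ℓ + 1) * (A * (C * r ^ k *
        ((box s R).card * D * ∏ i, ‖v i‖))) := by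
        gcongr
        refine (hE a ha c A hA _ (hf.window_mem_annihilator hf' hR hy1 v)
          ((Finset.coe_subset.2 (support_window_subset f _ v R _)).trans hQ) k _).trans ?_
        gcongr
        exact l1_window_le hDf v R _
    _ = _ := by rw [mul_pow, ← pow_mul, ← pow_mul, mul_comm k (ℓ + 1)]; ring

theorem exists_norm_iteratedFDeriv_le {f : Space s → ℝ} {j : ℕ} (hf : ContDiff ℝ j f)
    (hfs : HasCompactSupport f) (hA : ∀ α, |c α| ≤ A) :
    ∃ C, ∀ x, ‖iteratedFDeriv ℝ j (approximant m a c f 0) x‖ ≤ C := by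
  obtain ⟨R, hR⟩ := exists_covers hfs 1
  replace hR := hR R le_rfl
  obtain ⟨D, hDf⟩ := (hfs.iteratedFDeriv (𝕜 := ℝ) j).exists_bound_of_continuous
    (hf.continuous_iteratedFDeriv le_rfl)
  have hD0 : 0 ≤ D := (norm_nonneg _).trans (hDf 0)
  have hA0 : 0 ≤ A := (abs_nonneg _).trans (hA 0)
  refine ⟨A * ((box s R).card * D), fun x => ?_⟩
  refine ContinuousMultilinearMap.opNorm_le_bound (by positivity) fun v => ?_
  rw [iteratedFDeriv_approximant hf hfs hR (abs_sub_roundDown_le m 0 x), pow_zero, one_pow,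
    one_mul, Real.norm_eq_abs, mul_assoc]
  exact (abs_pairing_le fun κ _ => hA _).trans
    (mul_le_mul_of_nonneg_left (l1_window_le hDf v R _) hA0)

end Estimates

/-! ### A smooth test function -/

/-- A smooth function on `ℝ` with support in `[-1, 1]` whose integer translates sum up to `1`. -/
def partitionBump (t : ℝ) : ℝ := Real.smoothTransition (t + 1) - Real.smoothTransition t

theorem partitionBump_eq_zero {t : ℝ} (ht : 1 ≤ |t|) : partitionBump t = 0 := by
  rw [partitionBump]
  rcases le_abs.1 ht with h | h
  · rw [Real.smoothTransition.one_of_one_le h, Real.smoothTransition.one_of_one_le (by linarith),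
      sub_self]
  · rw [Real.smoothTransition.zero_of_nonpos (by linarith : t ≤ 0),
      Real.smoothTransition.zero_of_nonpos (by linarith), sub_self]

theorem contDiff_partitionBump {n : ℕ∞} : ContDiff ℝ n partitionBump :=
  (Real.smoothTransition.contDiff.comp (contDiff_id.add contDiff_const)).sub
    Real.smoothTransition.contDiff

/-- A telescoping sum of smooth steps, in which only `n = ⌊t⌋` and `n = ⌊t⌋ + 1` contribute. -/
theorem hasSum_partitionBump (t : ℝ) : HasSum (fun n : ℤ => partitionBump (t - n)) 1 := by
  have h0 := Int.floor_le t
  have h1 := Int.lt_floor_add_one t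
  have hsum : ∑ n ∈ {⌊t⌋, ⌊t⌋ + 1}, partitionBump (t - (n : ℤ)) = 1 := by
    rw [Finset.sum_pair (by omega), partitionBump, partitionBump]
    push_cast
    rw [Real.smoothTransition.one_of_one_le (by linarith : 1 ≤ t - ⌊t⌋ + 1),
      Real.smoothTransition.zero_of_nonpos (by linarith : t - (⌊t⌋ + 1 : ℝ) ≤ 0)]
    rw [show t - ((⌊t⌋ : ℝ) + 1) + 1 = t - ⌊t⌋ by ring]
    ring
  rw [← hsum]
  refine hasSum_sum_of_ne_finset_zero fun n hn => partitionBump_eq_zero ?_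
  simp only [Finset.mem_insert, Finset.mem_singleton, not_or] at hn
  rcases lt_or_gt_of_ne hn.1 with h | h
  · have : (n : ℝ) + 1 ≤ ⌊t⌋ := by exact_mod_cast h
    rw [le_abs]; left; linarith
  · have h2 : ⌊t⌋ + 2 ≤ n := by omega
    have : (⌊t⌋ : ℝ) + 2 ≤ n := by exact_mod_cast h2
    rw [le_abs]; right; linarith

/-- The Lagrange polynomials for the nodes `0, …, ℓ`. -/
def lagrangePoly (ℓ i : ℕ) : Polynomial ℝ :=
  Lagrange.basis (Finset.range (ℓ + 1)) (fun n : ℕ => (n : ℝ)) i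

/-- Interpolation at the shifted nodes `b, …, b + ℓ` is exact on powers of degree at most `ℓ`. -/
theorem sum_pow_mul_lagrangePoly {ℓ d : ℕ} (hd : d ≤ ℓ) (b t : ℝ) :
    ∑ i ∈ Finset.range (ℓ + 1), (b + i) ^ d * (lagrangePoly ℓ i).eval (t - b) = t ^ d := by
  have h := Lagrange.eq_interpolate (s := Finset.range (ℓ + 1)) (v := fun n : ℕ => (n : ℝ))
    (f := (Polynomial.X + Polynomial.C b) ^ d) (Nat.cast_injective.injOn) (by
      rw [Polynomial.degree_pow, Polynomial.degree_X_add_C, Finset.card_range, nsmul_one]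
      exact_mod_cast Nat.lt_succ_of_le hd)
  have h2 := congrArg (Polynomial.eval (t - b)) h
  rw [Lagrange.interpolate_apply, Polynomial.eval_finsetSum] at h2
  simp only [Polynomial.eval_pow, Polynomial.eval_add, Polynomial.eval_X, Polynomial.eval_C,
    sub_add_cancel, Polynomial.eval_mul] at h2
  rw [h2]
  refine Finset.sum_congr rfl fun i _ => ?_
  rw [add_comm b]; rfl

/-- A smooth, compactly supported function on `ℝ` whose integer translates reproduce the polynomials
of degree at most `ℓ`. -/
def bump₁ (ℓ : ℕ) (t : ℝ) : ℝ :=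
  ∑ i ∈ Finset.range (ℓ + 1), partitionBump (t + i) * (lagrangePoly ℓ i).eval (t + i)

theorem bump₁_eq_zero {ℓ : ℕ} {t : ℝ} (ht : (ℓ + 1 : ℝ) ≤ |t|) : bump₁ ℓ t = 0 := by
  refine Finset.sum_eq_zero fun i hi => ?_
  have hi' : (i : ℝ) ≤ ℓ := by exact_mod_cast Nat.lt_succ_iff.1 (Finset.mem_range.1 hi)
  have hi0 : (0 : ℝ) ≤ i := i.cast_nonneg
  rw [partitionBump_eq_zero, zero_mul]
  rw [le_abs] at ht ⊢
  rcases ht with h | h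
  · left; linarith
  · right; linarith

theorem contDiff_bump₁ (ℓ : ℕ) {n : ℕ∞} : ContDiff ℝ n (bump₁ ℓ) := by
  refine ContDiff.sum fun i _ => ?_
  have h : ContDiff ℝ n fun t : ℝ => t + i := contDiff_id.add contDiff_const
  exact (contDiff_partitionBump.comp h).mul (((lagrangePoly ℓ i).contDiff_aeval n).comp h)

/-- After the shift `n ↦ n + i` the coefficient of `partitionBump (t - n)` is the interpolation of
`x^d` at the nodes `n, …, n + ℓ`, which equals `t^d`; the partition of unity does the rest. -/
theorem hasSum_pow_mul_bump₁ {ℓ d : ℕ} (hd : d ≤ ℓ) (t : ℝ) :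
    HasSum (fun n : ℤ => (n : ℝ) ^ d * bump₁ ℓ (t - n)) (t ^ d) := by
  have hfin : ∀ G : ℤ → ℝ, Summable fun n : ℤ => partitionBump (t - n) * G n := by
    intro G
    refine summable_of_hasFiniteSupport ((Set.finite_Icc ⌊t - 1⌋ ⌈t + 1⌉).subset fun n hn => ?_)
    by_contra h
    refine left_ne_zero_of_mul hn (partitionBump_eq_zero ?_)
    rw [Set.mem_Icc, not_and_or, not_le, not_le] at h
    rw [le_abs]
    rcases h with h | h
    · left
      have := Int.lt_floor_iff.1 h
      linarith
    · right
      have := Int.lt_ceil.not.1 (not_lt.2 h.le)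
      linarith
  have h1 : ∀ i ∈ Finset.range (ℓ + 1), HasSum (fun n : ℤ => (n : ℝ) ^ d *
      (partitionBump (t - n + i) * (lagrangePoly ℓ i).eval (t - n + i)))
      (∑' n : ℤ, partitionBump (t - n) * (((n : ℝ) + i) ^ d * (lagrangePoly ℓ i).eval (t - n))) := by
    intro i _
    have h2 := (hfin fun n => ((n : ℝ) + i) ^ d * (lagrangePoly ℓ i).eval (t - n)).hasSum
    rw [← (Equiv.subRight (i : ℤ)).hasSum_iff] at h2
    convert h2 using 1
    funext n
    simp only [Function.comp, Equiv.subRight_apply]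
    push_cast
    rw [show t - ((n : ℝ) - i) = t - n + i by ring, sub_add_cancel]
    ring
  have h3 := hasSum_sum h1
  simp only [← Finset.mul_sum] at h3
  rw [← Summable.tsum_finsetSum fun i _ => hfin _] at h3
  simp only [← Finset.mul_sum, sum_pow_mul_lagrangePoly hd] at h3
  rw [tsum_mul_right, (hasSum_partitionBump t).tsum_eq, one_mul] at h3
  exact h3

/-- The tensor product of the functions `bump₁`. -/
def testBump (s ℓ : ℕ) (x : Space s) : ℝ := ∏ i, bump₁ ℓ (x i)

theorem contDiff_testBump (s ℓ : ℕ) {n : ℕ∞} : ContDiff ℝ n (testBump s ℓ) :=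
  contDiff_prod fun i _ =>
    (contDiff_bump₁ ℓ).comp (EuclideanSpace.proj i : Space s →L[ℝ] ℝ).contDiff

theorem hasCompactSupport_testBump (s ℓ : ℕ) : HasCompactSupport (testBump s ℓ) := by
  have hK : IsCompact (Set.univ.pi fun _ : Fin s => Set.Icc (-(ℓ + 1 : ℝ)) (ℓ + 1)) :=
    isCompact_univ_pi fun _ => isCompact_Icc
  refine HasCompactSupport.intro
    (hK.image (EuclideanSpace.equiv (Fin s) ℝ).symm.continuous) fun x hx => ?_
  have hx' : ¬ ∀ i, x i ∈ Set.Icc (-(ℓ + 1 : ℝ)) (ℓ + 1) := fun h =>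
    hx ⟨fun i => x i, fun i _ => h i, rfl⟩
  push Not at hx'
  obtain ⟨i, hi⟩ := hx'
  refine Finset.prod_eq_zero (Finset.mem_univ i) (bump₁_eq_zero ?_)
  by_contra! h
  exact hi ⟨(abs_lt.1 h).1.le, (abs_lt.1 h).2.le⟩

/-- A monomial times a tensor product factors over the coordinates, each being the one-dimensional
reproduction formula. -/
theorem hasSum_evalInt_mul_testBump {ℓ : ℕ} {p : MvPolynomial (Fin s) ℝ}
    (hp : p ∈ polyLT s (ℓ + 1)) (x : Space s) :
    HasSum (fun α : Fin s → ℤ => evalInt p α * testBump s ℓ (x - intVec α)) (polyFun p x) := by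
  refine polyLT_induction (P := fun p => HasSum (fun α : Fin s → ℤ =>
    evalInt p α * testBump s ℓ (x - intVec α)) (polyFun p x)) ?_ ?_ ?_ hp
  · simp only [evalInt, polyFun, map_zero, zero_mul]
    exact hasSum_zero
  · intro p q h1 h2
    convert h1.add h2 using 1
    · funext α; simp [evalInt, add_mul]
    · simp [polyFun]
  · intro n c hn
    set S : Fin s → Finset ℤ := fun i => Finset.Icc ⌊x i - (ℓ + 1)⌋ ⌈x i + (ℓ + 1)⌉ with hS
    have hout : ∀ i, ∀ k : ℤ, k ∉ S i → bump₁ ℓ (x i - k) = 0 := by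
      intro i k hk
      refine bump₁_eq_zero ?_
      rw [hS, Finset.mem_Icc, not_and_or, not_le, not_le] at hk
      rw [le_abs]
      rcases hk with h | h
      · left
        have := Int.lt_floor_iff.1 h
        linarith
      · right
        have := Int.lt_ceil.not.1 (not_lt.2 h.le)
        linarith
    have hone : ∀ i, ∑ k ∈ S i, (k : ℝ) ^ n i * bump₁ ℓ (x i - k) = x i ^ n i := by
      intro i
      have hi : n i ≤ ℓ := Nat.lt_succ_iff.1 ((Finsupp.le_degree i n).trans_lt hn)
      rw [← (hasSum_pow_mul_bump₁ hi (x i)).tsum_eq, tsum_eq_sum]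
      intro k hk
      rw [hout i k hk, mul_zero]
    have heval : ∀ α : Fin s → ℤ, evalInt (MvPolynomial.monomial n c) α *
        testBump s ℓ (x - intVec α) =
        c * ∏ i, ((α i : ℝ) ^ n i * bump₁ ℓ (x i - α i)) := by
      intro α
      rw [evalInt, MvPolynomial.eval_monomial, Finsupp.prod_fintype _ _ (by simp), testBump,
        mul_assoc, ← Finset.prod_mul_distrib]
      rfl
    have hval : polyFun (MvPolynomial.monomial n c) x = ∑ α ∈ Fintype.piFinset S,
        evalInt (MvPolynomial.monomial n c) α * testBump s ℓ (x - intVec α) := by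
      simp only [heval]
      rw [← Finset.mul_sum, ← Finset.prod_univ_sum S fun i (k : ℤ) =>
        (k : ℝ) ^ n i * bump₁ ℓ (x i - k)]
      simp only [hone]
      rw [polyFun, MvPolynomial.eval_monomial, Finsupp.prod_fintype _ _ (by simp)]
    rw [hval]
    refine hasSum_sum_of_ne_finset_zero fun α hα => ?_
    rw [Fintype.mem_piFinset, not_forall] at hα
    obtain ⟨i, hi⟩ := hα
    rw [heval, Finset.prod_eq_zero (Finset.mem_univ i), mul_zero]
    rw [hout i _ hi, mul_zero]

theorem isTestFunction_testBump {s : ℕ} (ℓ : ℕ) {j : ℕ} (hj : j ≤ ℓ) :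
    IsTestFunction j (testBump s ℓ) where
  contDiff := by exact_mod_cast contDiff_testBump s ℓ (n := (j : ℕ∞))
  hasCompactSupport := hasCompactSupport_testBump s ℓ
  strangFix p hp := by
    refine ⟨0, Or.inl rfl, fun x => ?_⟩
    rw [add_zero]
    exact (hasSum_evalInt_mul_testBump (mem_polyLT_succ.2 (hp.trans hj)) x).tsum_eq

/-! ### Convergence -/

/-- All decay rates that follow from the decay with rate `ρ` on the annihilator of the polynomials
of degree at most `ℓ`. -/
theorem Decays.exists_rate {m : ℤ} (hm : 2 ≤ |m|) {N ℓ : ℕ} {𝒜 : Set (Mask s)} {B : ℝ}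
    (h𝒜 : ∀ a ∈ 𝒜, Reproducing m N ℓ a) (hB : ∀ a ∈ 𝒜, ∑ γ ∈ maskBox s N, |a γ| ≤ B)
    (hB0 : 0 ≤ B) {ρ : ℝ} (hρ0 : 0 ≤ ρ) (hρ : |(m : ℝ)| ^ ℓ * ρ < 1)
    (h : Decays m N (letters m 𝒜) (ℓ + 1) ρ) {j : ℕ} (hj : j ≤ ℓ) :
    ∃ r, 0 ≤ r ∧ Decays m N (letters m 𝒜) (j + 1) r ∧ |(m : ℝ)| ^ j * r < 1 := by
  have hM := two_le_abs_cast hm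
  rcases hj.eq_or_lt with rfl | hlt
  · exact ⟨ρ, hρ0, h, hρ⟩
  -- Below the top order, the rate on the annihilator of order `j + 1` leaves the factor `|m|^j r =
  -- 1/|m|`.
  · refine ⟨(|(m : ℝ)| ^ (j + 1))⁻¹, by positivity,
      h.of_le hm h𝒜 hB hB0 hρ0 ?_ hlt, ?_⟩
    · rwa [← lt_inv_mul_iff₀ (by positivity), mul_one] at hρ
    · rw [← div_eq_mul_inv, div_lt_one (by positivity)]
      exact pow_lt_pow_right₀ (by linarith) j.lt_succ_self

section Convergence

variable {m : ℤ} {N ℓ : ℕ} {𝒜 : Set (Mask s)} {a : ℕ → Mask s} {c : Mask s} {A : ℝ}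

/-- The increments of the approximants for `testBump` are summable in `C^ℓ`, so their telescoping
series has a `C^ℓ` sum. For any other test function the distance to these approximants tends to
zero. -/
theorem exists_isLimit (hm : 2 ≤ |m|) {B : ℝ}
    (h𝒜 : ∀ a ∈ 𝒜, Reproducing m N ℓ a) (hB : ∀ a ∈ 𝒜, ∑ γ ∈ maskBox s N, |a γ| ≤ B)
    (hB0 : 0 ≤ B) {ρ : ℝ} (hρ0 : 0 ≤ ρ) (hρ : |(m : ℝ)| ^ ℓ * ρ < 1)
    (hD : Decays m N (letters m 𝒜) (ℓ + 1) ρ) (ha : ∀ r, 1 ≤ r → a r ∈ 𝒜)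
    (hA : ∀ α, |c α| ≤ A) : ∃ g, IsLimit m ℓ a c g := by
  have hf := isTestFunction_testBump (s := s) ℓ le_rfl
  set f := testBump s ℓ
  set F := approximant m a c f with hF
  have hFc : ∀ k, ContDiff ℝ ℓ (F k) := fun k =>
    contDiff_approximant hf.contDiff hf.hasCompactSupport k
  have hFj : ∀ j ≤ ℓ, ∀ k, ContDiff ℝ j (F k) := fun j hj k =>
    (hFc k).of_le (by exact_mod_cast hj)
  -- The implication inside the existential makes the choice of bounds total in `j`, as the
  -- differentiation theorem for series expects.
  have hv : ∀ j, ∃ v : ℕ → ℝ, j ≤ ℓ → Summable v ∧ ∀ k x,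
      ‖iteratedFDeriv ℝ j (F (k + 1)) x - iteratedFDeriv ℝ j (F k) x‖ ≤ v k := by
    intro j
    by_cases hj : j ≤ ℓ
    · obtain ⟨r, hr0, hr, hr1⟩ := hD.exists_rate hm h𝒜 hB hB0 hρ0 hρ hj
      obtain ⟨C, hC⟩ := norm_iteratedFDeriv_approximant_succ_sub_le hm h𝒜 hB hB0 hj hr0 hr hf ha hA
      exact ⟨_, fun _ => ⟨(summable_geometric_of_lt_one (by positivity) hr1).mul_left C, hC⟩⟩
    · exact ⟨0, fun h => absurd h hj⟩
  choose v hv using hv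
  set Δ : ℕ → Space s → ℝ := fun k => F (k + 1) - F k with hΔ
  have hΔc : ∀ k, ContDiff ℝ ℓ (Δ k) := fun k => (hFc (k + 1)).sub (hFc k)
  have hΔj : ∀ j ≤ ℓ, ∀ k x, iteratedFDeriv ℝ j (Δ k) x =
      iteratedFDeriv ℝ j (F (k + 1)) x - iteratedFDeriv ℝ j (F k) x := fun j hj k x =>
    iteratedFDeriv_sub_apply (hFj j hj _).contDiffAt (hFj j hj _).contDiffAt
  have hsum : ∀ j : ℕ, (j : ℕ∞) ≤ (ℓ : ℕ∞) → Summable (v j) := fun j hj =>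
    (hv j (by exact_mod_cast hj)).1
  have hbound : ∀ (j k : ℕ) (x : Space s), (j : ℕ∞) ≤ (ℓ : ℕ∞) →
      ‖iteratedFDeriv ℝ j (Δ k) x‖ ≤ v j k := fun j k x hj => by
    have hj' : j ≤ ℓ := by exact_mod_cast hj
    rw [hΔj j hj']
    exact (hv j hj').2 k x
  have hΔc' : ∀ k, ContDiff ℝ ((ℓ : ℕ∞) : WithTop ℕ∞) (Δ k) := hΔc
  have hts := contDiff_tsum hΔc' hsum hbound
  set S : Space s → ℝ := fun x => ∑' k, Δ k x with hS
  have hSc : ContDiff ℝ ℓ S := hts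
  have hlim : ∀ j ≤ ℓ, TendstoUniformly (fun k x => iteratedFDeriv ℝ j (F k) x)
      (iteratedFDeriv ℝ j (F 0 + S)) atTop := by
    intro j hj
    have hj' : (j : ℕ∞) ≤ (ℓ : ℕ∞) := by exact_mod_cast hj
    have h1 := tendstoUniformly_tsum_nat (hsum j hj') (fun k x => hbound j k x hj')
    rw [Metric.tendstoUniformly_iff] at h1 ⊢
    intro ε hε
    filter_upwards [h1 ε hε] with n hn x
    have h2 := hn x
    rw [← iteratedFDeriv_tsum_apply hΔc' hsum hbound hj' x] at h2
    have h3 : ∑ k ∈ Finset.range n, iteratedFDeriv ℝ j (Δ k) x =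
        iteratedFDeriv ℝ j (F n) x - iteratedFDeriv ℝ j (F 0) x := by
      simp only [hΔj j hj]
      exact Finset.sum_range_sub (fun k => iteratedFDeriv ℝ j (F k) x) n
    rw [h3] at h2
    rw [iteratedFDeriv_add_apply (hFj j hj 0).contDiffAt
      (hSc.of_le (by exact_mod_cast hj)).contDiffAt]
    rw [dist_eq_norm] at h2 ⊢
    convert h2 using 2
    rw [hS]
    abel
  refine ⟨F 0 + S, (hFc 0).add hSc, fun f' hf' j hj => ?_⟩
  obtain ⟨r, hr0, hr, hr1⟩ := hD.exists_rate hm h𝒜 hB hB0 hρ0 hρ hj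
  obtain ⟨C, hC⟩ := norm_iteratedFDeriv_approximant_sub_le hm h𝒜 hj hr0 hr hf' hf ha hA
  have h1 := hlim j hj
  rw [Metric.tendstoUniformly_iff] at h1 ⊢
  intro ε hε
  have h2 : Tendsto (fun k => C * (|(m : ℝ)| ^ j * r) ^ k) atTop (𝓝 0) := by
    simpa using (tendsto_pow_atTop_nhds_zero_of_lt_one (by positivity) hr1).const_mul C
  filter_upwards [h1 (ε / 2) (half_pos hε), h2.eventually_lt_const (half_pos hε)] with k hk hk' x
  refine (dist_triangle _ (iteratedFDeriv ℝ j (F k) x) _).trans_lt ?_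
  have h3 : dist (iteratedFDeriv ℝ j (F k) x) (iteratedFDeriv ℝ j (approximant m a c f' k) x) <
      ε / 2 := by
    rw [dist_comm, dist_eq_norm]
    exact (hC k x).trans_lt hk'
  linarith [hk x]

/-- A single bump is a test function for both orders, so the pointwise limits agree. In particular,
limit functions in the `C^0` sense are the `C^ℓ` limits. -/
theorem IsLimit.unique {n n' : ℕ} {g g' : Space s → ℝ} (h : IsLimit m n a c g)
    (h' : IsLimit m n' a c g') : g = g' := by
  funext x
  have h1 := (h.2 _ (isTestFunction_testBump (s := s) (max n n') (le_max_left _ _)) 0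
    (Nat.zero_le _)).tendsto_at x
  have h2 := (h'.2 _ (isTestFunction_testBump (s := s) (max n n') (le_max_right _ _)) 0
    (Nat.zero_le _)).tendsto_at x
  have h3 := tendsto_nhds_unique h1 h2
  rw [← iteratedFDeriv_zero_apply (𝕜 := ℝ) (f := g) (x := x) 0, h3, iteratedFDeriv_zero_apply]

/-! ### Hölder regularity -/

/-- Interpolation between a sup bound and a Lipschitz bound, from `min(2, d) ≤ 2 d^ν` with `d = t ‖x
- y‖`. -/
theorem norm_sub_le_rpow {E F : Type*} [SeminormedAddCommGroup E] [SeminormedAddCommGroup F]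
    {φ : E → F} {P t ν : ℝ} (hP : 0 ≤ P) (ht : 0 ≤ t) (hν0 : 0 ≤ ν) (hν1 : ν ≤ 1)
    (h0 : ∀ x, ‖φ x‖ ≤ P) (h1 : ∀ x y, ‖φ x - φ y‖ ≤ P * t * ‖x - y‖) (x y : E) :
    ‖φ x - φ y‖ ≤ 2 * P * t ^ ν * ‖x - y‖ ^ ν := by
  rw [mul_assoc, ← Real.mul_rpow ht (norm_nonneg _)]
  set d := t * ‖x - y‖ with hd
  have hd0 : 0 ≤ d := by positivity
  rcases le_total d 1 with h | h
  · have h2 : d ≤ d ^ ν := by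
      rcases hd0.eq_or_lt with h3 | h3
      · rw [← h3]; exact Real.rpow_nonneg le_rfl _
      · simpa using Real.rpow_le_rpow_of_exponent_ge h3 h hν1
    calc ‖φ x - φ y‖ ≤ P * d := by rw [hd, ← mul_assoc]; exact h1 x y
      _ ≤ P * d ^ ν := by gcongr
      _ ≤ 2 * P * d ^ ν := by
        have : 0 ≤ P * d ^ ν := mul_nonneg hP (Real.rpow_nonneg hd0 _)
        linarith
  · calc ‖φ x - φ y‖ ≤ ‖φ x‖ + ‖φ y‖ := norm_sub_le _ _
      _ ≤ 2 * P := by linarith [h0 x, h0 y]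
      _ ≤ 2 * P * d ^ ν := le_mul_of_one_le_right (by positivity) (Real.one_le_rpow h hν0)

theorem norm_iteratedFDeriv_sub_le {E F : Type*} [NormedAddCommGroup E] [NormedSpace ℝ E]
    [NormedAddCommGroup F] [NormedSpace ℝ F] {f : E → F} {n : ℕ} (hf : ContDiff ℝ (n + 1 : ℕ) f)
    {C : ℝ} (hC : ∀ x, ‖iteratedFDeriv ℝ (n + 1) f x‖ ≤ C) (x y : E) :
    ‖iteratedFDeriv ℝ n f x - iteratedFDeriv ℝ n f y‖ ≤ C * ‖x - y‖ := by
  refine Convex.norm_image_sub_le_of_norm_fderiv_le (𝕜 := ℝ) (s := Set.univ) (fun z _ => ?_)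
    (fun z _ => ?_) convex_univ trivial trivial
  · exact (hf.differentiable_iteratedFDeriv (by exact_mod_cast n.lt_succ_self)) z
  · rw [norm_fderiv_iteratedFDeriv]; exact hC z

/-- With `q = |m|^ℓ ρ`, the `k`-th increment of the `ℓ`-th derivatives is `O(q^k)` with Lipschitz
constant `O((q|m|)^k)`. Interpolation gives the `ν`-Hölder constant `O((q|m|^ν)^k)`, a convergent
geometric series. -/
theorem IsLimit.holderDeriv (hm : 2 ≤ |m|) {B : ℝ}
    (h𝒜 : ∀ a ∈ 𝒜, Reproducing m N ℓ a) (hB : ∀ a ∈ 𝒜, ∑ γ ∈ maskBox s N, |a γ| ≤ B)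
    (hB0 : 0 ≤ B) {ρ : ℝ} (hρ0 : 0 ≤ ρ)
    (hD : Decays m N (letters m 𝒜) (ℓ + 1) ρ) (ha : ∀ r, 1 ≤ r → a r ∈ 𝒜)
    (hA : ∀ α, |c α| ≤ A) {g : Space s → ℝ} (hg : IsLimit m ℓ a c g) {ν : ℝ} (hν0 : 0 ≤ ν)
    (hν1 : ν ≤ 1) (hρ : |(m : ℝ)| ^ ℓ * ρ * |(m : ℝ)| ^ ν < 1) : HolderDeriv ℓ ν g := by
  have hM := two_le_abs_cast hm
  have hf := isTestFunction_testBump (s := s) ℓ le_rfl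
  have hfs : ∀ n : ℕ, ContDiff ℝ n (testBump s ℓ) := fun n => by
    exact_mod_cast contDiff_testBump s ℓ (n := (n : ℕ∞))
  set f := testBump s ℓ
  set F := approximant m a c f with hF
  have hFs : ∀ n k : ℕ, ContDiff ℝ n (F k) := fun n k =>
    contDiff_approximant (hfs n) hf.hasCompactSupport k
  set M := |(m : ℝ)| with hMdef
  set q := M ^ ℓ * ρ with hq
  have hq0 : 0 ≤ q := by positivity
  obtain ⟨C₁, hC₁⟩ := norm_iteratedFDeriv_approximant_succ_sub_le hm h𝒜 hB hB0 le_rfl hρ0 hD hf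
    ha hA
  obtain ⟨C₂, hC₂⟩ := norm_iteratedFDeriv_succ_approximant_le hm h𝒜 hρ0 hD hf (hfs _) ha hA
  obtain ⟨C₃, hC₃⟩ := exists_norm_iteratedFDeriv_le (m := m) (a := a) (hfs ℓ) hf.hasCompactSupport
    hA
  have hC₁0 : 0 ≤ C₁ := by simpa using (norm_nonneg _).trans (hC₁ 0 0)
  have hC₂0 : 0 ≤ C₂ := by simpa using (norm_nonneg _).trans (hC₂ 0 0)
  have hC₃0 : 0 ≤ C₃ := (norm_nonneg _).trans (hC₃ 0)
  have hMq : M ^ (ℓ + 1) * ρ = q * M := by rw [hq]; ring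
  set D : ℕ → Space s → _ := fun k => iteratedFDeriv ℝ ℓ (F k) with hDdef
  have hlip : ∀ k x y, ‖D k x - D k y‖ ≤ C₂ * (q * M) ^ k * ‖x - y‖ := by
    intro k
    refine norm_iteratedFDeriv_sub_le (hFs (ℓ + 1) k) fun x => ?_
    rw [← hMq]; exact hC₂ k x
  have hzero : ∀ x y, ‖D 0 x - D 0 y‖ ≤ 2 * (C₃ + C₂) * ‖x - y‖ ^ ν := by
    intro x y
    have h1 := norm_sub_le_rpow (φ := D 0) (P := C₃ + C₂) (t := 1) (by positivity) zero_le_one hν0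
      hν1 (fun x => (hC₃ x).trans (by linarith)) (fun x y => ?_) x y
    · simpa using h1
    · refine (hlip 0 x y).trans ?_
      rw [pow_zero]
      gcongr
      linarith
  set P := C₁ + C₂ * (q * M + 1) with hP
  have hP0 : 0 ≤ P := by positivity
  have hstep : ∀ k x y, ‖(D (k + 1) x - D k x) - (D (k + 1) y - D k y)‖ ≤
      2 * P * (q * M ^ ν) ^ k * ‖x - y‖ ^ ν := by
    intro k x y
    have h1 := norm_sub_le_rpow (φ := fun x => D (k + 1) x - D k x) (P := P * q ^ k) (t := M ^ k)
      (by positivity) (by positivity) hν0 hν1 (fun x => ?_) (fun x y => ?_) x y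
    · refine h1.trans (le_of_eq ?_)
      rw [mul_pow q, Real.rpow_pow_comm (by positivity)]
      ring
    · refine (hC₁ k x).trans ?_
      gcongr
      have : 0 ≤ C₂ * (q * M + 1) := by positivity
      linarith
    · rw [sub_sub_sub_comm]
      refine (norm_sub_le _ _).trans ((add_le_add (hlip (k + 1) x y) (hlip k x y)).trans ?_)
      rw [← add_mul]
      gcongr
      calc C₂ * (q * M) ^ (k + 1) + C₂ * (q * M) ^ k = C₂ * (q * M + 1) * (q ^ k * M ^ k) := by
            rw [pow_succ, mul_pow]; ring
        _ ≤ P * (q ^ k * M ^ k) := by gcongr; linarith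
        _ = P * q ^ k * M ^ k := by ring
  have hqν0 : 0 ≤ q * M ^ ν := mul_nonneg hq0 (Real.rpow_nonneg (by positivity) _)
  refine ⟨2 * (C₃ + C₂) + 2 * P * (1 - q * M ^ ν)⁻¹, fun x y => ?_⟩
  have hall : ∀ n, ‖D n x - D n y‖ ≤
      (2 * (C₃ + C₂) + 2 * P * (1 - q * M ^ ν)⁻¹) * ‖x - y‖ ^ ν := by
    intro n
    have h1 : D n x - D n y = (D 0 x - D 0 y) +
        ∑ k ∈ Finset.range n, ((D (k + 1) x - D k x) - (D (k + 1) y - D k y)) := by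
      rw [Finset.sum_sub_distrib, Finset.sum_range_sub (fun k => D k x),
        Finset.sum_range_sub (fun k => D k y)]
      abel
    rw [h1, add_mul]
    refine (norm_add_le _ _).trans (add_le_add (hzero x y) ?_)
    refine (norm_sum_le _ _).trans ((Finset.sum_le_sum fun k _ => hstep k x y).trans ?_)
    rw [← Finset.sum_mul, ← Finset.mul_sum]
    gcongr
    rw [← tsum_geometric_of_lt_one hqν0 hρ]
    exact (summable_geometric_of_lt_one hqν0 hρ).sum_le_tsum _ fun k _ => pow_nonneg hqν0 k
  have ht := (hg.2 f hf ℓ le_rfl)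
  refine le_of_tendsto ((ht.tendsto_at x).sub (ht.tendsto_at y)).norm
    (Eventually.of_forall hall)

end Convergence

/-- Every function on a point is constant, so no largest order of smoothness exists. -/
theorem holderExponent_eq_top_of_subsingleton [Subsingleton (Space s)] (m : ℤ) (a : ℕ → Mask s) :
    holderExponent m a = ⊤ := by
  refine top_le_iff.1 ?_
  rw [← ENNReal.iSup_natCast]
  refine iSup_le fun n => le_iSup₂_of_le n (fun g _ => ?_) le_self_add
  rw [show g = fun _ => g 0 from funext fun x => congrArg g (Subsingleton.elim x 0)]
  exact contDiff_const

/-- The supremum need not be attained: all exponents strictly below `ν₀` suffice. -/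
theorem le_holderExponent {m : ℤ} {a : ℕ → Mask s} {n : ℕ} {ν₀ : ℝ≥0∞}
    (hn : ∀ g ∈ limitFunctions m a, ContDiff ℝ n g)
    (hν : ∀ ν : ℝ≥0, (ν : ℝ≥0∞) < ν₀ → ν ≤ 1 ∧ ∀ g ∈ limitFunctions m a, HolderDeriv n ν g) :
    n + ν₀ ≤ holderExponent m a := by
  refine le_iSup₂_of_le n hn ?_
  gcongr
  refine le_of_forall_lt_imp_le_of_dense fun b hb => ?_
  lift b to ℝ≥0 using hb.ne_top
  exact le_iSup₂_of_le (f := fun (ν : ℝ≥0) (_ : ν ≤ 1 ∧ ∀ g ∈ limitFunctions m a,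
    HolderDeriv n ν g) => (ν : ℝ≥0∞)) b (hν b hb) le_rfl

end Subdivision

end

/-! ### The main theorem: assembling decay, convergence and the Hölder exponent -/

open Subdivision in
theorem theorem3p5 (s : ℕ) (m : ℤ) (hm : 2 ≤ |m|) (N ℓ : ℕ) (ω₁ ω₂ : ℝ) (hω : ω₁ < ω₂)
    (a : ℝ → Subdivision.Mask s)
    (hsupp : ∀ ω ∈ Set.Icc ω₁ ω₂, Subdivision.SupportedIn N (a ω))
    (hlin : ∃ b d : Subdivision.Mask s, ∀ ω ∈ Set.Icc ω₁ ω₂, ∀ α, a ω α = b α + ω * d α)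
    (hsum : ∀ ω ∈ Set.Icc ω₁ ω₂, Subdivision.SumRules m N ℓ (a ω))
    (γ : ℝ≥0∞)
    (hγ : Subdivision.jointSpectralRadius
      (Subdivision.restrictedFamily m N ℓ {a ω₁, a ω₂}) = γ)
    (hγlt : γ < ((m.natAbs : ℝ≥0∞) ^ ℓ)⁻¹)
    (ω : ℕ → ℝ) (hωr : ∀ r, 1 ≤ r → ω r ∈ Set.Icc ω₁ ω₂) :
    Subdivision.IsConvergent m ℓ (fun r => a (ω r)) ∧
    -(ENNReal.log γ) / ((Real.log |(m : ℝ)| : ℝ) : EReal) ≤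
      ((Subdivision.holderExponent m (fun r => a (ω r)) : ℝ≥0∞) : EReal) := by
  have hM := two_le_abs_cast hm
  have hm0 : m ≠ 0 := by rintro rfl; norm_num at hm
  have h₁ : ω₁ ∈ Set.Icc ω₁ ω₂ := Set.left_mem_Icc.2 hω.le
  have h₂ : ω₂ ∈ Set.Icc ω₁ ω₂ := Set.right_mem_Icc.2 hω.le
  set 𝒜 : Set (Mask s) := a '' Set.Icc ω₁ ω₂
  have hrep : ∀ x ∈ 𝒜, Reproducing m N ℓ x := by
    rintro _ ⟨t, ht, rfl⟩
    exact (hsum t ht).reproducing hm0 (hsupp t ht)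
  have hseg : 𝒜 ⊆ segment ℝ (a ω₁) (a ω₂) := by
    rintro _ ⟨t, ht, rfl⟩
    obtain ⟨b, d, hbd⟩ := hlin
    have hpos : 0 < ω₂ - ω₁ := sub_pos.2 hω
    refine ⟨(ω₂ - t) / (ω₂ - ω₁), (t - ω₁) / (ω₂ - ω₁), div_nonneg (sub_nonneg.2 ht.2) hpos.le,
      div_nonneg (sub_nonneg.2 ht.1) hpos.le, ?_, ?_⟩
    · rw [← add_div, sub_add_sub_cancel, div_self hpos.ne']
    · funext α
      simp only [Pi.add_apply, Pi.smul_apply, smul_eq_mul, hbd _ h₁, hbd _ h₂, hbd _ ht]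
      field_simp
      ring
  set B := ∑ γ ∈ maskBox s N, |a ω₁ γ| + ∑ γ ∈ maskBox s N, |a ω₂ γ|
  have hB : ∀ x ∈ 𝒜, ∑ γ ∈ maskBox s N, |x γ| ≤ B := fun x hx =>
    sum_abs_le_of_mem_segment (hseg hx)
  have hB0 : 0 ≤ B := by positivity
  have ha : ∀ r, 1 ≤ r → a (ω r) ∈ 𝒜 := fun r hr => ⟨_, hωr r hr, rfl⟩
  -- Every rate above `γ` is available for the whole parameter interval, so `ρ` can later be taken
  -- arbitrarily close to `γ`.
  have hdec : ∀ ρ : ℝ≥0, γ < ρ → Decays m N (letters m 𝒜) (ℓ + 1) ρ := by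
    intro ρ hρ
    have hρ0 : (0 : ℝ) < ρ := by
      have : (0 : ℝ≥0∞) < ρ := bot_le.trans_lt hρ
      exact_mod_cast this
    refine decays_of_jointSpectralRadius_lt hm (hrep _ ⟨_, h₁, rfl⟩) (hrep _ ⟨_, h₂, rfl⟩) hseg hrep
      hρ0 ?_
    rw [hγ, ENNReal.ofReal_coe_nnreal]
    exact hρ
  have hMnn : ((m.natAbs : ℝ≥0) : ℝ) = |(m : ℝ)| := by
    rw [NNReal.coe_natCast, Nat.cast_natAbs, Int.cast_abs]
  have hMne : (m.natAbs : ℝ≥0) ≠ 0 := by simpa using hm0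
  obtain ⟨ρ, hρ1, hρ2⟩ := ENNReal.lt_iff_exists_nnreal_btwn.1 hγlt
  have hρ3 : |(m : ℝ)| ^ ℓ * ρ < 1 := by
    have h1 : (ρ : ℝ≥0∞) < (((m.natAbs : ℝ≥0) ^ ℓ)⁻¹ : ℝ≥0) := by
      rw [ENNReal.coe_inv (pow_ne_zero _ hMne)]
      push_cast
      exact hρ2
    have h2 : (ρ : ℝ) < (((m.natAbs : ℝ≥0) ^ ℓ)⁻¹ : ℝ≥0) := by exact_mod_cast h1
    rw [NNReal.coe_inv, NNReal.coe_pow, hMnn] at h2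
    rwa [← lt_inv_mul_iff₀ (by positivity), mul_one]
  have hconv : IsConvergent m ℓ fun r => a (ω r) := fun c ⟨A, hA⟩ =>
    exists_isLimit hm hrep hB hB0 ρ.2 hρ3 (hdec ρ hρ1) ha hA
  refine ⟨hconv, ?_⟩
  have hlimit : ∀ g ∈ limitFunctions m (fun r => a (ω r)), ∃ c A, (∀ α, |c α| ≤ A) ∧
      IsLimit m ℓ (fun r => a (ω r)) c g := by
    rintro g ⟨c, ⟨A, hA⟩, hg⟩
    obtain ⟨g', hg'⟩ := hconv c ⟨A, hA⟩
    exact ⟨c, A, hA, hg.unique hg' ▸ hg'⟩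
  -- Dimension zero is the only case in which `γ = 0` could occur; in positive dimension the lower
  -- bound on decay rates forces `γ > 0`.
  rcases Nat.eq_zero_or_pos s with rfl | hs
  · rw [holderExponent_eq_top_of_subsingleton]
    exact le_top
  have hlow : ∀ ρ : ℝ≥0, γ < ρ → (|(m : ℝ)| ^ (ℓ + 1))⁻¹ ≤ ρ := fun ρ hρ =>
    Decays.inv_pow_le hm (Set.mem_image_of_mem a h₁) (hrep _ (Set.mem_image_of_mem a h₁)) ⟨0, hs⟩
      ρ.2 (hdec ρ hρ)
  lift γ to ℝ≥0 using hγlt.ne_top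
  have hγlow : (|(m : ℝ)| ^ (ℓ + 1))⁻¹ ≤ γ := by
    refine le_of_forall_gt_imp_ge_of_dense fun t ht => ?_
    have ht0 : 0 ≤ t := γ.2.trans ht.le
    lift t to ℝ≥0 using ht0
    exact hlow t (by exact_mod_cast ht)
  have hγ0 : (0 : ℝ) < γ := lt_of_lt_of_le (by positivity) hγlow
  have hγρ : (γ : ℝ) < ρ := by exact_mod_cast hρ1
  have hlogM : 0 < Real.log |(m : ℝ)| := Real.log_pos (by linarith)
  -- The target exponent. The lower bound on `γ` gives `θ ≤ ℓ + 1`, so any `ν < θ - ℓ` is admissible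
  -- as a Hölder exponent; the hypothesis on `γ` gives `θ ≥ ℓ`.
  set θ : ℝ := -Real.log γ / Real.log |(m : ℝ)| with hθ
  have hγθ : (γ : ℝ) = |(m : ℝ)| ^ (-θ) := by
    rw [Real.rpow_def_of_pos (by positivity), hθ, mul_neg, mul_div_cancel₀ _ hlogM.ne', neg_neg,
      Real.exp_log hγ0]
  have hθ1 : θ ≤ ℓ + 1 := by
    rw [hγθ, ← Real.rpow_natCast, ← Real.rpow_neg (by positivity),
      Real.rpow_le_rpow_left_iff (by linarith)] at hγlow
    push_cast at hγlow
    linarith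
  have hθ0 : (ℓ : ℝ) ≤ θ := by
    have h1 : (γ : ℝ) ≤ (|(m : ℝ)| ^ ℓ)⁻¹ := by
      refine hγρ.le.trans ?_
      rw [← lt_inv_mul_iff₀ (by positivity), mul_one] at hρ3
      exact hρ3.le
    rw [hγθ, ← Real.rpow_natCast, ← Real.rpow_neg (by positivity),
      Real.rpow_le_rpow_left_iff (by linarith)] at h1
    linarith
  have hmain : (ℓ : ℝ≥0∞) + ENNReal.ofReal (θ - ℓ) ≤ holderExponent m fun r => a (ω r) := by
    refine le_holderExponent (fun g hg => ?_) fun ν hν => ?_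
    · obtain ⟨c, A, _, hg⟩ := hlimit g hg
      exact hg.1
    · have hν' : (ν : ℝ) < θ - ℓ := by
        rwa [ENNReal.ofReal, ENNReal.coe_lt_coe, ← NNReal.coe_lt_coe,
          Real.coe_toNNReal _ (sub_nonneg.2 hθ0)] at hν
      have hν1 : (ν : ℝ) ≤ 1 := by linarith
      refine ⟨by exact_mod_cast hν1, fun g hg => ?_⟩
      obtain ⟨c, A, hA, hg⟩ := hlimit g hg
      -- Since `ℓ + ν < θ`, a rate `t` fits strictly between `γ` and `|m|^{-(ℓ+ν)}`: large enough
      -- for decay, small enough for a convergent geometric series.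
      have hlt : (γ : ℝ) < |(m : ℝ)| ^ (-(ℓ + ν : ℝ)) := by
        rw [hγθ, Real.rpow_lt_rpow_left_iff (by linarith)]
        linarith
      obtain ⟨t, ht1, ht2⟩ := exists_between hlt
      have ht0 : 0 ≤ t := hγ0.le.trans ht1.le
      refine hg.holderDeriv hm hrep hB hB0 ht0 ?_ ha hA ν.2 hν1 ?_
      · lift t to ℝ≥0 using ht0
        exact hdec t (by exact_mod_cast ht1)
      · calc |(m : ℝ)| ^ ℓ * t * |(m : ℝ)| ^ (ν : ℝ) = |(m : ℝ)| ^ (ℓ + ν : ℝ) * t := by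
              rw [Real.rpow_add (by positivity), Real.rpow_natCast]
              ring
          _ < |(m : ℝ)| ^ (ℓ + ν : ℝ) * |(m : ℝ)| ^ (-(ℓ + ν : ℝ)) := by gcongr
          _ = 1 := by rw [← Real.rpow_add (by positivity), add_neg_cancel, Real.rpow_zero]
  have hcast : -(ENNReal.log (γ : ℝ≥0∞)) / ((Real.log |(m : ℝ)| : ℝ) : EReal) = (θ : EReal) := by
    rw [← ENNReal.ofReal_coe_nnreal, ENNReal.log_ofReal_of_pos hγ0, ← EReal.coe_neg,
      ← EReal.coe_div]
  have hsplit : (ℓ : ℝ≥0∞) + ENNReal.ofReal (θ - ℓ) = ENNReal.ofReal θ := by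
    rw [← ENNReal.ofReal_natCast, ← ENNReal.ofReal_add (Nat.cast_nonneg _) (sub_nonneg.2 hθ0),
      add_sub_cancel]
  rw [hsplit, ← EReal.coe_ennreal_le_coe_ennreal_iff, EReal.coe_ennreal_ofReal] at hmain
  rw [hcast]
  -- The conversion from `ENNReal.ofReal` leaves `max θ 0`, which is at least `θ`.
  exact (EReal.coe_le_coe_iff.2 (le_max_left _ _)).trans hmain
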